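/- **Interval exchanges.** An (abstract) interval exchange $\tau$ with $n$ bands is a pair of lists, "top" and "bottom", of band labels in which each of the $n$ labels occurs exactly twice in total; the lists record, from left to right, where the ends of $n$ untwisted bands are glued to the top and bottom of a thickened interval. A band with both ends on the same side is called orientation reversing, otherwise orientation preserving. Its cone of weights is $$\mathcal{ML}(\tau,\mathbb R)=\Big\{w\in\mathbb R_{\ge 0}^n : \sum_{\text{top ends } e} w_e=\sum_{\text{bottom ends } e} w_e\Big\},$$ with Lebesgue measure coming from the linear space cut out by this switch condition. The exchange $\tau$ is *recurrent* if some $w\in\mathcal{ML}(\tau,\mathbb R)$ is positive on every band. Gluing discs to all boundary circles of the union of the thickened interval and the bands gives a closed surface; these discs are the complementary regions, and the gaps between consecutive band ends along the boundary of the thickened interval, other than the two gaps containing its vertical sides, are the cusps of these regions. Call $\tau$ a *complete genus 2 interval exchange* if it is recurrent, every complementary region has exactly three cusps (is an ideal triangle), and the closed surface has genus 2. Let $\mathcal I$ be the set of complete genus 2 interval exchanges up to abstract isomorphism, i.e. up to relabeling the bands and interchanging top and bottom. **Splitting.** Let $w\in\mathcal{ML}(\tau,\mathbb R)$, and let $t$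 and $b$ be the rightmost bands on top and bottom. If $w_t>w_b$, then $(\tau,w)\searrow(\tau',w')$, where $\tau'$ is obtained by removing the rightmost bottom end of $b$ and reinserting it next to the other end of $t$ (immediately to its right if $t$ is orientation preserving, immediately to its left if $t$ is orientation reversing), $w'_t=w_t-w_b$, and all other weights are unchanged. If $w_t<w_b$, the mirror image of this operation (exchanging the roles of top and bottom) is performed. In the corner case $w_t=w_b$ no splitting is defined. Write $\tau\searrow\tau'$ if $(\tau,w)\searrow(\tau',w')$ for some $w\in\mathcal{ML}(\tau,\mathbb R)$ and some $w'$; this makes $\mathcal I$ a directed graph. The *sink* is $$\mathcal I_S=\{\tau\in\mathcal I : \text{for every }\sigma\in\mathcal I\text{ there is a directed path in } \mathcal I\text{ from }\sigma\text{ to }\tau\},$$ and $X_S=\coprod_{\tau\in\mathcal I_S}\mathcal{ML}(\tau,\mathbb R)$. **Theorem 10.3.** The splitting transformation on $X_S$ is normal: $\mathcal I_S$ is non-empty, and for every finite splitting sequence $\sigma_1\searrow\sigma_2\searrow\cdots\searrow\sigma_m$ contained in $\mathcal I_S$, for almost every $(\tau,w)\in X_S$ the infinite splitting sequence of $(\tau,w)$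 is defined (the corner case never occurs) and $\sigma_1,\dots,\sigma_m$ occur consecutively in it (as elements of $\mathcal I$) infinitely often. Moreover, the standard exchange $$\tau_0=\frac{1\,2\,3\,4\,2\,3\,4}{5\,6\,7\,5\,6\,7\,1}$$ lies in the sink $\mathcal I_S$. -/

import Mathlib

open MeasureTheory Filter

/-- A labeled (abstract) interval exchange with `n` bands, given by the lists of the bands
attached to the top and to the bottom of the base interval, each read from left to right.
Every band has two ends, so every label occurs exactly twice in the two lists together.
A band occurring once on each side is orientation preserving, a band occurring twice on
one side is orientation reversing. -/
@[ext]
structure IntervalExchange (n : ℕ) where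
  top : List (Fin n)
  bottom : List (Fin n)
  count_eq_two : ∀ i, (top ++ bottom).count i = 2

namespace IntervalExchange

variable {n : ℕ}

/-! ### Weights -/

/-- The vectors satisfying the switch condition: the total width of the band ends
attached to the top equals the total width of those attached to the bottom. -/
def switchSpace (τ : IntervalExchange n) : Submodule ℝ (Fin n → ℝ) where
  carrier := {w | (τ.top.map fun i => w i).sum = (τ.bottom.map fun i => w i).sum}
  add_mem' := by
    intro a b (ha : _ = _) (hb : _ = _)
    change (τ.top.map fun i => a i + b i).sum = (τ.bottom.map fun i => a i + b i).sum
    rw [List.sum_map_add, List.sum_map_add, ha, hb]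
  zero_mem' := by
    change (τ.top.map fun _ => (0 : ℝ)).sum = (τ.bottom.map fun _ => (0 : ℝ)).sum
    simp
  smul_mem' := by
    intro c a (ha : _ = _)
    change (τ.top.map fun i => c * a i).sum = (τ.bottom.map fun i => c * a i).sum
    rw [List.sum_map_mul_left, List.sum_map_mul_left, ha]

/-- `ML(τ, ℝ)`: the cone of weights, i.e. nonnegative vectors satisfying the switch condition. -/
def ML (τ : IntervalExchange n) : Set (Fin n → ℝ) :=
  {w | w ∈ τ.switchSpace ∧ ∀ i, 0 ≤ w i}

/-- Lebesgue measure on the linear space spanned by the weights (normalized as a Haar measure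
of this finite dimensional space; the normalization does not affect null sets). -/
noncomputable def lebesgue (τ : IntervalExchange n) : Measure τ.switchSpace :=
  Measure.addHaar

/-! ### Complementary regions

A neighborhood of the exchange is a disc (the thickened base interval) with `n` untwisted
bands attached along its boundary circle.  The band ends cut the rest of this circle into gaps. -/

/-- The bands met when one walks once around the boundary of the thickened base interval:
along the top from left to right, then along the bottom from right to left. -/
def boundary (τ : IntervalExchange n) : List (Fin n) := τ.top ++ τ.bottom.reverse

/-- The cyclic successor of a position on the boundary circle. -/
def next (τ : IntervalExchange n) (p : Fin τ.boundary.length) : Fin τ.boundary.length :=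
  ⟨(p + 1) % τ.boundary.length, Nat.mod_lt _ p.pos⟩

/-- The position `p` also stands for the gap between the band ends at `p` and at `next p`.
Walking along the boundary of a complementary region through the gap `p`, one reaches the band
end at `next p`, follows the near side of that band to its other end `q`, and leaves
through the gap following `q`. -/
def GapStep (τ : IntervalExchange n) (p q : Fin τ.boundary.length) : Prop :=
  q ≠ τ.next p ∧ τ.boundary.get q = τ.boundary.get (τ.next p)

/-- The complementary regions; a region is recorded by the set of gaps on its boundary. -/
def Region (τ : IntervalExchange n) : Type := Quot τ.GapStep

/-- A gap is a cusp (an ideal vertex of the region it lies on), except for the two gaps that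
contain the vertical sides of the thickened base interval. -/
def IsCusp (τ : IntervalExchange n) (p : Fin τ.boundary.length) : Prop :=
  (p : ℕ) + 1 ≠ τ.top.length ∧ (p : ℕ) + 1 ≠ τ.boundary.length

/-- The region is an ideal triangle: it has exactly three cusps. (In an abstract exchange each
complementary region is a disc glued to one boundary circle of the neighborhood.) -/
def IsIdealTriangle (τ : IntervalExchange n) (R : τ.Region) : Prop :=
  {p | Quot.mk τ.GapStep p = R ∧ τ.IsCusp p}.ncard = 3

/-- There are weights that are positive on every band. -/
def IsRecurrent (τ : IntervalExchange n) : Prop :=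
  ∃ w ∈ τ.ML, ∀ i, 0 < w i

/-- Complete exchanges on a surface of genus 2: recurrent, all complementary regions are ideal
triangles, and the closed surface obtained from the disc, the `n` bands and
the complementary discs has Euler characteristic `2 - 2 * 2`. -/
def IsCompleteGenusTwo (τ : IntervalExchange n) : Prop :=
  τ.IsRecurrent ∧ (∀ R : τ.Region, τ.IsIdealTriangle R) ∧
    (1 : ℤ) - n + Nat.card τ.Region = 2 - 2 * 2

/-! ### Splitting (Rauzy induction) -/

/-- Reflection in the base interval, exchanging top and bottom. -/
def flip (τ : IntervalExchange n) : IntervalExchange n where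
  top := τ.bottom
  bottom := τ.top
  count_eq_two i := by
    have h := τ.count_eq_two i
    rw [List.count_append] at h ⊢
    omega

/-- One splitting step when the rightmost top band `t` is wider than the rightmost bottom
band `b`.  The critical end of `b` is removed from the bottom and, having been slid through
`t`, is attached beside the other end of `t`: on its right if `t` is orientation preserving (the
other end is on the bottom), on its left if `t` is orientation reversing (the other
end is on the top).  The width of `t` decreases by the width of `b`. -/
def SplitsTop (p q : IntervalExchange n × (Fin n → ℝ)) : Prop :=
  ∃ (t b : Fin n) (A B : List (Fin n)),
    p.1.top = A ++ [t] ∧ p.1.bottom = B ++ [b] ∧ p.2 b < p.2 t ∧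
    q.1.top = A.flatMap (fun a => if a = t then [b, t] else [a]) ++ [t] ∧
    q.1.bottom = B.flatMap (fun a => if a = t then [t, b] else [a]) ∧
    q.2 = Function.update p.2 t (p.2 t - p.2 b)

/-- The splitting `(τ, w) ↘ (τ', w')`: either the top critical band is wider, or the bottom one
is wider and the mirror image of that step takes place.  There is no step in the corner
case of equal widths, where the result would no longer be complete. -/
def Splits (p q : IntervalExchange n × (Fin n → ℝ)) : Prop :=
  SplitsTop p q ∨ SplitsTop (p.1.flip, p.2) (q.1.flip, q.2)

/-- Splitting is a (partially defined) transformation: its result is unique. -/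
theorem Splits.unique {n : ℕ} {p q q' : IntervalExchange n × (Fin n → ℝ)}
    (h : Splits p q) (h' : Splits p q') : q = q' := by
  obtain ⟨τ, w⟩ := p
  obtain ⟨⟨_, _, _⟩, _⟩ := q
  obtain ⟨⟨_, _, _⟩, _⟩ := q'
  rcases h with ⟨t, b, A, B, h1, h2, h3, h4, h5, h6⟩ | ⟨t, b, A, B, h1, h2, h3, h4, h5, h6⟩ <;>
  rcases h' with ⟨t', b', A', B', g1, g2, g3, g4, g5, g6⟩ | ⟨t', b', A', B', g1, g2, g3, g4, g5, g6⟩ <;>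
  simp only [flip] at * <;>
  rw [h1] at * <;> rw [h2] at * <;>
  obtain ⟨rfl, e1⟩ := List.append_inj' g1 rfl <;>
  obtain ⟨rfl, e2⟩ := List.append_inj' g2 rfl <;>
  simp only [List.cons.injEq, and_true] at e1 e2 <;> subst e1 <;> subst e2
  · simp_all
  · exact absurd h3 (by linarith)
  · exact absurd h3 (by linarith)
  · simp_all

/-! ### Isomorphism classes and the sink -/

/-- Abstract isomorphism: a relabeling of the bands, possibly combined with the reflection that
exchanges the top and the bottom of the base interval. -/
def Iso (τ σ : Σ n, IntervalExchange n) : Prop :=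
  ∃ e : Fin τ.1 ≃ Fin σ.1,
    (σ.2.top = τ.2.top.map e ∧ σ.2.bottom = τ.2.bottom.map e) ∨
    (σ.2.top = τ.2.bottom.map e ∧ σ.2.bottom = τ.2.top.map e)

/-- Abstract isomorphism is an equivalence relation. -/
instance isoSetoid : Setoid (Σ n, IntervalExchange n) where
  r := Iso
  iseqv :=
    { refl := fun τ => ⟨Equiv.refl _, by simp⟩
      symm := by
        rintro τ σ ⟨e, h | h⟩
        · exact ⟨e.symm, by simp [h.1, h.2]⟩
        · exact ⟨e.symm, by simp [h.1, h.2]⟩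
      trans := by
        rintro τ σ ρ ⟨e, h | h⟩ ⟨f, g | g⟩ <;>
          exact ⟨e.trans f, by simp [h.1, h.2, g.1, g.2]⟩ }

end IntervalExchange

/-- Interval exchanges up to abstract isomorphism. -/
def ExchangeClass : Type := Quotient IntervalExchange.isoSetoid

/-- The isomorphism class of an exchange. -/
def IntervalExchange.cls {n : ℕ} (τ : IntervalExchange n) : ExchangeClass :=
  Quotient.mk IntervalExchange.isoSetoid ⟨n, τ⟩

namespace ExchangeClass

open IntervalExchange

/-- The set `𝓘` of complete genus 2 interval exchanges up to isomorphism. -/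
def completeGenusTwo : Set ExchangeClass :=
  {x | ∃ (n : ℕ) (τ : IntervalExchange n), τ.IsCompleteGenusTwo ∧ τ.cls = x}

/-- The edges of the directed graph `𝓘`: there is an edge from `x` to `y` if
`(τ, w)` splits to `(σ, w')` for some weights `w ∈ ML(τ, ℝ)`, where `τ` and `σ` represent
`x` and `y`. -/
def Edge (x y : ExchangeClass) : Prop :=
  x ∈ completeGenusTwo ∧ y ∈ completeGenusTwo ∧
    ∃ (n : ℕ) (τ σ : IntervalExchange n) (w w' : Fin n → ℝ),
      τ.cls = x ∧ σ.cls = y ∧ w ∈ τ.ML ∧ Splits (τ, w) (σ, w')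

/-- The sink: the members of `𝓘` that can be reached by a directed path from every member. -/
def sink : Set ExchangeClass :=
  {x | x ∈ completeGenusTwo ∧ ∀ y ∈ completeGenusTwo, Relation.ReflTransGen Edge y x}

/-- The finite sequence of classes `S` occurs in the splitting sequence `s` starting at time `k`. -/
def OccursAt {n : ℕ} (S : List ExchangeClass)
    (s : ℕ → IntervalExchange n × (Fin n → ℝ)) (k : ℕ) : Prop :=
  ∀ (j : ℕ) (hj : j < S.length), (s (k + j)).1.cls = S[j]

/-- Normality of the splitting transformation on the weights over the sink: the sink is
nonempty and, for every finite splitting sequence `S` contained in the sink, almost every pair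
`(τ, w)` over the sink has a (necessarily unique) infinite splitting sequence,
in which `S` occurs infinitely often. -/
def SplittingIsNormal : Prop :=
  sink.Nonempty ∧
    ∀ S : List ExchangeClass, S.IsChain Edge → (∀ x ∈ S, x ∈ sink) →
      ∀ (n : ℕ) (τ : IntervalExchange n), τ.cls ∈ sink →
        ∀ᵐ w : τ.switchSpace ∂τ.lebesgue, (w : Fin n → ℝ) ∈ τ.ML →
          ∃ s : ℕ → IntervalExchange n × (Fin n → ℝ),
            s 0 = (τ, (w : Fin n → ℝ)) ∧ (∀ k, Splits (s k) (s (k + 1))) ∧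
            ∃ᶠ k in atTop, OccursAt S s k

end ExchangeClass

/-- The standard exchange `τ₀ = (1 2 3 4 2 3 4 / 5 6 7 5 6 7 1)`, with labels shifted
to `0, …, 6`. -/
def standardExchange : IntervalExchange 7 where
  top := [0, 1, 2, 3, 1, 2, 3]
  bottom := [4, 5, 6, 4, 5, 6, 0]
  count_eq_two := by decide

/-!
The proof combines an analogue of Kerckhoff's argument for the normality of Rauzy induction with an
exhaustive enumeration of the complete exchanges of genus 2.

*Probability.* Let `T` be a finite family of recurrent exchanges that is closed under splitting and
in which no relation between the positions of two gaps holds identically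
(`IntervalExchange.IsSplittingFamily`). Then almost all weights are generic: no top gap is ever
above a bottom gap, so that the corner case never occurs. A splitting `w_t ↦ w_t - w_b` of the
weights is accompanied by the dual operation `h_b ↦ h_b + h_t` on heights `h` of the bands, which
preserves the total area `∑ i, h i * w i`. The weights that begin with a given word of splittings
are thus mapped linearly onto the weights of area at most `1` for the heights obtained at the end of
this word, and probabilities after a word are ratios of Lebesgue measures of sets of the form
`IntervalExchange.weightSet`. If all heights are comparable, a realizable word has probability
bounded below (`exists_le_measure_stopSet`). Heights become comparable with probability bounded
below: suppose that the `k` highest bands are comparable, and prescribe splittings until another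
band is rightmost, which is possible since in a generic sequence every band is rightmost infinitely
often (`IsSplittingFamily.frequently_isEnd`). From then on the high bands could only lose while no
additional band becomes high, and their heights would grow without bound, which is impossible unless
one of them is very narrow (`exists_follows_balanced`). Hence whatever has happened before, a
word that can be reached from everywhere is met with probability bounded below, and it is met
infinitely often almost surely (`IsSplittingFamily.measure_not_frequently`).

*Combinatorics.* Counting cusps shows that complete exchanges of genus 2 have seven bands. A search
that traces the boundaries of the complementary regions lists all gluings of seven bands whose
regions are triangles (`SmallRegions.exists_mem_gluings`); the list of the resulting exchanges is
`ExchangeCode.census`. Evaluation by the kernel shows that it is closed under splitting as long as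
the result is recurrent, that each member carries positive weights without connections, and that
each member can be split until it becomes the standard exchange (`censusCheck_eq_true`). The last
fact puts the standard exchange into the sink, and the first two make the exchanges over the sink a
splitting family. A path in the sink is realized by words of splittings, to which the probabilistic
part applies.
-/

/-! ### Splitting as an operation on pairs of lists -/

section Lists

variable {α β : Type*} [DecidableEq α] [DecidableEq β]

/-- Insert `b` immediately to the left of every occurrence of `t`. -/
def insertLeft (t b : α) (l : List α) : List α :=
  l.flatMap fun a => if a = t then [b, t] else [a]

/-- Insert `b` immediately to the right of every occurrence of `t`. -/
def insertRight (t b : α) (l : List α) : List α :=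
  l.flatMap fun a => if a = t then [t, b] else [a]

/-- The splitting of a pair (top, bottom) of lists in which the rightmost top band wins. -/
def splitLists (p : List α × List α) : List α × List α :=
  match p.1.getLast?, p.2.getLast? with
  | some t, some b => (insertLeft t b p.1.dropLast ++ [t], insertRight t b p.2.dropLast)
  | _, _ => p

/-- The splitting of a pair of lists; the top band wins if `d` is true, the bottom band
if `d` is false. -/
def splitListsDir (d : Bool) (p : List α × List α) : List α × List α :=
  bif d then splitLists p else (splitLists p.swap).swap

theorem insertLeft_append (t b : α) (l l' : List α) :
    insertLeft t b (l ++ l') = insertLeft t b l ++ insertLeft t b l' := by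
  simp [insertLeft]

theorem insertRight_append (t b : α) (l l' : List α) :
    insertRight t b (l ++ l') = insertRight t b l ++ insertRight t b l' := by
  simp [insertRight]

theorem splitLists_concat (t b : α) (A B : List α) :
    splitLists (A ++ [t], B ++ [b]) = (insertLeft t b A ++ [t], insertRight t b B) := by
  simp [splitLists]

theorem insertLeft_map {f : α → β} (hf : Function.Injective f) (t b : α) (l : List α) :
    insertLeft (f t) (f b) (l.map f) = (insertLeft t b l).map f := by
  induction l with
  | nil => rfl
  | cons a l ih =>
    simp only [insertLeft, List.map_cons, List.flatMap_cons, List.map_append] at ih ⊢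
    rw [ih]
    congr 1
    by_cases h : a = t <;> simp [h, hf.eq_iff]

theorem insertRight_map {f : α → β} (hf : Function.Injective f) (t b : α) (l : List α) :
    insertRight (f t) (f b) (l.map f) = (insertRight t b l).map f := by
  induction l with
  | nil => rfl
  | cons a l ih =>
    simp only [insertRight, List.map_cons, List.flatMap_cons, List.map_append] at ih ⊢
    rw [ih]
    congr 1
    by_cases h : a = t <;> simp [h, hf.eq_iff]

theorem splitLists_map {f : α → β} (hf : Function.Injective f) (p : List α × List α) :
    splitLists (p.map (List.map f) (List.map f)) =
      (splitLists p).map (List.map f) (List.map f) := by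
  obtain ⟨T, B⟩ := p
  rcases List.eq_nil_or_concat T with rfl | ⟨A, t, rfl⟩
  · simp [splitLists]
  rcases List.eq_nil_or_concat B with rfl | ⟨B, b, rfl⟩
  · simp [splitLists]
  simp only [List.concat_eq_append, Prod.map_apply, List.map_append, List.map_cons, List.map_nil,
    splitLists_concat, insertLeft_map hf, insertRight_map hf]

theorem splitListsDir_map {f : α → β} (hf : Function.Injective f) (d : Bool)
    (p : List α × List α) :
    splitListsDir d (p.map (List.map f) (List.map f)) =
      (splitListsDir d p).map (List.map f) (List.map f) := by
  cases d
  · exact congrArg Prod.swap (splitLists_map hf p.swap)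
  · exact splitLists_map hf p

theorem splitListsDir_swap (d : Bool) (p : List α × List α) :
    splitListsDir d p.swap = (splitListsDir (!d) p).swap := by
  cases d <;> simp [splitListsDir]

theorem count_insertLeft {t b : α} (h : t ≠ b) (l : List α) (i : α) :
    (insertLeft t b l).count i = l.count i + if i = b then l.count t else 0 := by
  induction l with
  | nil => simp [insertLeft]
  | cons a l ih =>
    have e : insertLeft t b (a :: l) = (if a = t then [b, t] else [a]) ++ insertLeft t b l := rfl
    rw [e, List.count_append, ih]
    by_cases h1 : a = t <;> by_cases h2 : i = b <;> by_cases h3 : i = t <;> by_cases h4 : a = i <;>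
      simp_all [List.count_cons] <;> grind

theorem count_insertRight {t b : α} (h : t ≠ b) (l : List α) (i : α) :
    (insertRight t b l).count i = l.count i + if i = b then l.count t else 0 := by
  induction l with
  | nil => simp [insertRight]
  | cons a l ih =>
    have e : insertRight t b (a :: l) = (if a = t then [t, b] else [a]) ++ insertRight t b l := rfl
    rw [e, List.count_append, ih]
    by_cases h1 : a = t <;> by_cases h2 : i = b <;> by_cases h3 : i = t <;> by_cases h4 : a = i <;>
      simp_all [List.count_cons] <;> grind

theorem sum_map_insertLeft {t b : α} (h : t ≠ b) (w : α → ℝ) (l : List α) :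
    ((insertLeft t b l).map (Function.update w t (w t - w b))).sum = (l.map w).sum := by
  induction l with
  | nil => simp [insertLeft]
  | cons a l ih =>
    have e : insertLeft t b (a :: l) = (if a = t then [b, t] else [a]) ++ insertLeft t b l := rfl
    rw [e, List.map_append, List.sum_append, ih]
    by_cases h1 : a = t <;> simp [h1, h.symm]

theorem sum_map_insertRight {t b : α} (h : t ≠ b) (w : α → ℝ) (l : List α) :
    ((insertRight t b l).map (Function.update w t (w t - w b))).sum = (l.map w).sum := by
  induction l with
  | nil => simp [insertRight]
  | cons a l ih =>
    have e : insertRight t b (a :: l) = (if a = t then [t, b] else [a]) ++ insertRight t b l := rfl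
    rw [e, List.map_append, List.sum_append, ih]
    by_cases h1 : a = t <;> simp [h1, h.symm]

theorem mem_insertLeft {t b : α} {l : List α} {i : α} (h : i ∈ insertLeft t b l) :
    i ∈ l ∨ i = b := by
  simp only [insertLeft, List.mem_flatMap] at h
  obtain ⟨a, ha, hi⟩ := h
  split_ifs at hi with h1 <;> simp at hi <;> grind

theorem mem_insertRight {t b : α} {l : List α} {i : α} (h : i ∈ insertRight t b l) :
    i ∈ l ∨ i = b := by
  simp only [insertRight, List.mem_flatMap] at h
  obtain ⟨a, ha, hi⟩ := h
  split_ifs at hi with h1 <;> simp at hi <;> grind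

end Lists

namespace IntervalExchange

variable {n : ℕ}

/-! ### Splitting as a function -/

/-- The pair (top, bottom) of lists of an exchange. -/
def lists (τ : IntervalExchange n) : List (Fin n) × List (Fin n) := (τ.top, τ.bottom)

theorem lists_injective : Function.Injective (lists (n := n)) := by
  intro τ σ h
  ext1
  · exact congrArg Prod.fst h
  · exact congrArg Prod.snd h

theorem lists_flip (τ : IntervalExchange n) : τ.flip.lists = τ.lists.swap := rfl

/-- The result of the splitting in direction `d` (`true` if the top band wins), where the
exchange is left unchanged if the result is not an interval exchange. -/
def succ (τ : IntervalExchange n) (d : Bool) : IntervalExchange n :=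
  if h : ∀ i, ((splitListsDir d τ.lists).1 ++ (splitListsDir d τ.lists).2).count i = 2 then
    ⟨(splitListsDir d τ.lists).1, (splitListsDir d τ.lists).2, h⟩ else τ

/-- Both sides are non-empty and the rightmost bands on the two sides are distinct. -/
def Splittable (τ : IntervalExchange n) : Prop :=
  ∃ t b A B, t ≠ b ∧ τ.top = A ++ [t] ∧ τ.bottom = B ++ [b]

theorem Splittable.flip {τ : IntervalExchange n} (h : τ.Splittable) : τ.flip.Splittable := by
  obtain ⟨t, b, A, B, h, h1, h2⟩ := h
  exact ⟨b, t, B, A, h.symm, h2, h1⟩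

theorem count_splitLists {τ : IntervalExchange n} (h : τ.Splittable) (i : Fin n) :
    ((splitLists τ.lists).1 ++ (splitLists τ.lists).2).count i = 2 := by
  obtain ⟨t, b, A, B, h, h1, h2⟩ := h
  have c := τ.count_eq_two
  simp only [lists, h1, h2, splitLists_concat, List.count_append, count_insertLeft h,
    count_insertRight h] at c ⊢
  have ci := c i
  have ct := c t
  by_cases h3 : i = b <;> by_cases h4 : i = t <;> simp_all [List.count_cons] <;> grind

theorem lists_succ {τ : IntervalExchange n} (h : τ.Splittable) (d : Bool) :
    (τ.succ d).lists = splitListsDir d τ.lists := by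
  have : ∀ i, ((splitListsDir d τ.lists).1 ++ (splitListsDir d τ.lists).2).count i = 2 := by
    intro i
    cases d
    · have := count_splitLists h.flip i
      rw [List.count_append, add_comm, ← List.count_append] at this
      exact this
    · exact count_splitLists h i
  rw [succ, dif_pos this]
  rfl

theorem succ_flip {τ : IntervalExchange n} (h : τ.Splittable) (d : Bool) :
    τ.flip.succ d = (τ.succ (!d)).flip := by
  apply lists_injective
  rw [lists_succ h.flip, lists_flip, lists_flip, lists_succ h, splitListsDir_swap]

theorem Splittable.top_succ_true {τ : IntervalExchange n} {t b : Fin n} {A B : List (Fin n)}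
    (h : t ≠ b) (h1 : τ.top = A ++ [t]) (h2 : τ.bottom = B ++ [b]) :
    (τ.succ true).top = insertLeft t b A ++ [t] ∧ (τ.succ true).bottom = insertRight t b B := by
  have := lists_succ ⟨t, b, A, B, h, h1, h2⟩ true
  rw [lists, lists, h1, h2, splitListsDir, cond_true, splitLists_concat] at this
  exact ⟨congrArg Prod.fst this, congrArg Prod.snd this⟩

theorem Splittable.top_succ_false {τ : IntervalExchange n} {t b : Fin n} {A B : List (Fin n)}
    (h : t ≠ b) (h1 : τ.top = A ++ [t]) (h2 : τ.bottom = B ++ [b]) :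
    (τ.succ false).top = insertRight b t A ∧ (τ.succ false).bottom = insertLeft b t B ++ [b] := by
  have := lists_succ ⟨t, b, A, B, h, h1, h2⟩ false
  simp only [lists, h1, h2, splitListsDir, cond_false, Prod.swap_prod_mk, splitLists_concat] at this
  exact ⟨congrArg Prod.fst this, congrArg Prod.snd this⟩

/-- The effect on the weights of a splitting in which `x` wins and `y` loses. -/
def cut (x y : Fin n) (w : Fin n → ℝ) : Fin n → ℝ := Function.update w x (w x - w y)

theorem cut_apply (x y i : Fin n) (w : Fin n → ℝ) :
    cut x y w i = if i = x then w x - w y else w i := by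
  simp [cut, Function.update_apply]

theorem mem_switchSpace {τ : IntervalExchange n} {w : Fin n → ℝ} :
    w ∈ τ.switchSpace ↔ (τ.top.map w).sum = (τ.bottom.map w).sum := Iff.rfl

variable [NeZero n]

/-- The rightmost band on the top. -/
def topEnd (τ : IntervalExchange n) : Fin n := τ.top.getLastD 0

/-- The rightmost band on the bottom. -/
def botEnd (τ : IntervalExchange n) : Fin n := τ.bottom.getLastD 0

/-- The wider one of the two rightmost bands in a splitting in direction `d`. -/
def winner (τ : IntervalExchange n) (d : Bool) : Fin n := bif d then τ.topEnd else τ.botEnd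

/-- The narrower one of the two rightmost bands in a splitting in direction `d`. -/
def loser (τ : IntervalExchange n) (d : Bool) : Fin n := bif d then τ.botEnd else τ.topEnd

/-- The direction of the splitting of `(τ, w)`. -/
noncomputable def dir (τ : IntervalExchange n) (w : Fin n → ℝ) : Bool :=
  decide (w τ.botEnd < w τ.topEnd)

/-- The splitting transformation, extended by an irrelevant convention to the corner case. -/
noncomputable def splitStep (p : IntervalExchange n × (Fin n → ℝ)) :
    IntervalExchange n × (Fin n → ℝ) :=
  (p.1.succ (p.1.dir p.2), cut (p.1.winner (p.1.dir p.2)) (p.1.loser (p.1.dir p.2)) p.2)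

theorem topEnd_of_eq {τ : IntervalExchange n} {t : Fin n} {A : List (Fin n)}
    (h : τ.top = A ++ [t]) : τ.topEnd = t := by simp [topEnd, h]

theorem botEnd_of_eq {τ : IntervalExchange n} {b : Fin n} {B : List (Fin n)}
    (h : τ.bottom = B ++ [b]) : τ.botEnd = b := by simp [botEnd, h]

theorem Splittable.exists_eq {τ : IntervalExchange n} (h : τ.Splittable) :
    ∃ A B, τ.topEnd ≠ τ.botEnd ∧ τ.top = A ++ [τ.topEnd] ∧ τ.bottom = B ++ [τ.botEnd] := by
  obtain ⟨t, b, A, B, h, h1, h2⟩ := h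
  rw [topEnd_of_eq h1, botEnd_of_eq h2]
  exact ⟨A, B, h, h1, h2⟩

theorem Splittable.winner_ne_loser {τ : IntervalExchange n} (h : τ.Splittable) (d : Bool) :
    τ.winner d ≠ τ.loser d := by
  obtain ⟨A, B, h, -, -⟩ := h.exists_eq
  cases d
  · exact h.symm
  · exact h

theorem splits_splitStep {τ : IntervalExchange n} (h : τ.Splittable) {w : Fin n → ℝ}
    (hw : w τ.topEnd ≠ w τ.botEnd) : Splits (τ, w) (splitStep (τ, w)) := by
  obtain ⟨A, B, h, h1, h2⟩ := h.exists_eq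
  rcases lt_or_gt_of_ne hw with hlt | hlt
  · right
    have hd : τ.dir w = false := by simp [dir, hlt.le]
    have := Splittable.top_succ_false h h1 h2
    refine ⟨τ.botEnd, τ.topEnd, B, A, h2, h1, hlt, ?_, ?_, ?_⟩
    · simp only [splitStep, hd]; exact this.2
    · simp only [splitStep, hd]; exact this.1
    · simp only [splitStep, hd]; rfl
  · left
    have hd : τ.dir w = true := by simp [dir, hlt]
    have := Splittable.top_succ_true h h1 h2
    refine ⟨τ.topEnd, τ.botEnd, A, B, h1, h2, hlt, ?_, ?_, ?_⟩
    · simp only [splitStep, hd]; exact this.1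
    · simp only [splitStep, hd]; exact this.2
    · simp only [splitStep, hd]; rfl

theorem Splits.splittable {p q : IntervalExchange n × (Fin n → ℝ)} (h : Splits p q) :
    p.1.Splittable ∧ p.2 p.1.topEnd ≠ p.2 p.1.botEnd := by
  rcases h with ⟨t, b, A, B, h1, h2, h3, -⟩ | ⟨b, t, B, A, h2, h1, h3, -⟩
  · refine ⟨⟨t, b, A, B, ?_, h1, h2⟩, ?_⟩
    · rintro rfl; exact lt_irrefl _ h3
    · rw [topEnd_of_eq h1, botEnd_of_eq h2]; exact h3.ne'
  · refine ⟨⟨t, b, A, B, ?_, h1, h2⟩, ?_⟩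
    · rintro rfl; exact lt_irrefl _ h3
    · rw [topEnd_of_eq h1, botEnd_of_eq h2]; exact h3.ne

theorem Splits.eq_splitStep {p q : IntervalExchange n × (Fin n → ℝ)} (h : Splits p q) :
    q = splitStep p :=
  Splits.unique h (splits_splitStep (τ := p.1) (w := p.2) h.splittable.1 h.splittable.2)

theorem cut_mem_switchSpace_iff {τ : IntervalExchange n} (h : τ.Splittable) (d : Bool)
    {w : Fin n → ℝ} :
    cut (τ.winner d) (τ.loser d) w ∈ (τ.succ d).switchSpace ↔ w ∈ τ.switchSpace := by
  obtain ⟨A, B, h, h1, h2⟩ := h.exists_eq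
  have s1 : (τ.top.map w).sum = (A.map w).sum + w τ.topEnd := by
    simpa using congrArg (fun l => (l.map w).sum) h1
  have s2 : (τ.bottom.map w).sum = (B.map w).sum + w τ.botEnd := by
    simpa using congrArg (fun l => (l.map w).sum) h2
  rw [mem_switchSpace, mem_switchSpace]
  cases d
  · obtain ⟨e1, e2⟩ := Splittable.top_succ_false h h1 h2
    rw [e1, e2, List.map_append, List.sum_append]
    simp only [winner, loser, cond_false, cut]
    rw [sum_map_insertRight h.symm, sum_map_insertLeft h.symm]
    simp only [List.map_cons, List.map_nil, Function.update_self, List.sum_singleton, s1, s2]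
    constructor <;> intro h <;> linarith
  · obtain ⟨e1, e2⟩ := Splittable.top_succ_true h h1 h2
    rw [e1, e2, List.map_append, List.sum_append]
    simp only [winner, loser, cond_true, cut]
    rw [sum_map_insertRight h, sum_map_insertLeft h]
    simp only [List.map_cons, List.map_nil, Function.update_self, List.sum_singleton, s1, s2]
    constructor <;> intro h <;> linarith

end IntervalExchange

namespace IntervalExchange

variable {n : ℕ}

/-! ### Lebesgue measure on the weights -/

instance (τ : IntervalExchange n) : τ.lebesgue.IsAddHaarMeasure := by
  unfold lebesgue; infer_instance

/-- Lebesgue measure on the switch space, as a measure on the ambient space of all vectors. -/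
noncomputable def weightMeasure (τ : IntervalExchange n) : Measure (Fin n → ℝ) :=
  τ.lebesgue.map Subtype.val

theorem measurableEmbedding_val (τ : IntervalExchange n) :
    MeasurableEmbedding (Subtype.val : τ.switchSpace → Fin n → ℝ) :=
  MeasurableEmbedding.subtype_coe τ.switchSpace.closed_of_finiteDimensional.measurableSet

theorem weightMeasure_apply (τ : IntervalExchange n) (s : Set (Fin n → ℝ)) :
    τ.weightMeasure s = τ.lebesgue (Subtype.val ⁻¹' s) :=
  τ.measurableEmbedding_val.map_apply _ _

theorem weightMeasure_compl (τ : IntervalExchange n) :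
    τ.weightMeasure (τ.switchSpace : Set (Fin n → ℝ))ᶜ = 0 := by
  rw [weightMeasure_apply]
  convert measure_empty (μ := τ.lebesgue)
  ext w
  simp

theorem weightMeasure_image_add (τ : IntervalExchange n) {v : Fin n → ℝ} (hv : v ∈ τ.switchSpace)
    (s : Set (Fin n → ℝ)) : τ.weightMeasure ((fun w => w + v) '' s) = τ.weightMeasure s := by
  rw [weightMeasure_apply, weightMeasure_apply,
    ← measure_preimage_add_right τ.lebesgue (⟨-v, τ.switchSpace.neg_mem hv⟩ : τ.switchSpace)
      (Subtype.val ⁻¹' s)]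
  congr 1
  ext w
  simp only [Set.mem_preimage, Set.mem_image, Submodule.coe_add]
  constructor
  · rintro ⟨u, hu, h⟩
    simpa [← h] using hu
  · intro h
    exact ⟨_, h, by simp⟩

open Pointwise in
theorem weightMeasure_smul (τ : IntervalExchange n) {r : ℝ} (hr : 0 < r)
    (s : Set (Fin n → ℝ)) :
    τ.weightMeasure (r • s) =
      ENNReal.ofReal (r ^ Module.finrank ℝ τ.switchSpace) * τ.weightMeasure s := by
  rw [weightMeasure_apply, weightMeasure_apply,
    show ENNReal.ofReal (r ^ Module.finrank ℝ τ.switchSpace) =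
      ENNReal.ofReal |r ^ Module.finrank ℝ τ.switchSpace| by rw [abs_of_pos (by positivity)],
    ← Measure.addHaar_smul]
  congr 1
  ext w
  simp only [Set.mem_preimage, Set.mem_smul_set_iff_inv_smul_mem₀ hr.ne', Submodule.coe_smul]

theorem weightMeasure_lt_top (τ : IntervalExchange n) {s : Set (Fin n → ℝ)}
    (hs : Bornology.IsBounded s) : τ.weightMeasure s < ⊤ := by
  rw [weightMeasure_apply]
  apply Bornology.IsBounded.measure_lt_top
  obtain ⟨R, hR⟩ := hs.subset_closedBall 0
  refine (Metric.isBounded_closedBall (x := 0) (r := R)).subset fun w hw => ?_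
  have := hR hw
  rw [mem_closedBall_zero_iff] at this ⊢
  exact this

theorem weightMeasure_pos (τ : IntervalExchange n) {s : Set (Fin n → ℝ)} (hs : IsOpen s)
    {w : Fin n → ℝ} (hw : w ∈ s) (hwV : w ∈ τ.switchSpace) : 0 < τ.weightMeasure s := by
  rw [weightMeasure_apply]
  exact (hs.preimage continuous_subtype_val).measure_pos _ ⟨⟨w, hwV⟩, hw⟩

theorem weightMeasure_ker (τ : IntervalExchange n) (f : (Fin n → ℝ) →ₗ[ℝ] ℝ)
    {v : Fin n → ℝ} (hv : v ∈ τ.switchSpace) (hf : f v ≠ 0) :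
    τ.weightMeasure {w | f w = 0} = 0 := by
  rw [weightMeasure_apply]
  have : (Subtype.val ⁻¹' {w | f w = 0} : Set τ.switchSpace) =
      (LinearMap.ker (f ∘ₗ τ.switchSpace.subtype) : Set τ.switchSpace) := by
    ext w; simp
  rw [this]
  apply Measure.addHaar_submodule
  intro h
  have : (⟨v, hv⟩ : τ.switchSpace) ∈ LinearMap.ker (f ∘ₗ τ.switchSpace.subtype) := by
    rw [h]; trivial
  exact hf this

/-- A linear automorphism of the ambient space that matches two switch spaces rescales the
Lebesgue measures by a constant. -/
theorem exists_weightMeasure_preimage (τ σ : IntervalExchange n)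
    (e : (Fin n → ℝ) ≃ₗ[ℝ] (Fin n → ℝ)) (he : ∀ w, e w ∈ σ.switchSpace ↔ w ∈ τ.switchSpace) :
    ∃ κ : ENNReal, κ ≠ 0 ∧ κ ≠ ⊤ ∧
      ∀ s, τ.weightMeasure (e ⁻¹' s) = κ * σ.weightMeasure s := by
  have hmap : τ.switchSpace.map (e : (Fin n → ℝ) →ₗ[ℝ] (Fin n → ℝ)) = σ.switchSpace := by
    ext w
    rw [Submodule.mem_map]
    constructor
    · rintro ⟨u, hu, rfl⟩
      exact (he u).2 hu
    · intro hw
      exact ⟨e.symm w, (he _).1 (by simpa using hw), by simp⟩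
  let E : τ.switchSpace ≃ₗ[ℝ] σ.switchSpace := e.ofSubmodules _ _ hmap
  let E' : τ.switchSpace ≃L[ℝ] σ.switchSpace := E.toContinuousLinearEquiv
  have hE : ∀ w : τ.switchSpace, ((E' w : σ.switchSpace) : Fin n → ℝ) = e w := fun w => rfl
  have : (τ.lebesgue.map E').IsAddHaarMeasure := E'.isAddHaarMeasure_map _
  obtain ⟨κ, h0, ht, hκ⟩ : ∃ κ : ENNReal, κ ≠ 0 ∧ κ ≠ ⊤ ∧ τ.lebesgue.map E' = κ • σ.lebesgue :=
    
    ⟨_, by exact_mod_cast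
        (Measure.addHaarScalarFactor_pos_of_isAddHaarMeasure (τ.lebesgue.map E') σ.lebesgue).ne',
      ENNReal.coe_ne_top, Measure.isAddLeftInvariant_eq_smul (τ.lebesgue.map E') σ.lebesgue⟩
  refine ⟨κ, h0, ht, fun s => ?_⟩
  rw [weightMeasure_apply, weightMeasure_apply]
  have h1 : τ.lebesgue (Subtype.val ⁻¹' (e ⁻¹' s)) =
      τ.lebesgue.map E' (Subtype.val ⁻¹' s) := by
    rw [show (E' : τ.switchSpace → σ.switchSpace) = E'.toHomeomorph from rfl,
      E'.toHomeomorph.measurableEmbedding.map_apply]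
    rfl
  rw [h1, hκ]
  rfl

/-- `cut x y` as a linear automorphism. -/
def cutEquiv {x y : Fin n} (h : x ≠ y) : (Fin n → ℝ) ≃ₗ[ℝ] (Fin n → ℝ) where
  toFun := cut x y
  map_add' u v := by
    ext i; simp only [cut_apply, Pi.add_apply]; split_ifs <;> ring
  map_smul' c u := by
    ext i; simp only [cut_apply, Pi.smul_apply, smul_eq_mul, RingHom.id_apply]; split_ifs <;> ring
  invFun w := Function.update w x (w x + w y)
  left_inv w := by
    ext i
    by_cases hi : i = x
    · subst hi; simp [cut_apply, h.symm]
    · simp [cut_apply, hi]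
  right_inv w := by
    ext i
    by_cases hi : i = x
    · subst hi; simp [cut_apply, h.symm]
    · simp [cut_apply, hi]

/-! ### The sets of positive weights of bounded total height -/

/-- The positive weights `w` on `τ` for which the total `∑ i, h i * w i` is at most `1`. The
number `h i` plays the role of the height of the band `i` over the initial interval. -/
def weightSet (τ : IntervalExchange n) (h : Fin n → ℝ) : Set (Fin n → ℝ) :=
  {w | w ∈ τ.switchSpace ∧ (∀ i, 0 < w i) ∧ h ⬝ᵥ w ≤ 1}

theorem measurableSet_switchSpace (τ : IntervalExchange n) :
    MeasurableSet (τ.switchSpace : Set (Fin n → ℝ)) :=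
  τ.switchSpace.closed_of_finiteDimensional.measurableSet

theorem measurable_dotProduct (h : Fin n → ℝ) : Measurable fun w : Fin n → ℝ => h ⬝ᵥ w := by
  unfold dotProduct; fun_prop

theorem measurableSet_weightSet (τ : IntervalExchange n) (h : Fin n → ℝ) :
    MeasurableSet (τ.weightSet h) := by
  have h1 : MeasurableSet {w : Fin n → ℝ | ∀ i, 0 < w i} := by
    rw [Set.ofPred_forall]
    exact MeasurableSet.iInter fun i => measurableSet_lt measurable_const (measurable_pi_apply i)
  have h2 : MeasurableSet {w : Fin n → ℝ | h ⬝ᵥ w ≤ 1} :=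
    measurableSet_le (measurable_dotProduct h) measurable_const
  exact τ.measurableSet_switchSpace.inter (h1.inter h2)

theorem mul_le_dotProduct {h w : Fin n → ℝ} (hh : ∀ i, 0 ≤ h i) (hw : ∀ i, 0 ≤ w i) (i : Fin n) :
    h i * w i ≤ h ⬝ᵥ w :=
  Finset.single_le_sum (f := fun i => h i * w i) (fun j _ => mul_nonneg (hh j) (hw j))
    (Finset.mem_univ i)

theorem weightSet_lt_top (τ : IntervalExchange n) {h : Fin n → ℝ} (hh : ∀ i, 0 < h i) :
    τ.weightMeasure (τ.weightSet h) < ⊤ := by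
  apply weightMeasure_lt_top
  have : τ.weightSet h ⊆ Set.pi Set.univ fun i => Set.Icc 0 (1 / h i) := by
    intro w hw i _
    refine ⟨(hw.2.1 i).le, ?_⟩
    rw [le_div_iff₀ (hh i), mul_comm]
    exact (mul_le_dotProduct (fun i => (hh i).le) (fun i => (hw.2.1 i).le) i).trans hw.2.2
  exact (Bornology.IsBounded.pi fun i => Metric.isBounded_Icc _ _).subset this

open Pointwise in
theorem smul_weightSet (τ : IntervalExchange n) (h : Fin n → ℝ) {r : ℝ} (hr : 0 < r) :
    r • τ.weightSet h = {w | w ∈ τ.switchSpace ∧ (∀ i, 0 < w i) ∧ h ⬝ᵥ w ≤ r} := by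
  ext w
  rw [Set.mem_smul_set_iff_inv_smul_mem₀ hr.ne']
  simp only [weightSet, Set.mem_ofPred_eq, Pi.smul_apply, smul_eq_mul, dotProduct_smul,
    Submodule.smul_mem_iff _ (inv_ne_zero hr.ne')]
  refine and_congr_right fun _ => and_congr (forall_congr' fun i => ?_) ?_
  · rw [mul_pos_iff_of_pos_left (inv_pos.2 hr)]
  · rw [inv_mul_le_iff₀ hr, mul_one]

theorem weightSet_pos (τ : IntervalExchange n) {h w : Fin n → ℝ}
    (hw : w ∈ τ.switchSpace) (hpos : ∀ i, 0 < w i) : 0 < τ.weightMeasure (τ.weightSet h) := by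
  have ho : IsOpen {u : Fin n → ℝ | (∀ i, 0 < u i) ∧ h ⬝ᵥ u < 1} := by
    have h1 : IsOpen {u : Fin n → ℝ | ∀ i, 0 < u i} := by
      rw [Set.ofPred_forall]
      exact isOpen_iInter_of_finite fun i => isOpen_lt continuous_const (continuous_apply i)
    have h2 : IsOpen {u : Fin n → ℝ | h ⬝ᵥ u < 1} := by
      refine isOpen_lt ?_ continuous_const
      unfold dotProduct; fun_prop
    exact h1.inter h2
  obtain ⟨r, hr, hr1⟩ : ∃ r : ℝ, 0 < r ∧ r * (h ⬝ᵥ w) < 1 := by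
    refine ⟨1 / (|h ⬝ᵥ w| + 1), by positivity, ?_⟩
    rw [one_div, inv_mul_lt_iff₀ (by positivity), mul_one]
    exact (le_abs_self _).trans_lt (lt_add_one _)
  have := τ.weightMeasure_pos ho (w := r • w)
    ⟨fun i => mul_pos hr (hpos i), by rwa [dotProduct_smul, smul_eq_mul]⟩
    (τ.switchSpace.smul_mem r hw)
  refine this.trans_le ?_
  rw [← Set.inter_univ {u : Fin n → ℝ | (∀ i, 0 < u i) ∧ h ⬝ᵥ u < 1},
    ← Set.union_compl_self (τ.switchSpace : Set (Fin n → ℝ)), Set.inter_union_distrib_left]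
  refine (measure_union_le _ _).trans ?_
  rw [measure_mono_null Set.inter_subset_right τ.weightMeasure_compl, add_zero]
  exact measure_mono fun u hu => ⟨hu.2, hu.1.1, hu.1.2.le⟩

/-- A band whose height is comparable to the largest one is unlikely to have a small weight. -/
theorem small_weight_le (τ : IntervalExchange n) {v : Fin n → ℝ} (hv : v ∈ τ.switchSpace)
    (hv0 : ∀ i, 0 < v i) {i : Fin n} (hvi : v i = 1) {C : ℝ} {h : Fin n → ℝ} (hh : ∀ i, 0 < h i)
    (hC : h ⬝ᵥ v ≤ C * h i) (m : ℕ) {M : ℝ} (hM : 0 < M) (hm : 2 * m * C ≤ M) :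
    (m : ENNReal) * τ.weightMeasure {w ∈ τ.weightSet h | M * (h i * w i) ≤ 1} ≤
      2 ^ Module.finrank ℝ τ.switchSpace * τ.weightMeasure (τ.weightSet h) := by
  -- The translates of this set by multiples of `v` are disjoint and lie in `2 • weightSet`.
  set S := {w ∈ τ.weightSet h | M * (h i * w i) ≤ 1} with hS
  have hSm : MeasurableSet S := by
    have : MeasurableSet {w : Fin n → ℝ | M * (h i * w i) ≤ 1} :=
      measurableSet_le (measurable_const.mul (measurable_const.mul (measurable_pi_apply i)))
        measurable_const
    exact (τ.measurableSet_weightSet h).inter this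
  set s : ℝ := 2 / (M * h i) with hs
  have hs0 : 0 < s := div_pos two_pos (mul_pos hM (hh i))
  let T : ℕ → Set (Fin n → ℝ) := fun k => (fun w => w + (k * s) • v) '' S
  have hT : ∀ k, τ.weightMeasure (T k) = τ.weightMeasure S := fun k =>
    τ.weightMeasure_image_add (τ.switchSpace.smul_mem _ hv) S
  have hTm : ∀ k, MeasurableSet (T k) := fun k =>
    (MeasurableEquiv.addRight ((k * s : ℝ) • v)).measurableSet_image.2 hSm
  have hdisj : Pairwise fun k l => Disjoint (T k) (T l) := by
    have key : ∀ k l : ℕ, k < l → Disjoint (T k) (T l) := by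
      intro k l hkl
      rw [Set.disjoint_left]
      rintro _ ⟨w, hw, rfl⟩ ⟨u, hu, e⟩
      have e := congrFun e i
      simp only [Pi.add_apply, Pi.smul_apply, hvi, smul_eq_mul, mul_one] at e
      have h1 : (k : ℝ) + 1 ≤ l := by exact_mod_cast hkl
      have h2 : w i ≤ s / 2 := by
        rw [hs, div_div, mul_comm _ (2 : ℝ), ← div_div, div_self two_ne_zero,
          le_div_iff₀ (mul_pos hM (hh i))]
        have := hw.2
        linarith
      have h3 : 0 < u i := hu.1.2.1 i
      nlinarith
    intro k l hkl
    rcases lt_or_gt_of_ne hkl with h | h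
    · exact key k l h
    · exact (key l k h).symm
  have hsub : ∀ k < m, T k ⊆ {w | w ∈ τ.switchSpace ∧ (∀ i, 0 < w i) ∧ h ⬝ᵥ w ≤ 2} := by
    rintro k hk _ ⟨w, hw, rfl⟩
    refine ⟨τ.switchSpace.add_mem hw.1.1 (τ.switchSpace.smul_mem _ hv), fun j => ?_, ?_⟩
    · have := hw.1.2.1 j
      have := hv0 j
      simp only [Pi.add_apply, Pi.smul_apply, smul_eq_mul]
      positivity
    · rw [dotProduct_add, dotProduct_smul, smul_eq_mul]
      have h1 : (k : ℝ) * s * (h ⬝ᵥ v) ≤ 1 := by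
        have hk' : (k : ℝ) ≤ m := by exact_mod_cast hk.le
        have h0 : 0 < h ⬝ᵥ v := (mul_pos (hh i) (hv0 i)).trans_le
          (mul_le_dotProduct (fun i => (hh i).le) (fun i => (hv0 i).le) i)
        have hC0 : 0 < C := by
          by_contra hC'
          have := mul_nonpos_of_nonpos_of_nonneg (not_lt.1 hC') (hh i).le
          linarith
        calc (k : ℝ) * s * (h ⬝ᵥ v) ≤ m * s * (C * h i) := by gcongr
          _ = (2 * m * C) / M := by
            rw [hs]; have := (hh i).ne'; field_simp
          _ ≤ 1 := (div_le_one hM).2 hm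
      linarith [hw.1.2.2]
  calc (m : ENNReal) * τ.weightMeasure S = ∑ k ∈ Finset.range m, τ.weightMeasure (T k) := by
        simp [hT]
    _ = τ.weightMeasure (⋃ k ∈ Finset.range m, T k) :=
        (measure_biUnion_finset (fun k _ l _ hkl => hdisj hkl) fun k _ => hTm k).symm
    _ ≤ τ.weightMeasure {w | w ∈ τ.switchSpace ∧ (∀ i, 0 < w i) ∧ h ⬝ᵥ w ≤ 2} :=
        measure_mono (Set.iUnion₂_subset fun k hk => hsub k (Finset.mem_range.1 hk))
    _ = _ := by
        rw [← smul_weightSet τ h two_pos, weightMeasure_smul τ two_pos]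
        congr 1
        rw [ENNReal.ofReal_pow (by norm_num)]
        norm_num

end IntervalExchange

/-! ### Suffixes of band ends -/

section Cuts

variable {α : Type*}

/-- The list is empty or its last entry does not belong to `S`. -/
def EndsOutside (S : Set α) (l : List α) : Prop :=
  l = [] ∨ ∃ l₀ x, l = l₀ ++ [x] ∧ x ∉ S

theorem exists_endsOutside_append (S : Set α) (l : List α) :
    ∃ A A', l = A ++ A' ∧ EndsOutside S A ∧ ∀ a ∈ A', a ∈ S := by
  induction l using List.reverseRecOn with
  | nil => exact ⟨[], [], rfl, Or.inl rfl, by simp⟩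
  | append_singleton l x ih =>
    by_cases hx : x ∈ S
    · obtain ⟨A, A', rfl, h1, h2⟩ := ih
      refine ⟨A, A' ++ [x], by simp, h1, ?_⟩
      intro a ha
      rcases List.mem_append.1 ha with ha | ha
      · exact h2 a ha
      · rw [List.mem_singleton.1 ha]; exact hx
    · exact ⟨l ++ [x], [], by simp, Or.inr ⟨l, x, rfl, hx⟩, by simp⟩

theorem EndsOutside.ne_nil_of_append {S : Set α} {A A' l : List α} {t : α} (hA : EndsOutside S A)
    (ht : t ∈ S) (h : A ++ A' = l ++ [t]) : ∃ A'', A' = A'' ++ [t] ∧ l = A ++ A'' := by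
  rcases List.eq_nil_or_concat A' with rfl | ⟨A'', x, rfl⟩
  · rw [List.append_nil] at h
    rcases hA with rfl | ⟨l₀, x, rfl, hx⟩
    · simp at h
    · obtain ⟨-, h⟩ := List.append_inj' h rfl
      rw [List.singleton_inj] at h
      exact absurd ht (h ▸ hx)
  · rw [List.concat_eq_append, ← List.append_assoc] at h
    obtain ⟨h1, h2⟩ := List.append_inj' h rfl
    rw [List.singleton_inj] at h2
    exact ⟨A'', by rw [h2, List.concat_eq_append], h1.symm⟩

variable [DecidableEq α]

theorem EndsOutside.insertLeft {S : Set α} {A : List α} (hA : EndsOutside S A) {t b : α}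
    (ht : t ∈ S) : EndsOutside S (insertLeft t b A) := by
  rcases hA with rfl | ⟨l₀, x, rfl, hx⟩
  · exact Or.inl rfl
  · have : x ≠ t := fun h => hx (h ▸ ht)
    refine Or.inr ⟨_root_.insertLeft t b l₀, x, ?_, hx⟩
    rw [insertLeft_append]
    simp [_root_.insertLeft, this]

theorem EndsOutside.insertRight {S : Set α} {A : List α} (hA : EndsOutside S A) {t b : α}
    (ht : t ∈ S) : EndsOutside S (insertRight t b A) := by
  rcases hA with rfl | ⟨l₀, x, rfl, hx⟩
  · exact Or.inl rfl
  · have : x ≠ t := fun h => hx (h ▸ ht)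
    refine Or.inr ⟨_root_.insertRight t b l₀, x, ?_, hx⟩
    rw [insertRight_append]
    simp [_root_.insertRight, this]

/-- The total weight of the list up to the last end outside `S` is `c`. -/
def PrefixWeight (S : Set α) (l : List α) (w : α → ℝ) (c : ℝ) : Prop :=
  ∃ A A', l = A ++ A' ∧ EndsOutside S A ∧ (∀ a ∈ A', a ∈ S) ∧ (A.map w).sum = c

theorem PrefixWeight.winner {S : Set α} {l : List α} {t b : α} {w : α → ℝ} {c : ℝ}
    (h : PrefixWeight S (l ++ [t]) w c) (ht : t ∈ S) (hb : b ∈ S) (htb : t ≠ b) :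
    PrefixWeight S (insertLeft t b l ++ [t]) (Function.update w t (w t - w b)) c := by
  obtain ⟨A, A', h1, h2, h3, h4⟩ := h
  obtain ⟨A'', rfl, rfl⟩ := h2.ne_nil_of_append ht h1.symm
  refine ⟨insertLeft t b A, insertLeft t b A'' ++ [t], ?_, h2.insertLeft ht, ?_, ?_⟩
  · rw [insertLeft_append, List.append_assoc]
  · intro a ha
    rcases List.mem_append.1 ha with ha | ha
    · rcases mem_insertLeft ha with ha | rfl
      · exact h3 a (List.mem_append_left _ ha)
      · exact hb
    · rw [List.mem_singleton.1 ha]; exact ht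
  · rw [sum_map_insertLeft htb, h4]

theorem PrefixWeight.loser {S : Set α} {l : List α} {t b : α} {w : α → ℝ} {c : ℝ}
    (h : PrefixWeight S (l ++ [b]) w c) (ht : t ∈ S) (hb : b ∈ S) (htb : t ≠ b) :
    PrefixWeight S (insertRight t b l) (Function.update w t (w t - w b)) c := by
  obtain ⟨A, A', h1, h2, h3, h4⟩ := h
  obtain ⟨A'', rfl, rfl⟩ := h2.ne_nil_of_append hb h1.symm
  refine ⟨insertRight t b A, insertRight t b A'', ?_, h2.insertRight ht, ?_, ?_⟩
  · rw [insertRight_append]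
  · intro a ha
    rcases mem_insertRight ha with ha | rfl
    · exact h3 a (List.mem_append_left _ ha)
    · exact hb
  · rw [sum_map_insertRight htb, h4]

end Cuts

namespace IntervalExchange

variable {n : ℕ}

theorem length_top_add_length_bottom (τ : IntervalExchange n) :
    τ.top.length + τ.bottom.length = 2 * n := by
  have := Multiset.sum_count_eq_card (s := Finset.univ) (m := ((τ.top ++ τ.bottom : List (Fin n)) :
    Multiset (Fin n))) (by simp)
  simp only [Multiset.coe_count, τ.count_eq_two] at this
  simp at this
  omega

theorem mem_top_or_mem_bottom (τ : IntervalExchange n) (i : Fin n) :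
    i ∈ τ.top ∨ i ∈ τ.bottom := by
  rw [← List.mem_append, ← List.count_pos_iff, τ.count_eq_two]
  norm_num

theorem cut_pos_iff {x y : Fin n} {w : Fin n → ℝ} (h : x ≠ y) :
    (∀ i, 0 < cut x y w i) ↔ (∀ i, 0 < w i) ∧ w y < w x := by
  simp only [cut_apply]
  constructor
  · intro hw
    have hx := hw x
    have hy := hw y
    simp only [if_true, if_neg h.symm] at hx hy
    refine ⟨fun i => ?_, by linarith⟩
    have := hw i
    split_ifs at this with hi
    · subst hi; linarith
    · exact this
  · rintro ⟨hw, hlt⟩ i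
    split_ifs with hi
    · linarith
    · exact hw i

theorem sum_cut {x y : Fin n} (w : Fin n → ℝ) : ∑ i, cut x y w i = ∑ i, w i - w y := by
  have : ∀ i, cut x y w i = w i - if i = x then w y else 0 := by
    intro i
    rw [cut_apply]
    split_ifs with h
    · rw [h]
    · simp
  simp [this]

theorem sum_map_le_mul {l : List (Fin n)} {w : Fin n → ℝ} {m : ℝ}
    (h : ∀ a ∈ l, w a ≤ m) : (l.map w).sum ≤ l.length * m := by
  simpa using List.sum_le_card_nsmul (l.map w) m (by simpa using h)

variable [NeZero n]

/-! ### Families of exchanges closed under splitting -/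

/-- A family of exchanges on which the splitting transformation can be studied: all members are
recurrent and end with different bands on the two sides, the result of a splitting of positive
weights is again in the family, and no relation between the positions of two gaps is satisfied by
all weights. -/
structure IsSplittingFamily (T : Set (IntervalExchange n)) : Prop where
  splittable : ∀ τ ∈ T, τ.Splittable
  exists_pos : ∀ τ ∈ T, ∃ w ∈ τ.switchSpace, ∀ i, 0 < w i
  succ_mem : ∀ τ ∈ T, ∀ w ∈ τ.switchSpace, (∀ i, 0 < w i) → w τ.topEnd ≠ w τ.botEnd →
    τ.succ (τ.dir w) ∈ T
  irreducible : ∀ τ ∈ T, ∀ A A' B B', τ.top = A ++ A' → τ.bottom = B ++ B' →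
    (A ≠ [] ∨ B ≠ []) → (A' ≠ [] ∨ B' ≠ []) →
    ∃ v ∈ τ.switchSpace, (A.map v).sum ≠ (B.map v).sum

/-- The weights for which some gap on the top is exactly above some gap on the bottom. -/
def connectionSet (τ : IntervalExchange n) : Set (Fin n → ℝ) :=
  {w | ∃ A A' B B', τ.top = A ++ A' ∧ τ.bottom = B ++ B' ∧ (A ≠ [] ∨ B ≠ []) ∧
    (A' ≠ [] ∨ B' ≠ []) ∧ (A.map w).sum = (B.map w).sum}

/-- Positive weights for which no connection ever appears in the splitting sequence. -/
def IsGeneric (p : IntervalExchange n × (Fin n → ℝ)) : Prop :=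
  p.2 ∈ p.1.switchSpace ∧ (∀ i, 0 < p.2 i) ∧
    ∀ k, (splitStep^[k] p).2 ∉ (splitStep^[k] p).1.connectionSet

theorem dir_eq_true_iff {τ : IntervalExchange n} {w : Fin n → ℝ} :
    τ.dir w = true ↔ w τ.botEnd < w τ.topEnd := by simp [dir]

theorem loser_le_winner (τ : IntervalExchange n) (w : Fin n → ℝ) :
    w (τ.loser (τ.dir w)) ≤ w (τ.winner (τ.dir w)) := by
  unfold winner loser
  cases h : τ.dir w
  · simpa [dir] using h
  · exact (dir_eq_true_iff.1 h).le

theorem loser_lt_winner {τ : IntervalExchange n} {w : Fin n → ℝ}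
    (hw : w τ.topEnd ≠ w τ.botEnd) : w (τ.loser (τ.dir w)) < w (τ.winner (τ.dir w)) := by
  refine lt_of_le_of_ne (τ.loser_le_winner w) ?_
  cases h : τ.dir w
  · exact hw
  · exact hw.symm

theorem ne_of_loser_lt_winner {τ : IntervalExchange n} {w : Fin n → ℝ} {d : Bool}
    (h : w (τ.loser d) < w (τ.winner d)) : w τ.topEnd ≠ w τ.botEnd ∧ τ.dir w = d := by
  cases d
  · exact ⟨ne_of_lt h, decide_eq_false (lt_asymm h)⟩
  · exact ⟨ne_of_gt h, dir_eq_true_iff.2 h⟩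

theorem corner_mem_connectionSet {τ : IntervalExchange n} (hτ : τ.Splittable) {w : Fin n → ℝ}
    (hw : w ∈ τ.switchSpace) (h : w τ.topEnd = w τ.botEnd) : w ∈ τ.connectionSet := by
  obtain ⟨A, B, hne, h1, h2⟩ := hτ.exists_eq
  refine ⟨A, [_], B, [_], h1, h2, ?_, Or.inl (by simp), ?_⟩
  · by_contra hAB
    push Not at hAB
    obtain ⟨rfl, rfl⟩ := hAB
    have := τ.count_eq_two τ.topEnd
    rw [h1, h2] at this
    simp [hne.symm] at this
  · have s1 : (τ.top.map w).sum = (A.map w).sum + w τ.topEnd := by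
      simpa using congrArg (fun l => (l.map w).sum) h1
    have s2 : (τ.bottom.map w).sum = (B.map w).sum + w τ.botEnd := by
      simpa using congrArg (fun l => (l.map w).sum) h2
    have := mem_switchSpace.1 hw
    linarith

variable {T : Set (IntervalExchange n)}

theorem IsGeneric.ne {p : IntervalExchange n × (Fin n → ℝ)} (hp : IsGeneric p)
    (hτ : p.1.Splittable) : p.2 p.1.topEnd ≠ p.2 p.1.botEnd := fun h =>
  hp.2.2 0 (corner_mem_connectionSet hτ hp.1 h)

theorem IsGeneric.splitStep {p : IntervalExchange n × (Fin n → ℝ)} (hp : IsGeneric p)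
    (hτ : p.1.Splittable) : IsGeneric (splitStep p) := by
  refine ⟨(cut_mem_switchSpace_iff hτ _).2 hp.1, ?_, fun k => hp.2.2 (k + 1)⟩
  exact (cut_pos_iff (hτ.winner_ne_loser _)).2 ⟨hp.2.1, loser_lt_winner (hp.ne hτ)⟩

theorem IsSplittingFamily.iterate (hT : IsSplittingFamily T)
    {p : IntervalExchange n × (Fin n → ℝ)} (hp : IsGeneric p) (hp1 : p.1 ∈ T) (k : ℕ) :
    IsGeneric (IntervalExchange.splitStep^[k] p) ∧ (IntervalExchange.splitStep^[k] p).1 ∈ T := by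
  induction k with
  | zero => exact ⟨hp, hp1⟩
  | succ k ih =>
    rw [Function.iterate_succ_apply']
    have hs := hT.splittable _ ih.2
    exact ⟨ih.1.splitStep hs, hT.succ_mem _ ih.2 _ ih.1.1 ih.1.2.1 (ih.1.ne hs)⟩

theorem winner_eq_end {τ : IntervalExchange n} (hτ : τ.Splittable) (d : Bool) :
    τ.winner d = (τ.succ d).topEnd ∨ τ.winner d = (τ.succ d).botEnd := by
  obtain ⟨A, B, hne, h1, h2⟩ := hτ.exists_eq
  cases d
  · right
    exact (botEnd_of_eq (Splittable.top_succ_false hne h1 h2).2).symm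
  · left
    exact (topEnd_of_eq (Splittable.top_succ_true hne h1 h2).1).symm

theorem IsSplittingFamily.measure_connectionSet (hT : IsSplittingFamily T)
    {τ : IntervalExchange n} (hτ : τ ∈ T) : τ.weightMeasure τ.connectionSet = 0 := by
  let S : ℕ × ℕ → Set (Fin n → ℝ) := fun q =>
    {w | (τ.top.take q.1 ≠ [] ∨ τ.bottom.take q.2 ≠ []) ∧
      (τ.top.drop q.1 ≠ [] ∨ τ.bottom.drop q.2 ≠ []) ∧
      ((τ.top.take q.1).map w).sum = ((τ.bottom.take q.2).map w).sum}
  have hsub : τ.connectionSet ⊆ ⋃ q, S q := by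
    rintro w ⟨A, A', B, B', h1, h2, h3, h4, h5⟩
    refine Set.mem_iUnion.2 ⟨(A.length, B.length), ?_⟩
    simp only [S, h1, h2]
    simpa using ⟨h3, h4, h5⟩
  refine measure_mono_null hsub (measure_iUnion_null fun q => ?_)
  by_cases h : (τ.top.take q.1 ≠ [] ∨ τ.bottom.take q.2 ≠ []) ∧
      (τ.top.drop q.1 ≠ [] ∨ τ.bottom.drop q.2 ≠ [])
  · obtain ⟨v, hv, hne⟩ := hT.irreducible τ hτ _ _ _ _ (List.take_append_drop q.1 τ.top).symm
      (List.take_append_drop q.2 τ.bottom).symm h.1 h.2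
    let f : List (Fin n) → (Fin n → ℝ) →ₗ[ℝ] ℝ := fun l =>
      { toFun := fun w => (l.map w).sum
        map_add' := fun u w => List.sum_map_add
        map_smul' := fun c u => List.sum_map_mul_left _ _ _ }
    refine measure_mono_null ?_ (τ.weightMeasure_ker (f (τ.top.take q.1) - f (τ.bottom.take q.2))
      hv (sub_ne_zero.2 hne))
    intro w hw
    exact sub_eq_zero.2 hw.2.2
  · convert measure_empty (μ := τ.weightMeasure)
    ext w
    exact ⟨fun hw => h ⟨hw.1, hw.2.1⟩, fun hw => hw.elim⟩

/-- One splitting step changes the measures by a constant factor only. -/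
theorem Splittable.exists_measure_preimage_cut {τ : IntervalExchange n} (hτ : τ.Splittable)
    (d : Bool) : ∃ κ : ENNReal, κ ≠ 0 ∧ κ ≠ ⊤ ∧ ∀ s,
      τ.weightMeasure (cut (τ.winner d) (τ.loser d) ⁻¹' s) = κ * (τ.succ d).weightMeasure s :=
  exists_weightMeasure_preimage τ (τ.succ d) (cutEquiv (hτ.winner_ne_loser d))
    fun _ => cut_mem_switchSpace_iff hτ d

/-- Almost no splitting sequence is in a given null set after `k` steps. -/
theorem IsSplittingFamily.measure_iterate_mem (hT : IsSplittingFamily T)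
    {Z : IntervalExchange n → Set (Fin n → ℝ)} (hZ : ∀ τ ∈ T, τ.weightMeasure (Z τ) = 0) (k : ℕ) :
    ∀ τ ∈ T, τ.weightMeasure {w | w ∈ τ.switchSpace ∧ (∀ i, 0 < w i) ∧
      (∀ j < k, (splitStep^[j] (τ, w)).2 (splitStep^[j] (τ, w)).1.topEnd ≠
        (splitStep^[j] (τ, w)).2 (splitStep^[j] (τ, w)).1.botEnd) ∧
      (splitStep^[k] (τ, w)).2 ∈ Z (splitStep^[k] (τ, w)).1} = 0 := by
  induction k with
  | zero => exact fun τ hτ => measure_mono_null (fun w hw => hw.2.2.2) (hZ τ hτ)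
  | succ k ih =>
    intro τ hτ
    have hs := hT.splittable τ hτ
    let S : Bool → Set (Fin n → ℝ) := fun d => {w | w ∈ τ.switchSpace ∧ (∀ i, 0 < w i) ∧
      (∀ j < k + 1, (splitStep^[j] (τ, w)).2 (splitStep^[j] (τ, w)).1.topEnd ≠
        (splitStep^[j] (τ, w)).2 (splitStep^[j] (τ, w)).1.botEnd) ∧
      (splitStep^[k + 1] (τ, w)).2 ∈ Z (splitStep^[k + 1] (τ, w)).1 ∧ τ.dir w = d}
    have hS : ∀ d, τ.weightMeasure (S d) = 0 := by
      intro d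
      rcases (S d).eq_empty_or_nonempty with h | ⟨w, hw⟩
      · rw [h, measure_empty]
      have hmem : τ.succ d ∈ T := by
        have := hT.succ_mem τ hτ w hw.1 hw.2.1 (hw.2.2.1 0 (Nat.succ_pos _))
        rwa [hw.2.2.2.2] at this
      obtain ⟨κ, -, -, hκ⟩ := hs.exists_measure_preimage_cut d
      refine measure_mono_null ?_ ((hκ _).trans (by rw [ih _ hmem, mul_zero]))
      rintro w ⟨h1, h2, h3, h4, rfl⟩
      exact ⟨(cut_mem_switchSpace_iff hs _).2 h1,
        (cut_pos_iff (hs.winner_ne_loser _)).2 ⟨h2, loser_lt_winner (h3 0 (Nat.succ_pos _))⟩,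
        fun j hj => h3 (j + 1) (by omega), h4⟩
    refine measure_mono_null (t := S false ∪ S true) ?_ (measure_union_null (hS _) (hS _))
    rintro w ⟨h1, h2, h3, h4⟩
    cases hd : τ.dir w
    · exact Or.inl ⟨h1, h2, h3, h4, hd⟩
    · exact Or.inr ⟨h1, h2, h3, h4, hd⟩

/-- Almost all positive weights are generic. -/
theorem IsSplittingFamily.measure_not_isGeneric (hT : IsSplittingFamily T)
    {τ : IntervalExchange n} (hτ : τ ∈ T) :
    τ.weightMeasure {w | w ∈ τ.switchSpace ∧ (∀ i, 0 < w i) ∧ ¬ IsGeneric (τ, w)} = 0 := by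
  refine measure_mono_null ?_ (measure_iUnion_null fun k =>
    hT.measure_iterate_mem (fun σ hσ => hT.measure_connectionSet hσ) k τ hτ)
  rintro w ⟨h1, h2, h3⟩
  have h4 : ∃ k, (splitStep^[k] (τ, w)).2 ∈ (splitStep^[k] (τ, w)).1.connectionSet := by
    simpa [IsGeneric, h1, h2] using h3
  classical
  -- Up to the first connection no corner case has occurred.
  have key : ∀ j ≤ Nat.find h4, (splitStep^[j] (τ, w)).1 ∈ T ∧
      (splitStep^[j] (τ, w)).2 ∈ (splitStep^[j] (τ, w)).1.switchSpace ∧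
      (∀ i, 0 < (splitStep^[j] (τ, w)).2 i) ∧
      ∀ l < j, (splitStep^[l] (τ, w)).2 (splitStep^[l] (τ, w)).1.topEnd ≠
        (splitStep^[l] (τ, w)).2 (splitStep^[l] (τ, w)).1.botEnd := by
    intro j
    induction j with
    | zero => exact fun _ => ⟨hτ, h1, h2, fun l hl => absurd hl (by omega)⟩
    | succ j ih =>
      intro hj
      obtain ⟨i1, i2, i3, i4⟩ := ih (by omega)
      have hs := hT.splittable _ i1
      have hne := fun h => Nat.find_min h4 (by omega : j < _) (corner_mem_connectionSet hs i2 h)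
      rw [Function.iterate_succ_apply']
      refine ⟨hT.succ_mem _ i1 _ i2 i3 hne, (cut_mem_switchSpace_iff hs _).2 i2,
        (cut_pos_iff (hs.winner_ne_loser _)).2 ⟨i3, loser_lt_winner hne⟩, fun l hl => ?_⟩
      rcases Nat.lt_succ_iff_lt_or_eq.1 hl with hl | rfl
      · exact i4 l hl
      · exact hne
  exact Set.mem_iUnion.2 ⟨Nat.find h4, h1, h2, (key _ le_rfl).2.2.2, Nat.find_spec h4⟩

/-! ### Every band takes part infinitely often -/

/-- The band is the rightmost one on the top or on the bottom. -/
def IsEnd (τ : IntervalExchange n) (i : Fin n) : Prop := i = τ.topEnd ∨ i = τ.botEnd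

theorem isEnd_iff (τ : IntervalExchange n) (i : Fin n) (d : Bool) :
    τ.IsEnd i ↔ i = τ.winner d ∨ i = τ.loser d := by
  cases d
  · exact or_comm
  · exact Iff.rfl

/-- A band `i` that takes part in infinitely many steps has widths tending to zero. -/
theorem tendsto_weight_zero {p : ℕ → IntervalExchange n × (Fin n → ℝ)}
    (hstep : ∀ k, p (k + 1) = splitStep (p k)) (hs : ∀ k, (p k).1.Splittable)
    (hpos : ∀ k i, 0 < (p k).2 i) {i : Fin n} (hi : ∃ᶠ k in atTop, (p k).1.IsEnd i) :
    Tendsto (fun k => (p k).2 i) atTop (nhds 0) := by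
  set d : ℕ → Bool := fun k => (p k).1.dir (p k).2 with hd
  set x : ℕ → Fin n := fun k => (p k).1.winner (d k) with hx
  set y : ℕ → Fin n := fun k => (p k).1.loser (d k) with hy
  have hw : ∀ k j, (p (k + 1)).2 j = if j = x k then (p k).2 (x k) - (p k).2 (y k)
      else (p k).2 j := by
    intro k j
    rw [hstep]
    exact cut_apply _ _ _ _
  have hxy : ∀ k, x k ≠ y k := fun k => (hs k).winner_ne_loser _
  have hanti : ∀ j, Antitone fun k => (p k).2 j := by
    intro j
    refine antitone_nat_of_succ_le fun k => ?_
    rw [hw]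
    split_ifs with h
    · rw [h]; linarith [hpos k (y k)]
    · exact le_rfl
  -- The total width decreases by the width of the losing band in each step.
  have hlose : Tendsto (fun k => (p k).2 (y k)) atTop (nhds 0) := by
    have hsum : ∀ k, ∑ j, (p (k + 1)).2 j = ∑ j, (p k).2 j - (p k).2 (y k) := by
      intro k
      rw [hstep]
      exact sum_cut _
    have hS : Antitone fun k => ∑ j, (p k).2 j := fun a b hab =>
      Finset.sum_le_sum fun j _ => hanti j hab
    have hb : BddBelow (Set.range fun k => ∑ j, (p k).2 j) := by
      refine ⟨0, ?_⟩
      rintro _ ⟨k, rfl⟩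
      exact Finset.sum_nonneg fun j _ => (hpos k j).le
    have h1 := tendsto_atTop_ciInf hS hb
    have h2 := h1.sub (h1.comp (tendsto_add_atTop_nat 1))
    rw [sub_self] at h2
    refine h2.congr fun k => ?_
    simp only [Function.comp_apply, hsum]
    ring
  have hfreq : ∃ᶠ k in atTop, y k = i := by
    intro hnot
    obtain ⟨N, hN⟩ := eventually_atTop.1 hnot
    obtain ⟨k, hk, hki⟩ := frequently_atTop.1 hi N
    -- From this time on the band `i` always wins, against bands of constant widths.
    have hwin : ∀ m, x (k + m) = i := by
      intro m
      induction m with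
      | zero =>
        rcases (isEnd_iff _ i (d k)).1 hki with h | h
        · exact h.symm
        · exact absurd h.symm (hN k hk)
      | succ m ih =>
        have h1 : (p (k + m + 1)).1.IsEnd i := by
          rw [hstep, ← ih]
          exact winner_eq_end (hs _) _
        rcases (isEnd_iff _ i (d (k + m + 1))).1 h1 with h | h
        · exact h.symm
        · exact absurd h.symm (hN (k + m + 1) (by omega))
    have hconst : ∀ j, j ≠ i → ∀ m, (p (k + m)).2 j = (p k).2 j := by
      intro j hj m
      induction m with
      | zero => rfl
      | succ m ih =>
        rw [← add_assoc, hw, hwin, if_neg hj, ih]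
    obtain ⟨j₀, -, hj₀⟩ := Finset.exists_min_image Finset.univ (p k).2 ⟨i, Finset.mem_univ i⟩
    have h1 := hlose.eventually (gt_mem_nhds (hpos k j₀))
    obtain ⟨M, hM⟩ := eventually_atTop.1 h1
    have h2 := hM (k + M) (by omega)
    rw [hconst _ (by rw [← hwin M]; exact (hxy _).symm)] at h2
    exact absurd (hj₀ _ (Finset.mem_univ _)) (not_le.2 h2)
  rw [Metric.tendsto_atTop]
  intro ε hε
  obtain ⟨k, hk1, hk2⟩ := (hfreq.and_eventually (hlose.eventually (gt_mem_nhds hε))).exists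
  refine ⟨k, fun m hm => ?_⟩
  rw [Real.dist_eq, sub_zero, abs_of_pos (hpos m i)]
  rw [hk1] at hk2
  exact (hanti i hm).trans_lt hk2

theorem PrefixWeight.splitStep {S : Set (Fin n)} {p : IntervalExchange n × (Fin n → ℝ)}
    (hs : p.1.Splittable) (hS : ∀ i, p.1.IsEnd i → i ∈ S) {c c' : ℝ}
    (h : PrefixWeight S p.1.top p.2 c) (h' : PrefixWeight S p.1.bottom p.2 c') :
    PrefixWeight S (splitStep p).1.top (splitStep p).2 c ∧
      PrefixWeight S (splitStep p).1.bottom (splitStep p).2 c' := by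
  obtain ⟨A, B, hne, h1, h2⟩ := hs.exists_eq
  have ht := hS _ (Or.inl rfl)
  have hb := hS _ (Or.inr rfl)
  rw [h1] at h
  rw [h2] at h'
  unfold IntervalExchange.splitStep
  cases hd : p.1.dir p.2
  · have e := Splittable.top_succ_false hne h1 h2
    simp only
    rw [e.1, e.2]
    exact ⟨h.loser hb ht hne.symm, h'.winner hb ht hne.symm⟩
  · have e := Splittable.top_succ_true hne h1 h2
    simp only
    rw [e.1, e.2]
    exact ⟨h.winner ht hb hne, h'.loser ht hb hne⟩

/-- In a generic splitting sequence every band is rightmost infinitely often: otherwise the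
positions of the last ends of the bands that are eventually inactive do not change, while the
total width of the ends behind them tends to zero, so that these positions coincide. -/
theorem IsSplittingFamily.frequently_isEnd (hT : IsSplittingFamily T)
    {q : IntervalExchange n × (Fin n → ℝ)} (hq : IsGeneric q) (hq1 : q.1 ∈ T) (i : Fin n) :
    ∃ᶠ k in atTop, (IntervalExchange.splitStep^[k] q).1.IsEnd i := by
  set p : ℕ → IntervalExchange n × (Fin n → ℝ) := fun k => IntervalExchange.splitStep^[k] q with hp
  have hgen : ∀ k, IsGeneric (p k) ∧ (p k).1 ∈ T := fun k => hT.iterate hq hq1 k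
  have hstep : ∀ k, p (k + 1) = IntervalExchange.splitStep (p k) := fun k =>
    Function.iterate_succ_apply' _ _ _
  have hs : ∀ k, (p k).1.Splittable := fun k => hT.splittable _ (hgen k).2
  have hpos : ∀ k i, 0 < (p k).2 i := fun k => (hgen k).1.2.1
  by_contra hi
  let S : Set (Fin n) := {j | ∃ᶠ k in atTop, (p k).1.IsEnd j}
  have hev : ∀ᶠ k in atTop, ∀ j, j ∉ S → ¬ (p k).1.IsEnd j := by
    rw [eventually_all]
    intro j
    by_cases hj : j ∈ S
    · exact Eventually.of_forall fun k h => absurd hj h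
    · have : ∀ᶠ k in atTop, ¬ (p k).1.IsEnd j := not_frequently.1 hj
      exact this.mono fun k hk _ => hk
  obtain ⟨N, hN⟩ := eventually_atTop.1 hev
  have hNS : ∀ k, N ≤ k → ∀ j, (p k).1.IsEnd j → j ∈ S := fun k hk j hj => by
    by_contra h
    exact hN k hk j h hj
  obtain ⟨A, A', eA, hA, hA'⟩ := exists_endsOutside_append S (p N).1.top
  obtain ⟨B, B', eB, hB, hB'⟩ := exists_endsOutside_append S (p N).1.bottom
  have hpre : ∀ m, PrefixWeight S (p (N + m)).1.top (p (N + m)).2 (A.map (p N).2).sum ∧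
      PrefixWeight S (p (N + m)).1.bottom (p (N + m)).2 (B.map (p N).2).sum := by
    intro m
    induction m with
    | zero => exact ⟨⟨A, A', eA, hA, hA', rfl⟩, ⟨B, B', eB, hB, hB', rfl⟩⟩
    | succ m ih =>
      rw [← add_assoc, hstep]
      exact PrefixWeight.splitStep (hs _) (hNS _ (by omega)) ih.1 ih.2
  -- An upper bound for the widths of all bands that take part infinitely often.
  let μ : ℕ → ℝ := fun m => ∑ j, S.indicator (p (N + m)).2 j
  have hμ : Tendsto μ atTop (nhds 0) := by
    rw [show (0 : ℝ) = ∑ _j : Fin n, 0 by simp]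
    refine tendsto_finsetSum _ fun j _ => ?_
    by_cases hj : j ∈ S
    · simp only [Set.indicator_of_mem hj]
      have := (tendsto_weight_zero hstep hs hpos hj).comp (tendsto_add_atTop_nat N)
      refine this.congr fun m => ?_
      simp [add_comm]
    · simp [Set.indicator_of_notMem hj]
  have hμS : ∀ m, ∀ j ∈ S, (p (N + m)).2 j ≤ μ m := by
    intro m j hj
    have := Finset.single_le_sum (f := S.indicator (p (N + m)).2)
      (fun j _ => Set.indicator_nonneg (fun j _ => (hpos (N + m) j).le) j) (Finset.mem_univ j)
    rwa [Set.indicator_of_mem hj] at this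
  have hμ0 : ∀ m, 0 ≤ μ m := fun m =>
    Finset.sum_nonneg fun j _ => Set.indicator_nonneg (fun j _ => (hpos (N + m) j).le) j
  have hside : ∀ (m : ℕ) (l : List (Fin n)) (c : ℝ), l.length ≤ 2 * n →
      PrefixWeight S l (p (N + m)).2 c →
      c ≤ (l.map (p (N + m)).2).sum ∧ (l.map (p (N + m)).2).sum ≤ c + 2 * n * μ m := by
    rintro m l c hl ⟨C, C', rfl, -, hC', rfl⟩
    rw [List.map_append, List.sum_append]
    constructor
    · have : 0 ≤ (C'.map (p (N + m)).2).sum := List.sum_nonneg (by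
        simp only [List.mem_map, forall_exists_index, and_imp, forall_apply_eq_imp_iff₂]
        exact fun j _ => (hpos _ j).le)
      linarith
    · have h1 := sum_map_le_mul (w := (p (N + m)).2) fun a ha => hμS m a (hC' a ha)
      have h2 : (C'.length : ℝ) ≤ 2 * n := by
        rw [List.length_append] at hl
        exact_mod_cast (by omega : C'.length ≤ 2 * n)
      have := mul_le_mul_of_nonneg_right h2 (hμ0 m)
      linarith
  have hdiff : ∀ m, |(A.map (p N).2).sum - (B.map (p N).2).sum| ≤ 2 * n * μ m := by
    intro m
    have hlen := (p (N + m)).1.length_top_add_length_bottom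
    have h1 := hside m _ _ (by omega) (hpre m).1
    have h2 := hside m _ _ (by omega) (hpre m).2
    have h3 := mem_switchSpace.1 (hgen (N + m)).1.1
    rw [abs_le]
    constructor <;> linarith
  have heq : (A.map (p N).2).sum = (B.map (p N).2).sum := by
    have h1 : Tendsto (fun m => 2 * n * μ m) atTop (nhds 0) := by
      simpa using hμ.const_mul (2 * (n : ℝ))
    have h2 := ge_of_tendsto' h1 hdiff
    exact sub_eq_zero.1 (abs_nonpos_iff.1 h2)
  refine (hgen N).1.2.2 0 ⟨A, A', B, B', eA, eB, ?_, Or.inl ?_, heq⟩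
  · rcases (p N).1.mem_top_or_mem_bottom i with h | h
    · rw [eA, List.mem_append] at h
      rcases h with h | h
      · exact Or.inl (List.ne_nil_of_mem h)
      · exact absurd (hA' i h) hi
    · rw [eB, List.mem_append] at h
      rcases h with h | h
      · exact Or.inr (List.ne_nil_of_mem h)
      · exact absurd (hB' i h) hi
  · obtain ⟨A₀, -, -, e, -⟩ := (hs N).exists_eq
    rw [eA] at e
    obtain ⟨A'', rfl, -⟩ := hA.ne_nil_of_append (hNS N le_rfl _ (Or.inl rfl)) e
    simp

end IntervalExchange

namespace IntervalExchange

variable {n : ℕ}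

/-! ### Words of splittings and heights -/

/-- The effect on the heights of a splitting in which `x` wins and `y` loses. -/
def grow (x y : Fin n) (h : Fin n → ℝ) : Fin n → ℝ := Function.update h y (h y + h x)

theorem grow_apply (x y i : Fin n) (h : Fin n → ℝ) :
    grow x y h i = if i = y then h y + h x else h i := by
  simp [grow, Function.update_apply]

theorem grow_dotProduct_cut {x y : Fin n} (hxy : x ≠ y) (h w : Fin n → ℝ) :
    grow x y h ⬝ᵥ cut x y w = h ⬝ᵥ w := by
  have : ∀ i, grow x y h i * cut x y w i = h i * w i + ((if i = y then h x * w y else 0) -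
      if i = x then h x * w y else 0) := by
    intro i
    rw [grow_apply, cut_apply]
    by_cases h1 : i = y
    · subst h1; simp [hxy.symm]; ring
    · by_cases h2 : i = x
      · subst h2; simp [hxy]; ring
      · simp [h1, h2]
  simp [dotProduct, this, Finset.sum_add_distrib]

theorem le_grow {x y : Fin n} {h : Fin n → ℝ} (hh : ∀ i, 0 < h i) (i : Fin n) :
    h i ≤ grow x y h i := by
  rw [grow_apply]
  split_ifs with hi
  · rw [hi]; linarith [hh x]
  · exact le_rfl

theorem measurable_cut (x y : Fin n) : Measurable (cut x y) := by
  rw [measurable_pi_iff]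
  intro i
  simp only [cut_apply]
  split_ifs
  · exact (measurable_pi_apply x).sub (measurable_pi_apply y)
  · exact measurable_pi_apply i

/-- The proportion of `N` in the weights of total height at most `1` is at most `c`. -/
def Bound (N : IntervalExchange n → Set (Fin n → ℝ)) (c : ℝ) (τ : IntervalExchange n)
    (h : Fin n → ℝ) : Prop :=
  τ.weightMeasure (N τ ∩ τ.weightSet h) ≤ ENNReal.ofReal c * τ.weightMeasure (τ.weightSet h)

theorem Bound.mono {N : IntervalExchange n → Set (Fin n → ℝ)} {c c' : ℝ} (hc : c ≤ c')
    {τ : IntervalExchange n} {h : Fin n → ℝ} (hB : Bound N c τ h) : Bound N c' τ h :=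
  hB.trans (by gcongr)

variable [NeZero n]

/-- The exchange and the heights after the splittings in the directions given by a word. -/
def descend (q : IntervalExchange n × (Fin n → ℝ)) (u : List Bool) :
    IntervalExchange n × (Fin n → ℝ) :=
  u.foldl (fun q d => (q.1.succ d, grow (q.1.winner d) (q.1.loser d) q.2)) q

/-- The exchange after the splittings in the directions given by a word. -/
def path (τ : IntervalExchange n) (u : List Bool) : IntervalExchange n := u.foldl succ τ

theorem descend_fst (q : IntervalExchange n × (Fin n → ℝ)) (u : List Bool) :
    (descend q u).1 = path q.1 u := by
  induction u generalizing q with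
  | nil => rfl
  | cons d u ih => exact ih _

/-- The splitting sequence of the weights begins with the directions given by a word. -/
def Follows : List Bool → IntervalExchange n × (Fin n → ℝ) → Prop
  | [], _ => True
  | d :: u, p => p.2 (p.1.loser d) < p.2 (p.1.winner d) ∧
      Follows u (p.1.succ d, cut (p.1.winner d) (p.1.loser d) p.2)

/-- The directions of the first `k` splittings. -/
noncomputable def word (p : IntervalExchange n × (Fin n → ℝ)) : ℕ → List Bool
  | 0 => []
  | k + 1 => word p k ++ [(splitStep^[k] p).1.dir (splitStep^[k] p).2]

theorem length_word (p : IntervalExchange n × (Fin n → ℝ)) (k : ℕ) : (word p k).length = k := by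
  induction k with
  | zero => rfl
  | succ k ih => simp [word, ih]

theorem word_add (p : IntervalExchange n × (Fin n → ℝ)) (k l : ℕ) :
    word p (k + l) = word p k ++ word (splitStep^[k] p) l := by
  induction l with
  | zero => simp [word]
  | succ l ih =>
    rw [← add_assoc, word, ih, word, ← Function.iterate_add_apply, add_comm l k, List.append_assoc]

theorem path_word (p : IntervalExchange n × (Fin n → ℝ)) (k : ℕ) :
    path p.1 (word p k) = (splitStep^[k] p).1 := by
  induction k with
  | zero => rfl
  | succ k ih =>
    rw [word, path, List.foldl_append, Function.iterate_succ_apply']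
    change (path p.1 (word p k)).succ _ = _
    rw [ih]
    rfl

theorem follows_cons {d : Bool} {u : List Bool} {p : IntervalExchange n × (Fin n → ℝ)}
    (h : Follows (d :: u) p) :
    p.2 p.1.topEnd ≠ p.2 p.1.botEnd ∧ p.1.dir p.2 = d ∧ Follows u (splitStep p) := by
  obtain ⟨h1, h2⟩ := ne_of_loser_lt_winner h.1
  refine ⟨h1, h2, ?_⟩
  have := h.2
  rw [← h2] at this
  exact this

theorem Follows.eq_word {u : List Bool} {p : IntervalExchange n × (Fin n → ℝ)}
    (h : Follows u p) : u = word p u.length := by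
  induction u generalizing p with
  | nil => rfl
  | cons d u ih =>
    obtain ⟨-, h2, h3⟩ := follows_cons h
    rw [List.length_cons, add_comm, word_add, Function.iterate_one, ← ih h3]
    simp [word, h2]

theorem follows_append {u v : List Bool} {p : IntervalExchange n × (Fin n → ℝ)} :
    Follows (u ++ v) p ↔ Follows u p ∧ Follows v (splitStep^[u.length] p) := by
  induction u generalizing p with
  | nil => simp [Follows]
  | cons d u ih =>
    constructor
    · intro h
      obtain ⟨h1, h2, h3⟩ := follows_cons h
      obtain ⟨h4, h5⟩ := ih.1 h3
      subst h2
      exact ⟨⟨loser_lt_winner h1, h4⟩, h5⟩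
    · rintro ⟨h, hv⟩
      obtain ⟨h1, h2, h3⟩ := follows_cons h
      have := ih.2 ⟨h3, hv⟩
      subst h2
      exact ⟨loser_lt_winner h1, this⟩

theorem Follows.word {p : IntervalExchange n × (Fin n → ℝ)} {k : ℕ}
    (h : ∀ j < k, (splitStep^[j] p).2 (splitStep^[j] p).1.topEnd ≠
      (splitStep^[j] p).2 (splitStep^[j] p).1.botEnd) : Follows (word p k) p := by
  induction k with
  | zero => trivial
  | succ k ih =>
    rw [IntervalExchange.word, follows_append, length_word]
    exact ⟨ih fun j hj => h j (by omega), loser_lt_winner (h k (by omega)), trivial⟩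

variable {T : Set (IntervalExchange n)}

theorem IsSplittingFamily.follows_word (hT : IsSplittingFamily T)
    {p : IntervalExchange n × (Fin n → ℝ)} (hp : IsGeneric p) (hp1 : p.1 ∈ T) (k : ℕ) :
    Follows (word p k) p :=
  Follows.word fun j _ => (hT.iterate hp hp1 j).1.ne (hT.splittable _ (hT.iterate hp hp1 j).2)

theorem descend_word_succ (p : IntervalExchange n × (Fin n → ℝ)) (h : Fin n → ℝ) (k : ℕ) :
    (descend (p.1, h) (word p (k + 1))).2 =
      grow ((splitStep^[k] p).1.winner ((splitStep^[k] p).1.dir (splitStep^[k] p).2))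
        ((splitStep^[k] p).1.loser ((splitStep^[k] p).1.dir (splitStep^[k] p).2))
        (descend (p.1, h) (word p k)).2 := by
  have h1 : (descend (p.1, h) (word p k)).1 = (splitStep^[k] p).1 :=
    (descend_fst _ _).trans (path_word p k)
  rw [word, descend, List.foldl_append, ← h1]
  rfl

theorem descend_pos (q : IntervalExchange n × (Fin n → ℝ)) (u : List Bool)
    (hq : ∀ i, 0 < q.2 i) : ∀ i, q.2 i ≤ (descend q u).2 i := by
  induction u generalizing q with
  | nil => exact fun i => le_rfl
  | cons d u ih =>
    intro i
    exact (le_grow hq i).trans (ih (q.1.succ d, grow (q.1.winner d) (q.1.loser d) q.2)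
      (fun j => (hq j).trans_le (le_grow hq j)) i)

theorem descend_le (q : IntervalExchange n × (Fin n → ℝ)) (u : List Bool) {H : ℝ}
    (hq : ∀ i, 0 < q.2 i) (hH : ∀ i, q.2 i ≤ H) : ∀ i, (descend q u).2 i ≤ 2 ^ u.length * H := by
  induction u generalizing q H with
  | nil => simpa [descend] using hH
  | cons d u ih =>
    intro i
    refine (ih (q.1.succ d, grow (q.1.winner d) (q.1.loser d) q.2) (H := 2 * H)
      (fun j => (hq j).trans_le (le_grow hq j)) (fun j => ?_) i).trans (le_of_eq ?_)
    · simp only [grow_apply]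
      split_ifs
      · linarith [hH (q.1.loser d), hH (q.1.winner d)]
      · linarith [hH j, hq j]
    · rw [List.length_cons, pow_succ]; ring

/-! ### Stopping at a set of words -/

/-- The weights whose splitting sequence begins with one of the words in `W`. -/
def stopSet (W : Set (List Bool)) (τ : IntervalExchange n) (h : Fin n → ℝ) : Set (Fin n → ℝ) :=
  {w | w ∈ τ.weightSet h ∧ ∃ u ∈ W, Follows u (τ, w)}

theorem cut_mem_weightSet_iff {τ : IntervalExchange n} (hτ : τ.Splittable) (d : Bool)
    {h w : Fin n → ℝ} :
    cut (τ.winner d) (τ.loser d) w ∈ (τ.succ d).weightSet (grow (τ.winner d) (τ.loser d) h) ↔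
      w ∈ τ.weightSet h ∧ w (τ.loser d) < w (τ.winner d) := by
  simp only [weightSet, Set.mem_ofPred_eq, cut_mem_switchSpace_iff hτ,
    cut_pos_iff (hτ.winner_ne_loser d), grow_dotProduct_cut (hτ.winner_ne_loser d)]
  tauto

theorem stopSet_eq_of_nil_mem {W : Set (List Bool)} (hW : [] ∈ W) (τ : IntervalExchange n)
    (h : Fin n → ℝ) : stopSet W τ h = τ.weightSet h := by
  ext w
  exact ⟨fun hw => hw.1, fun hw => ⟨hw, [], hW, trivial⟩⟩

theorem stopSet_eq_union {W : Set (List Bool)} (hW : [] ∉ W) {τ : IntervalExchange n}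
    (hτ : τ.Splittable) (h : Fin n → ℝ) :
    stopSet W τ h =
      cut (τ.winner true) (τ.loser true) ⁻¹' stopSet {u | true :: u ∈ W} (τ.succ true)
        (grow (τ.winner true) (τ.loser true) h) ∪
      cut (τ.winner false) (τ.loser false) ⁻¹' stopSet {u | false :: u ∈ W} (τ.succ false)
        (grow (τ.winner false) (τ.loser false) h) := by
  ext w
  simp only [stopSet, Set.mem_union, Set.mem_preimage, Set.mem_ofPred_eq, cut_mem_weightSet_iff hτ]
  constructor
  · rintro ⟨hw, u, hu, hf⟩
    cases u with
    | nil => exact absurd hu hW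
    | cons d u =>
      cases d
      · exact Or.inr ⟨⟨hw, hf.1⟩, u, hu, hf.2⟩
      · exact Or.inl ⟨⟨hw, hf.1⟩, u, hu, hf.2⟩
  · rintro (⟨⟨hw, h1⟩, u, hu, hf⟩ | ⟨⟨hw, h1⟩, u, hu, hf⟩)
    · exact ⟨hw, true :: u, hu, h1, hf⟩
    · exact ⟨hw, false :: u, hu, h1, hf⟩

theorem measurableSet_follows (u : List Bool) (τ : IntervalExchange n) :
    MeasurableSet {w | Follows u (τ, w)} := by
  induction u generalizing τ with
  | nil => exact MeasurableSet.univ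
  | cons d u ih =>
    have h1 : MeasurableSet {w : Fin n → ℝ | w (τ.loser d) < w (τ.winner d)} :=
      measurableSet_lt (measurable_pi_apply _) (measurable_pi_apply _)
    exact h1.inter (measurable_cut (τ.winner d) (τ.loser d) (ih (τ.succ d)))

theorem measurableSet_stopSet (W : Set (List Bool)) (τ : IntervalExchange n) (h : Fin n → ℝ) :
    MeasurableSet (stopSet W τ h) := by
  have : stopSet W τ h = τ.weightSet h ∩ ⋃ u ∈ W, {w | Follows u (τ, w)} := by
    ext w; simp [stopSet]
  rw [this]
  exact (τ.measurableSet_weightSet h).inter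
    (MeasurableSet.biUnion W.to_countable fun u _ => measurableSet_follows u τ)

/-- A family of sets of generic weights that is mapped into itself by the splitting
transformation. -/
structure IsStable (N : IntervalExchange n → Set (Fin n → ℝ)) : Prop where
  isGeneric : ∀ τ, ∀ w ∈ N τ, IsGeneric (τ, w)
  splitStep : ∀ τ, ∀ w ∈ N τ, (splitStep (τ, w)).2 ∈ N (splitStep (τ, w)).1

variable {N : IntervalExchange n → Set (Fin n → ℝ)}

theorem IsStable.preimage_stopSet_subset (hN : IsStable N) {τ : IntervalExchange n}
    (hτ : τ.Splittable) (d : Bool) (W : Set (List Bool)) (h : Fin n → ℝ) :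
    N τ ∩ cut (τ.winner d) (τ.loser d) ⁻¹' stopSet W (τ.succ d)
        (grow (τ.winner d) (τ.loser d) h) ⊆
      cut (τ.winner d) (τ.loser d) ⁻¹' (N (τ.succ d) ∩ stopSet W (τ.succ d)
        (grow (τ.winner d) (τ.loser d) h)) := by
  rintro w ⟨h1, h2⟩
  refine ⟨?_, h2⟩
  have h3 := ((cut_mem_weightSet_iff hτ d).1 h2.1).2
  have h4 := (ne_of_loser_lt_winner h3).2
  have := hN.splitStep τ w h1
  simp only [IntervalExchange.splitStep, h4] at this
  exact this

/-- If the proportion of `N` is at most `c` after each of finitely many words, then it is at most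
`c` in the set of the weights that begin with one of these words. -/
theorem IsStable.measure_stopSet_le_of_length_le (hT : IsSplittingFamily T) (hN : IsStable N)
    {c : ENNReal} (m : ℕ) : ∀ (W : Set (List Bool)) (_ : ∀ u ∈ W, u.length ≤ m), ∀ τ ∈ T,
      ∀ h : Fin n → ℝ, (∀ u ∈ W, path τ u ∈ T →
        (path τ u).weightMeasure (N (path τ u) ∩ (path τ u).weightSet (descend (τ, h) u).2) ≤
          c * (path τ u).weightMeasure ((path τ u).weightSet (descend (τ, h) u).2)) →
      τ.weightMeasure (N τ ∩ stopSet W τ h) ≤ c * τ.weightMeasure (stopSet W τ h) := by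
  induction m with
  | zero =>
    intro W hW τ hτ h hc
    by_cases h0 : [] ∈ W
    · rw [stopSet_eq_of_nil_mem h0]
      exact hc [] h0 hτ
    · have : stopSet W τ h = ∅ := by
        ext w
        simp only [stopSet, Set.mem_ofPred_eq, Set.mem_empty_iff_false, iff_false]
        rintro ⟨-, u, hu, -⟩
        exact h0 ((List.length_eq_zero_iff.1 (Nat.le_zero.1 (hW u hu))) ▸ hu)
      simp [this]
  | succ m ih =>
    intro W hW τ hτ h hc
    by_cases h0 : [] ∈ W
    · rw [stopSet_eq_of_nil_mem h0]
      exact hc [] h0 hτ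
    have hs := hT.splittable τ hτ
    let S : Bool → Set (Fin n → ℝ) := fun d => cut (τ.winner d) (τ.loser d) ⁻¹'
      stopSet {u | d :: u ∈ W} (τ.succ d) (grow (τ.winner d) (τ.loser d) h)
    have hS : ∀ d, τ.weightMeasure (N τ ∩ S d) ≤ c * τ.weightMeasure (S d) := by
      intro d
      rcases (N τ ∩ S d).eq_empty_or_nonempty with h | ⟨w, hw⟩
      · simp [h]
      have hgen := hN.isGeneric τ w hw.1
      have hlt := ((cut_mem_weightSet_iff hs d).1 hw.2.1).2
      have hmem : τ.succ d ∈ T := by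
        have := hT.succ_mem τ hτ w hgen.1 hgen.2.1 (ne_of_loser_lt_winner hlt).1
        rwa [(ne_of_loser_lt_winner hlt).2] at this
      obtain ⟨κ, -, -, hκ⟩ := hs.exists_measure_preimage_cut d
      refine (measure_mono (hN.preimage_stopSet_subset hs d _ h)).trans ?_
      rw [hκ, hκ, mul_left_comm]
      gcongr
      exact ih {u | d :: u ∈ W} (fun u hu => Nat.le_of_succ_le_succ (hW (d :: u) hu)) _ hmem _
        fun u hu hu' => hc (d :: u) hu hu'
    have hdisj : Disjoint (S true) (S false) := by
      rw [Set.disjoint_left]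
      intro w h1 h2
      exact lt_asymm ((cut_mem_weightSet_iff hs true).1 h1.1).2
        ((cut_mem_weightSet_iff hs false).1 h2.1).2
    have hm : MeasurableSet (S false) := measurable_cut _ _ (measurableSet_stopSet _ _ _)
    rw [stopSet_eq_union h0 hs, Set.inter_union_distrib_left, measure_union hdisj hm, mul_add]
    exact (measure_union_le _ _).trans (add_le_add (hS true) (hS false))

/-- If the proportion of `N` is at most `c` after each of the words in `W`, then it is at most
`c` in the set of the weights that begin with one of these words. -/
theorem IsStable.measure_stopSet_le (hT : IsSplittingFamily T) (hN : IsStable N)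
    {c : ENNReal} {W : Set (List Bool)} {τ : IntervalExchange n} (hτ : τ ∈ T) {h : Fin n → ℝ}
    (hc : ∀ u ∈ W, path τ u ∈ T →
      (path τ u).weightMeasure (N (path τ u) ∩ (path τ u).weightSet (descend (τ, h) u).2) ≤
        c * (path τ u).weightMeasure ((path τ u).weightSet (descend (τ, h) u).2)) :
    τ.weightMeasure (N τ ∩ stopSet W τ h) ≤ c * τ.weightMeasure (stopSet W τ h) := by
  let V : ℕ → Set (List Bool) := fun m => {u ∈ W | u.length ≤ m}
  have hV : stopSet W τ h = ⋃ m, stopSet (V m) τ h := by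
    ext w
    simp only [stopSet, Set.mem_iUnion, V, Set.mem_ofPred_eq]
    constructor
    · rintro ⟨hw, u, hu, hf⟩
      exact ⟨u.length, hw, u, ⟨hu, le_rfl⟩, hf⟩
    · rintro ⟨m, hw, u, hu, hf⟩
      exact ⟨hw, u, hu.1, hf⟩
  have hmono : Monotone fun m => N τ ∩ stopSet (V m) τ h := by
    rintro a b hab w ⟨h1, h2, u, hu, hf⟩
    exact ⟨h1, h2, u, ⟨hu.1, hu.2.trans hab⟩, hf⟩
  conv_lhs => rw [hV, Set.inter_iUnion, hmono.measure_iUnion]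
  refine iSup_le fun m => ?_
  refine (hN.measure_stopSet_le_of_length_le hT m (V m) (fun u hu => hu.2) τ hτ h
    fun u hu => hc u hu.1).trans ?_
  gcongr
  rw [hV]
  exact Set.subset_iUnion (fun m => stopSet (V m) τ h) m

/-- If the words in `W` are seen with probability at least `δ`, and if after each of these words
the proportion of `N` is at most `c`, then the proportion of `N` is at most `1 - δ * (1 - c)`. -/
theorem IsStable.bound_of_stopSet (hT : IsSplittingFamily T) (hN : IsStable N) {c δ : ℝ}
    (hc0 : 0 ≤ c) (hc1 : c ≤ 1) (hδ : 0 ≤ δ) {W : Set (List Bool)} {τ : IntervalExchange n}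
    (hτ : τ ∈ T) {h : Fin n → ℝ} (hh : ∀ i, 0 < h i)
    (hc : ∀ u ∈ W, path τ u ∈ T → Bound N c (path τ u) (descend (τ, h) u).2)
    (hW : ENNReal.ofReal δ * τ.weightMeasure (τ.weightSet h) ≤ τ.weightMeasure (stopSet W τ h)) :
    Bound N (1 - δ * (1 - c)) τ h := by
  have hsub : stopSet W τ h ⊆ τ.weightSet h := fun w hw => hw.1
  have h1 := hN.measure_stopSet_le hT hτ hc
  have hfin := τ.weightSet_lt_top hh
  have h2 : τ.weightMeasure (τ.weightSet h) = τ.weightMeasure (stopSet W τ h) +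
      τ.weightMeasure (τ.weightSet h \ stopSet W τ h) := by
    rw [measure_sdiff hsub (measurableSet_stopSet _ _ _).nullMeasurableSet
      ((measure_mono hsub).trans_lt hfin).ne, add_tsub_cancel_of_le (measure_mono hsub)]
  have h3 : τ.weightMeasure (N τ ∩ τ.weightSet h) ≤
      ENNReal.ofReal c * τ.weightMeasure (stopSet W τ h) +
        τ.weightMeasure (τ.weightSet h \ stopSet W τ h) := by
    refine (measure_mono (t := (N τ ∩ stopSet W τ h) ∪ (τ.weightSet h \ stopSet W τ h)) ?_).trans
      ((measure_union_le _ _).trans (by gcongr))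
    rintro w ⟨hw1, hw2⟩
    by_cases hw : w ∈ stopSet W τ h
    · exact Or.inl ⟨hw1, hw⟩
    · exact Or.inr ⟨hw2, hw⟩
  refine h3.trans ?_
  have hg : τ.weightMeasure (stopSet W τ h) ≠ ⊤ := ((measure_mono hsub).trans_lt hfin).ne
  have hr : τ.weightMeasure (τ.weightSet h \ stopSet W τ h) ≠ ⊤ :=
    ((measure_mono Set.sdiff_subset).trans_lt hfin).ne
  rw [h2] at hW ⊢
  lift τ.weightMeasure (stopSet W τ h) to NNReal using hg with g
  lift τ.weightMeasure (τ.weightSet h \ stopSet W τ h) to NNReal using hr with r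
  have e : ∀ x : NNReal, (x : ENNReal) = ENNReal.ofReal x := fun x => ENNReal.ofReal_coe_nnreal.symm
  have hg0 : (0 : ℝ) ≤ g := g.2
  have hr0 : (0 : ℝ) ≤ r := r.2
  rw [e g, e r, ← ENNReal.ofReal_add hg0 hr0, ← ENNReal.ofReal_mul hδ,
    ENNReal.ofReal_le_ofReal_iff hg0] at hW
  have hfac : 0 ≤ 1 - δ * (1 - c) ∨ (g : ℝ) + r = 0 := by
    by_contra hcon
    push Not at hcon
    have : δ * (1 - c) ≤ δ := by nlinarith
    have : 0 < (g : ℝ) + r := lt_of_le_of_ne (by positivity) (Ne.symm hcon.2)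
    nlinarith
  rcases hfac with hfac | hfac
  · rw [e g, e r, ← ENNReal.ofReal_add hg0 hr0, ← ENNReal.ofReal_mul hc0,
      ← ENNReal.ofReal_mul hfac, ← ENNReal.ofReal_add (by positivity) hr0]
    apply ENNReal.ofReal_le_ofReal
    nlinarith
  · have : g = 0 ∧ r = 0 := by
      constructor <;> ext <;> simp <;> linarith
    simp [this.1, this.2]

end IntervalExchange

namespace IntervalExchange

variable {n : ℕ}

instance : Finite (IntervalExchange n) := by
  have h : ∀ τ : IntervalExchange n,
      τ.top.length < 2 * n + 1 ∧ τ.bottom.length < 2 * n + 1 := fun τ => by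
    have := τ.length_top_add_length_bottom
    omega
  let f : IntervalExchange n → {l : List (Fin n) // l.length < 2 * n + 1} ×
      {l : List (Fin n) // l.length < 2 * n + 1} := fun τ => (⟨τ.top, (h τ).1⟩, ⟨τ.bottom, (h τ).2⟩)
  have : Finite {l : List (Fin n) // l.length < 2 * n + 1} :=
    (List.finite_length_lt (Fin n) (2 * n + 1)).to_subtype
  refine Finite.of_injective f fun τ σ hτσ => ?_
  simp only [f, Prod.mk.injEq, Subtype.mk.injEq] at hτσ
  exact IntervalExchange.ext hτσ.1 hτσ.2

theorem exists_lt_one_forall {ι : Type*} [Finite ι] {P : ι → ℝ → Prop}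
    (hmono : ∀ i c c', c ≤ c' → P i c → P i c') (h : ∀ i, ∃ c < 1, P i c) :
    ∃ c, 0 ≤ c ∧ c < 1 ∧ ∀ i, P i c := by
  choose c hc hP using h
  rcases isEmpty_or_nonempty ι with hι | hι
  · exact ⟨0, le_rfl, one_pos, fun i => hι.elim i⟩
  · obtain ⟨i₀, hi₀⟩ := Finite.exists_max c
    exact ⟨max 0 (c i₀), le_max_left _ _, max_lt one_pos (hc i₀), fun i =>
      hmono i _ _ ((hi₀ i).trans (le_max_right _ _)) (hP i)⟩

theorem cut_add (x y : Fin n) (u w : Fin n → ℝ) : cut x y (u + w) = cut x y u + cut x y w := by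
  ext i
  simp only [cut_apply, Pi.add_apply]
  split_ifs <;> ring

theorem cut_smul (x y : Fin n) (c : ℝ) (w : Fin n → ℝ) : cut x y (c • w) = c • cut x y w := by
  ext i
  simp only [cut_apply, Pi.smul_apply, smul_eq_mul]
  split_ifs <;> ring

variable [NeZero n] {T : Set (IntervalExchange n)}
  {N : IntervalExchange n → Set (Fin n → ℝ)}

/-! ### Prescribing the beginning of a splitting sequence -/

/-- The splitting sequence begins with the given word, and only bands in `L` take part in
these splittings. -/
def FollowsIn (L : Finset (Fin n)) : List Bool → IntervalExchange n × (Fin n → ℝ) → Prop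
  | [], _ => True
  | d :: u, p => (p.1.loser d ∈ L ∧ p.1.winner d ∈ L) ∧ p.2 (p.1.loser d) < p.2 (p.1.winner d) ∧
      FollowsIn L u (p.1.succ d, cut (p.1.winner d) (p.1.loser d) p.2)

theorem Follows.followsIn_univ {u : List Bool} {p : IntervalExchange n × (Fin n → ℝ)}
    (h : Follows u p) : FollowsIn Finset.univ u p := by
  induction u generalizing p with
  | nil => trivial
  | cons d u ih => exact ⟨⟨Finset.mem_univ _, Finset.mem_univ _⟩, h.1, ih h.2⟩

theorem FollowsIn.append {L : Finset (Fin n)} {u : List Bool} {d : Bool}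
    {p : IntervalExchange n × (Fin n → ℝ)} (h : FollowsIn L u p) (hf : Follows (u ++ [d]) p)
    (hL : (path p.1 u).loser d ∈ L ∧ (path p.1 u).winner d ∈ L) : FollowsIn L (u ++ [d]) p := by
  induction u generalizing p with
  | nil => exact ⟨hL, hf.1, trivial⟩
  | cons e u ih => exact ⟨h.1, h.2.1, ih h.2.2 hf.2 hL⟩

theorem Follows.smul {u : List Bool} {τ : IntervalExchange n} {w : Fin n → ℝ} {c : ℝ}
    (hc : 0 < c) (h : Follows u (τ, w)) : Follows u (τ, c • w) := by
  induction u generalizing τ w with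
  | nil => trivial
  | cons d u ih =>
    refine ⟨mul_lt_mul_of_pos_left h.1 hc, ?_⟩
    have := ih h.2
    rwa [← cut_smul] at this

/-- The beginning of the splitting sequence only depends on the widths of the bands that take
part in it, and is stable under small perturbations of these widths. -/
theorem FollowsIn.exists_perturb {L : Finset (Fin n)} {u : List Bool} {τ : IntervalExchange n}
    {w₀ : Fin n → ℝ} (h : FollowsIn L u (τ, w₀)) :
    ∃ ε : ℝ, 0 < ε ∧ ∀ w : Fin n → ℝ, (∀ i ∈ L, |w i| ≤ ε) → Follows u (τ, w₀ + w) := by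
  induction u generalizing τ w₀ with
  | nil => exact ⟨1, one_pos, fun _ _ => trivial⟩
  | cons d u ih =>
    obtain ⟨⟨hl, hw⟩, hlt, h⟩ := h
    obtain ⟨ε, hε, H⟩ := ih h
    simp only at hl hw hlt H
    refine ⟨min (ε / 2) ((w₀ (τ.winner d) - w₀ (τ.loser d)) / 3),
      lt_min (by linarith) (by linarith), fun w hwL => ⟨?_, ?_⟩⟩
    · have h1 := (abs_le.1 ((hwL _ hl).trans (min_le_right _ _))).2
      have h2 := (abs_le.1 ((hwL _ hw).trans (min_le_right _ _))).1
      simp only [Pi.add_apply]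
      linarith
    · simp only [cut_add]
      refine H _ fun i hi => ?_
      have h1 := (hwL _ hl).trans (min_le_left _ _)
      have h2 := (hwL _ hw).trans (min_le_left _ _)
      have h3 := (hwL _ hi).trans (min_le_left _ _)
      rw [cut_apply]
      split_ifs
      · rw [abs_le] at h1 h2 ⊢
        constructor <;> linarith
      · linarith [abs_nonneg (w i)]

/-- A word that involves only bands of large height, and that can be realized at all, is realized
with probability bounded below. The bound comes from translating all weights by a multiple
of a realization. -/
theorem exists_le_measure_stopSet {L : Finset (Fin n)} {u : List Bool} {τ : IntervalExchange n}
    {w₀ : Fin n → ℝ} (hw₀ : w₀ ∈ τ.switchSpace) (hpos : ∀ i, 0 < w₀ i)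
    (hu : FollowsIn L u (τ, w₀)) {K : ℝ} (hK : 0 < K) :
    ∃ δ : ℝ, 0 < δ ∧ ∀ h : Fin n → ℝ, (∀ i, 0 < h i) → (∀ i ∈ L, ∀ j, h j ≤ K * h i) →
      ENNReal.ofReal δ * τ.weightMeasure (τ.weightSet h) ≤
        τ.weightMeasure (stopSet {u} τ h) := by
  obtain ⟨ε, hε, H⟩ := hu.exists_perturb
  have hS : 0 < ∑ i, w₀ i := Finset.sum_pos (fun i _ => hpos i) Finset.univ_nonempty
  set ρ : ℝ := 1 + K / ε * ∑ i, w₀ i with hρ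
  have hρ0 : 0 < ρ := by positivity
  set D := Module.finrank ℝ τ.switchSpace with hD
  refine ⟨(ρ ^ D)⁻¹, by positivity, fun h hh hL => ?_⟩
  obtain ⟨j₀, -, hj₀⟩ := Finset.exists_max_image Finset.univ h Finset.univ_nonempty
  set s : ℝ := K / (ε * h j₀) with hs
  have hs0 : 0 < s := div_pos hK (mul_pos hε (hh j₀))
  open Pointwise in
  have hsub : (fun w => w + s • w₀) '' τ.weightSet h ⊆ ρ • stopSet {u} τ h := by
    rintro _ ⟨w, hw, rfl⟩
    have hfol : Follows u (τ, w + s • w₀) := by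
      have h1 : Follows u (τ, w₀ + s⁻¹ • w) := by
        refine H _ fun i hi => ?_
        have h2 : h i * w i ≤ 1 :=
          (mul_le_dotProduct (fun i => (hh i).le) (fun i => (hw.2.1 i).le) i).trans hw.2.2
        have h3 := hw.2.1 i
        have h4 : h j₀ * w i ≤ K := by
          calc h j₀ * w i ≤ K * h i * w i := by gcongr; exact hL i hi j₀
            _ = K * (h i * w i) := by ring
            _ ≤ K * 1 := by gcongr
            _ = K := mul_one K
        rw [Pi.smul_apply, smul_eq_mul, abs_of_pos (by positivity), inv_mul_le_iff₀ hs0, hs,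
          div_mul_eq_mul_div, le_div_iff₀ (mul_pos hε (hh j₀))]
        nlinarith
      have h2 := h1.smul hs0
      rwa [smul_add, smul_inv_smul₀ hs0.ne', add_comm] at h2
    rw [Set.mem_smul_set_iff_inv_smul_mem₀ hρ0.ne']
    refine ⟨?_, u, rfl, hfol.smul (inv_pos.2 hρ0)⟩
    rw [← Set.mem_smul_set_iff_inv_smul_mem₀ hρ0.ne', smul_weightSet τ h hρ0]
    refine ⟨τ.switchSpace.add_mem hw.1 (τ.switchSpace.smul_mem _ hw₀), fun i => ?_, ?_⟩
    · have := hw.2.1 i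
      have := hpos i
      simp only [Pi.add_apply, Pi.smul_apply, smul_eq_mul]
      positivity
    · rw [dotProduct_add, dotProduct_smul, smul_eq_mul, hρ]
      refine add_le_add hw.2.2 ?_
      have : h ⬝ᵥ w₀ ≤ h j₀ * ∑ i, w₀ i := by
        rw [dotProduct, Finset.mul_sum]
        exact Finset.sum_le_sum fun i _ =>
          mul_le_mul_of_nonneg_right (hj₀ i (Finset.mem_univ i)) (hpos i).le
      calc s * (h ⬝ᵥ w₀) ≤ s * (h j₀ * ∑ i, w₀ i) := by gcongr
        _ = K / ε * ∑ i, w₀ i := by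
          have := (hh j₀).ne'
          rw [hs]; field_simp
  have h1 : τ.weightMeasure (τ.weightSet h) ≤
      ENNReal.ofReal (ρ ^ D) * τ.weightMeasure (stopSet {u} τ h) := by
    rw [← weightMeasure_smul τ hρ0,
      ← weightMeasure_image_add τ (τ.switchSpace.smul_mem s hw₀)]
    exact measure_mono hsub
  calc ENNReal.ofReal (ρ ^ D)⁻¹ * τ.weightMeasure (τ.weightSet h)
      ≤ ENNReal.ofReal (ρ ^ D)⁻¹ * (ENNReal.ofReal (ρ ^ D) *
          τ.weightMeasure (stopSet {u} τ h)) := by gcongr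
    _ = τ.weightMeasure (stopSet {u} τ h) := by
      rw [← mul_assoc, ← ENNReal.ofReal_mul (by positivity), inv_mul_cancel₀ (by positivity),
        ENNReal.ofReal_one, one_mul]

/-! ### Balanced heights -/

/-- At least `k` bands have heights that are within a factor `K` of the largest one. -/
def Balanced (k : ℕ) (K : ℝ) (h : Fin n → ℝ) : Prop :=
  ∃ L : Finset (Fin n), k ≤ L.card ∧ ∀ i ∈ L, ∀ j, h j ≤ K * h i

/-- If the height of a band is within a factor `K` of the largest one, then its area `h i * w i`
is at most `1 / M` with probability at most `1 / (2 * n)`, for a bound `M` that only depends on `τ` and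
`K`. -/
theorem exists_small_weight (hT : IsSplittingFamily T) {τ : IntervalExchange n} (hτ : τ ∈ T)
    {K : ℝ} (hK : 0 < K) : ∃ M : ℝ, 1 ≤ M ∧ ∀ h : Fin n → ℝ, (∀ i, 0 < h i) →
      ∀ i, (∀ j, h j ≤ K * h i) →
        (2 * n : ℕ) * τ.weightMeasure {w ∈ τ.weightSet h | M * (h i * w i) ≤ 1} ≤
          τ.weightMeasure (τ.weightSet h) := by
  obtain ⟨v, hv, hv0⟩ := hT.exists_pos τ hτ
  set D := Module.finrank ℝ τ.switchSpace with hD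
  set m : ℕ := 2 ^ D * (2 * n) with hm
  obtain ⟨i₀, -, hi₀⟩ := Finset.exists_min_image Finset.univ v Finset.univ_nonempty
  set C : ℝ := K * ((v i₀)⁻¹ * ∑ j, v j) with hC
  have hS : 0 < ∑ j, v j := Finset.sum_pos (fun i _ => hv0 i) Finset.univ_nonempty
  have hC0 : 0 < C := mul_pos hK (mul_pos (inv_pos.2 (hv0 i₀)) hS)
  refine ⟨1 + 2 * m * C, by linarith [show (0 : ℝ) ≤ 2 * m * C by positivity], fun h hh i hi => ?_⟩
  have key := small_weight_le τ (τ.switchSpace.smul_mem (v i)⁻¹ hv)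
    (fun j => mul_pos (inv_pos.2 (hv0 i)) (hv0 j)) (i := i) (inv_mul_cancel₀ (hv0 i).ne')
    (C := C) hh ?_ m (M := 1 + 2 * m * C) (by positivity) (by linarith)
  · rw [← hD, hm] at key
    push_cast at key
    rw [mul_assoc] at key
    rw [← ENNReal.mul_le_mul_iff_right (a := 2 ^ D) (by simp) (by simp)]
    rw [hm]
    push_cast
    exact key
  · rw [dotProduct_smul, smul_eq_mul, hC]
    have h1 : h ⬝ᵥ v ≤ K * h i * ∑ j, v j := by
      rw [dotProduct, Finset.mul_sum]
      exact Finset.sum_le_sum fun j _ => mul_le_mul_of_nonneg_right (hi j) (hv0 j).le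
    have h2 : (v i)⁻¹ ≤ (v i₀)⁻¹ := inv_anti₀ (hv0 i₀) (hi₀ i (Finset.mem_univ i))
    calc (v i)⁻¹ * (h ⬝ᵥ v) ≤ (v i₀)⁻¹ * (K * h i * ∑ j, v j) := by
          have h3 := hh i
          have h4 := inv_pos.2 (hv0 i₀)
          have h5 : 0 ≤ h ⬝ᵥ v := Finset.sum_nonneg fun j _ => (mul_pos (hh j) (hv0 j)).le
          gcongr
      _ = _ := by ring

theorem ends_notMem_iff (τ : IntervalExchange n) (L : Finset (Fin n)) (d : Bool) :
    (τ.topEnd ∉ L ∨ τ.botEnd ∉ L) ↔ (τ.winner d ∉ L ∨ τ.loser d ∉ L) := by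
  cases d
  · exact or_comm
  · exact Iff.rfl

/-- Suppose that the bands in `L` have the largest heights up to a factor `K`, and that one of the
rightmost bands is not in `L`. Unless some band in `L` is very narrow, an additional
band becomes high: as long as this does not happen, bands in `L` only lose, so that
their heights would grow without bound. -/
theorem exists_follows_balanced (hT : IsSplittingFamily T) {τ : IntervalExchange n} (hτ : τ ∈ T)
    {L : Finset (Fin n)} (hLne : L.Nonempty) {K M : ℝ} (hK : 1 ≤ K) (hM : 1 ≤ M)
    {h w : Fin n → ℝ} (hh : ∀ i, 0 < h i) (hL : ∀ i ∈ L, ∀ j, h j ≤ K * h i)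
    (hend : τ.topEnd ∉ L ∨ τ.botEnd ∉ L) (hgen : IsGeneric (τ, w)) (hw1 : h ⬝ᵥ w ≤ 1)
    (hbig : ∀ i ∈ L, 1 < M * (h i * w i)) :
    ∃ u, Follows u (τ, w) ∧ Balanced (L.card + 1) (K * (M + 1)) (descend (τ, h) u).2 := by
  by_contra hcon
  push Not at hcon
  obtain ⟨j₀, -, hj₀⟩ := Finset.exists_max_image Finset.univ h Finset.univ_nonempty
  set H := h j₀ with hH
  have hH0 : 0 < H := hh j₀
  set p : ℕ → IntervalExchange n × (Fin n → ℝ) := fun k => splitStep^[k] (τ, w) with hp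
  set η : ℕ → Fin n → ℝ := fun k => (descend (τ, h) (word (τ, w) k)).2 with hη
  have hgenk : ∀ k, IsGeneric (p k) ∧ (p k).1 ∈ T := fun k => hT.iterate hgen hτ k
  have hs : ∀ k, (p k).1.Splittable := fun k => hT.splittable _ (hgenk k).2
  set x : ℕ → Fin n := fun k => (p k).1.winner ((p k).1.dir (p k).2) with hx
  set y : ℕ → Fin n := fun k => (p k).1.loser ((p k).1.dir (p k).2) with hy
  have hxy : ∀ k, x k ≠ y k := fun k => (hs k).winner_ne_loser _
  have hstep : ∀ k, p (k + 1) = splitStep (p k) := fun k => Function.iterate_succ_apply' _ _ _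
  have hηstep : ∀ k, η (k + 1) = grow (x k) (y k) (η k) := fun k =>
    descend_word_succ (τ, w) h k
  have hη0 : ∀ k i, h i ≤ η k i := fun k => descend_pos (τ, h) _ hh
  have hdot : ∀ k, η k ⬝ᵥ (p k).2 = h ⬝ᵥ w := by
    intro k
    induction k with
    | zero => rfl
    | succ k ih =>
      rw [hηstep, hstep, ← ih]
      exact grow_dotProduct_cut (hxy k) _ _
  have hnb : ∀ k, ¬ Balanced (L.card + 1) (K * (M + 1)) (η k) := fun k =>
    hcon _ (hT.follows_word hgen hτ k)
  -- An additional high band gives balanced heights.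
  have hbal : ∀ k, ∀ z ∉ L, H ≤ K * η k z → (∀ j, η k j ≤ (M + 1) * H) → False := by
    intro k z hz hzH hj
    refine hnb k ⟨insert z L, by rw [Finset.card_insert_of_notMem hz], fun i hi j => ?_⟩
    have h1 : H ≤ K * η k i := by
      rcases Finset.mem_insert.1 hi with rfl | hi
      · exact hzH
      · exact (hL i hi j₀).trans (mul_le_mul_of_nonneg_left (hη0 k i) (by linarith))
    calc η k j ≤ (M + 1) * H := hj j
      _ ≤ (M + 1) * (K * η k i) := by gcongr
      _ = _ := by ring
  -- A band in `L` cannot win without making the other band high.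
  have hxL : ∀ k, ((p k).1.topEnd ∉ L ∨ (p k).1.botEnd ∉ L) →
      (∀ i ∉ L, K * η (k + 1) i < H) → x k ∉ L := by
    intro k h0 hlow hxk
    have hyk : y k ∉ L := ((ends_notMem_iff _ L ((p k).1.dir (p k).2)).1 h0).resolve_left
      fun h => h hxk
    have h1 := hlow _ hyk
    rw [hηstep, grow_apply, if_pos rfl] at h1
    have h2 := hL _ hxk j₀
    have h3 := hη0 k (x k)
    have h4 : 0 < η k (y k) := (hh _).trans_le (hη0 k _)
    nlinarith
  have hinv : ∀ k, ((p k).1.topEnd ∉ L ∨ (p k).1.botEnd ∉ L) ∧ (∀ i ∈ L, (p k).2 i = w i) ∧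
      ∀ i ∉ L, K * η k i < H := by
    intro k
    induction k with
    | zero =>
      refine ⟨hend, fun i _ => rfl, fun i hi => ?_⟩
      by_contra hcon
      refine hbal 0 i hi (not_lt.1 hcon) fun j => ?_
      have h1 : η 0 j ≤ H := hj₀ j (Finset.mem_univ j)
      nlinarith
    | succ k ih =>
      obtain ⟨ih1, ih2, ih3⟩ := ih
      have hleL : ∀ i ∈ L, η k i ≤ M * H := by
        intro i hi
        have h1 : η k i * (p k).2 i ≤ 1 :=
          (mul_le_dotProduct (fun j => ((hh j).trans_le (hη0 k j)).le)
            (fun j => ((hgenk k).1.2.1 j).le) i).trans ((hdot k).le.trans hw1)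
        rw [ih2 i hi] at h1
        have h2 := hbig i hi
        have h3 : 0 < w i := hgen.2.1 i
        have h4 : η k i < M * h i := by
          by_contra h5
          have := mul_le_mul_of_nonneg_right (not_lt.1 h5) h3.le
          linarith
        have h5 := hj₀ i (Finset.mem_univ i)
        have : M * h i ≤ M * H := by gcongr
        linarith
      have hle : ∀ i, η k i ≤ M * H := by
        intro i
        by_cases hi : i ∈ L
        · exact hleL i hi
        · have h1 := ih3 i hi
          have h2 : 0 < η k i := (hh i).trans_le (hη0 k i)
          nlinarith
      -- The loser does not become high.
      have hylow : ∀ i ∉ L, K * η (k + 1) i < H := by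
        intro i hi
        rw [hηstep, grow_apply]
        split_ifs with hiy
        · by_contra hcon
          refine hbal (k + 1) i hi ?_ fun j => ?_
          · rw [hηstep, grow_apply, if_pos hiy]; exact not_lt.1 hcon
          · rw [hηstep, grow_apply]
            split_ifs
            · have h1 := ih3 _ (hiy ▸ hi)
              have h2 : 0 < η k (y k) := (hh _).trans_le (hη0 k _)
              have h3 := hle (x k)
              nlinarith
            · have h3 := hle j
              nlinarith
        · exact ih3 i hi
      have hxL := hxL k ih1 hylow
      refine ⟨?_, fun i hi => ?_, hylow⟩
      · rw [hstep]
        rcases winner_eq_end (hs k) ((p k).1.dir (p k).2) with h | h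
        · exact Or.inl fun h' => hxL (by simp only [hx]; rw [h]; exact h')
        · exact Or.inr fun h' => hxL (by simp only [hx]; rw [h]; exact h')
      · rw [← ih2 i hi, hstep]
        change cut (x k) (y k) (p k).2 i = _
        rw [cut_apply, if_neg (fun h : i = x k => hxL (h ▸ hi))]
  -- The heights of the bands in `L` are bounded.
  obtain ⟨i, hi⟩ := hLne
  have hbdd : ∀ k, η k i * w i ≤ 1 := by
    intro k
    rw [← (hinv k).2.1 i hi]
    exact (mul_le_dotProduct (fun j => ((hh j).trans_le (hη0 k j)).le)
      (fun j => ((hgenk k).1.2.1 j).le) i).trans ((hdot k).le.trans hw1)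
  obtain ⟨i₁, -, hi₁⟩ := Finset.exists_min_image Finset.univ h Finset.univ_nonempty
  have hgrow : ∀ m : ℕ, ∃ k, m * h i₁ ≤ η k i := by
    intro m
    induction m with
    | zero => exact ⟨0, by rw [Nat.cast_zero, zero_mul]; exact ((hh i).trans_le (hη0 0 i)).le⟩
    | succ m ih =>
      obtain ⟨k, hk⟩ := ih
      obtain ⟨l, hl, hli⟩ := frequently_atTop.1 (hT.frequently_isEnd hgen hτ i) k
      have hmono : η k i ≤ η l i := by
        refine monotone_nat_of_le_succ (f := fun k => η k i) (fun k => ?_) hl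
        rw [hηstep]
        exact le_grow (fun j => (hh j).trans_le (hη0 k j)) i
      have hxl := hxL l (hinv l).1 (hinv (l + 1)).2.2
      have hyl : i = y l := by
        rcases (isEnd_iff _ i ((p l).1.dir (p l).2)).1 hli with h | h
        · exact absurd (show x l ∈ L by simp only [hx, hp]; rw [← h]; exact hi) hxl
        · exact h
      refine ⟨l + 1, ?_⟩
      rw [hηstep, grow_apply, if_pos hyl, ← hyl]
      have h1 := hi₁ (x l) (Finset.mem_univ _)
      have h2 := hη0 l (x l)
      push_cast
      linarith
  have hwi : 0 < w i := hgen.2.1 i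
  obtain ⟨m, hm⟩ := exists_nat_gt (1 / (h i₁ * w i))
  obtain ⟨k, hk⟩ := hgrow m
  rw [div_lt_iff₀ (mul_pos (hh i₁) hwi)] at hm
  have := mul_le_mul_of_nonneg_right hk hwi.le
  linarith [hbdd k]

end IntervalExchange

namespace IntervalExchange

variable {n : ℕ} [NeZero n] {T : Set (IntervalExchange n)}
  {N : IntervalExchange n → Set (Fin n → ℝ)}

/-! ### Prescribed words occur infinitely often -/

/-- The proportion of `N` is bounded away from `1` for heights of which at least `k` are
comparable to the largest one. -/
def Spread (T : Set (IntervalExchange n)) (N : IntervalExchange n → Set (Fin n → ℝ))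
    (k : ℕ) : Prop :=
  ∀ K : ℝ, 1 ≤ K → ∃ c : ℝ, 0 ≤ c ∧ c < 1 ∧ ∀ τ ∈ T, ∀ h : Fin n → ℝ, (∀ i, 0 < h i) →
    Balanced k K h → Bound N c τ h

/-- Suppose that the bands in `L` have the largest heights up to a factor `K`, and that one of the
rightmost bands is not in `L`. Then with probability at least one half an additional band becomes
high, since all bands in `L` are wide enough with this probability. -/
theorem IsSplittingFamily.half_le_measure_stopSet (hT : IsSplittingFamily T)
    {τ : IntervalExchange n} (hτ : τ ∈ T) {K : ℝ} (hK : 1 ≤ K) :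
    ∃ M : ℝ, 1 ≤ M ∧ ∀ (h : Fin n → ℝ) (L : Finset (Fin n)), (∀ i, 0 < h i) → L.Nonempty →
      (∀ i ∈ L, ∀ j, h j ≤ K * h i) → (τ.topEnd ∉ L ∨ τ.botEnd ∉ L) →
      ENNReal.ofReal (1 / 2) * τ.weightMeasure (τ.weightSet h) ≤ τ.weightMeasure
        (stopSet {u | Balanced (L.card + 1) (K * (M + 1)) (descend (τ, h) u).2} τ h) := by
  obtain ⟨M, hM, HM⟩ := exists_small_weight hT hτ (K := K) (by linarith)
  refine ⟨M, hM, fun h L hh hLne hL hend => ?_⟩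
  set W := {u | Balanced (L.card + 1) (K * (M + 1)) (descend (τ, h) u).2} with hW
  have hsub : τ.weightSet h ⊆ (stopSet W τ h ∪
      {w | w ∈ τ.switchSpace ∧ (∀ i, 0 < w i) ∧ ¬ IsGeneric (τ, w)}) ∪
      ⋃ i ∈ L, {w ∈ τ.weightSet h | M * (h i * w i) ≤ 1} := by
    intro w hw
    by_cases hg : IsGeneric (τ, w)
    · by_cases hb : ∀ i ∈ L, 1 < M * (h i * w i)
      · obtain ⟨u, hu, hbal⟩ :=
          exists_follows_balanced hT hτ hLne hK hM hh hL hend hg hw.2.2 hb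
        exact Or.inl (Or.inl ⟨hw, u, hbal, hu⟩)
      · push Not at hb
        obtain ⟨i, hi, hiw⟩ := hb
        exact Or.inr (Set.mem_biUnion hi ⟨hw, hiw⟩)
    · exact Or.inl (Or.inr ⟨hw.1, hw.2.1, hg⟩)
  have h1 : τ.weightMeasure (τ.weightSet h) ≤ τ.weightMeasure (stopSet W τ h) +
      ∑ i ∈ L, τ.weightMeasure {w ∈ τ.weightSet h | M * (h i * w i) ≤ 1} := by
    refine (measure_mono hsub).trans ((measure_union_le _ _).trans ?_)
    refine add_le_add ?_ (measure_biUnion_finset_le _ _)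
    refine (measure_union_le _ _).trans ?_
    rw [hT.measure_not_isGeneric hτ, add_zero]
  have hfin := τ.weightSet_lt_top hh
  set b := τ.weightMeasure (τ.weightSet h) with hb
  set s := τ.weightMeasure (stopSet W τ h) with hs
  have h2 : (2 * n : ℕ) * b ≤ (2 * n : ℕ) * s + n * b := by
    calc (2 * n : ℕ) * b ≤ (2 * n : ℕ) * (s +
          ∑ i ∈ L, τ.weightMeasure {w ∈ τ.weightSet h | M * (h i * w i) ≤ 1}) := by gcongr
      _ = (2 * n : ℕ) * s + ∑ i ∈ L, (2 * n : ℕ) *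
          τ.weightMeasure {w ∈ τ.weightSet h | M * (h i * w i) ≤ 1} := by
        rw [mul_add, Finset.mul_sum]
      _ ≤ (2 * n : ℕ) * s + ∑ i ∈ L, b := by
        gcongr with i hi
        exact HM h hh i (hL i hi)
      _ ≤ (2 * n : ℕ) * s + n * b := by
        rw [Finset.sum_const, nsmul_eq_mul]
        gcongr
        simpa using Finset.card_le_univ L
  have hn : (n : ENNReal) ≠ 0 := by exact_mod_cast NeZero.ne n
  have h3 : (n : ENNReal) * b ≤ n * (2 * s) := by
    have h4 : (n : ENNReal) * b + n * b ≤ n * (2 * s) + n * b := by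
      calc (n : ENNReal) * b + n * b = (2 * n : ℕ) * b := by push_cast; ring
        _ ≤ (2 * n : ℕ) * s + n * b := h2
        _ = n * (2 * s) + n * b := by push_cast; ring
    exact (ENNReal.add_le_add_iff_right (ENNReal.mul_ne_top (by simp) hfin.ne)).1 h4
  rw [ENNReal.mul_le_mul_iff_right hn (by simp)] at h3
  calc ENNReal.ofReal (1 / 2) * b ≤ ENNReal.ofReal (1 / 2) * (2 * s) := by gcongr
    _ = s := by
      rw [← mul_assoc, show (2 : ENNReal) = ENNReal.ofReal 2 by simp,
        ← ENNReal.ofReal_mul (by norm_num)]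
      norm_num

theorem IsStable.exists_bound_of_ends (hT : IsSplittingFamily T) (hN : IsStable N) {k : ℕ}
    (hk : 1 ≤ k) (hS : Spread T N (k + 1)) {K : ℝ} (hK : 1 ≤ K) :
    ∃ c : ℝ, 0 ≤ c ∧ c < 1 ∧ ∀ τ ∈ T, ∀ h : Fin n → ℝ, (∀ i, 0 < h i) →
      ∀ L : Finset (Fin n), L.card = k → (∀ i ∈ L, ∀ j, h j ≤ K * h i) →
      (τ.topEnd ∉ L ∨ τ.botEnd ∉ L) → Bound N c τ h := by
  refine exists_lt_one_forall (fun τ c c' hc H hτ h hh L h1 h2 h3 =>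
    (H hτ h hh L h1 h2 h3).mono hc) fun τ => ?_
  by_cases hτ : τ ∈ T
  · obtain ⟨M, hM, HM⟩ := hT.half_le_measure_stopSet hτ hK
    obtain ⟨c, hc0, hc1, hc⟩ := hS (K * (M + 1)) (by nlinarith)
    refine ⟨1 - 1 / 2 * (1 - c), by linarith, fun _ h hh L hLk hL hend => ?_⟩
    subst hLk
    refine hN.bound_of_stopSet hT hc0 hc1.le (by norm_num) hτ hh (fun u hu hu' => ?_)
      (HM h L hh (Finset.card_pos.1 hk) hL hend)
    exact hc _ hu' _ (fun i => (hh i).trans_le (descend_pos (τ, h) u hh i)) hu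
  · exact ⟨0, one_pos, fun h => absurd h hτ⟩

theorem IsSplittingFamily.exists_isGeneric (hT : IsSplittingFamily T) {τ : IntervalExchange n}
    (hτ : τ ∈ T) : ∃ w, IsGeneric (τ, w) := by
  by_contra hcon
  push Not at hcon
  obtain ⟨w, hw, hpos⟩ := hT.exists_pos τ hτ
  refine (τ.weightSet_pos (h := fun _ => 1) hw hpos).ne' (measure_mono_null (fun v hv => ?_)
    (hT.measure_not_isGeneric hτ))
  exact ⟨hv.1, hv.2.1, hcon v⟩

/-- Given a set `L` that does not contain all bands, it is possible to split until one of the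
rightmost bands is not in `L`. -/
theorem IsSplittingFamily.exists_followsIn (hT : IsSplittingFamily T) {τ : IntervalExchange n}
    (hτ : τ ∈ T) {L : Finset (Fin n)} {i : Fin n} (hi : i ∉ L) :
    ∃ w₀ ∈ τ.switchSpace, (∀ i, 0 < w₀ i) ∧ ∃ u, FollowsIn L u (τ, w₀) ∧ path τ u ∈ T ∧
      ((path τ u).topEnd ∉ L ∨ (path τ u).botEnd ∉ L) := by
  obtain ⟨w, hw⟩ := hT.exists_isGeneric hτ
  have hex : ∃ m, (splitStep^[m] (τ, w)).1.topEnd ∉ L ∨ (splitStep^[m] (τ, w)).1.botEnd ∉ L := by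
    obtain ⟨m, hm⟩ := (hT.frequently_isEnd hw hτ i).exists
    rcases hm with h | h
    · exact ⟨m, Or.inl fun h' => hi (h ▸ h')⟩
    · exact ⟨m, Or.inr fun h' => hi (h ▸ h')⟩
  classical
  have hpath := path_word (τ, w)
  simp only at hpath
  refine ⟨w, hw.1, hw.2.1, word (τ, w) (Nat.find hex), ?_, ?_, ?_⟩
  · have : ∀ m ≤ Nat.find hex, FollowsIn L (word (τ, w) m) (τ, w) := by
      intro m
      induction m with
      | zero => exact fun _ => trivial
      | succ m ih =>
        intro hm
        refine (ih (by omega)).append (hT.follows_word hw hτ (m + 1)) ?_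
        have h1 := Nat.find_min hex (m := m) (by omega)
        rw [ends_notMem_iff _ L ((splitStep^[m] (τ, w)).1.dir (splitStep^[m] (τ, w)).2)] at h1
        push Not at h1
        rw [hpath]
        exact h1.symm
    exact this _ le_rfl
  · rw [hpath]; exact (hT.iterate hw hτ _).2
  · rw [hpath]; exact Nat.find_spec hex

/-- The inductive step for heights: after a word that brings a band outside the `k` highest ones
to the right end, an additional band becomes high with probability at least one half. -/
theorem Spread.of_succ (hT : IsSplittingFamily T) (hN : IsStable N) {k : ℕ} (hk : 1 ≤ k)
    (hkn : k < n) (hS : Spread T N (k + 1)) : Spread T N k := by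
  intro K hK
  let P : IntervalExchange n × Finset (Fin n) → ℝ → Prop := fun q c =>
    q.1 ∈ T → q.2.card = k → ∀ h : Fin n → ℝ, (∀ i, 0 < h i) →
      (∀ i ∈ q.2, ∀ j, h j ≤ K * h i) → Bound N c q.1 h
  have hP : ∀ q, ∃ c < 1, P q c := by
    rintro ⟨τ, L⟩
    by_cases hτL : τ ∈ T ∧ L.card = k
    · obtain ⟨hτ, hL⟩ := hτL
      obtain ⟨i, hi⟩ : ∃ i, i ∉ L := by
        by_contra hcon
        push Not at hcon
        have := Finset.eq_univ_iff_forall.2 hcon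
        rw [this, Finset.card_univ, Fintype.card_fin] at hL
        omega
      obtain ⟨w₀, hw₀, hpos, u, hu, huT, hend⟩ := hT.exists_followsIn hτ hi
      obtain ⟨δ, hδ, H⟩ := exists_le_measure_stopSet hw₀ hpos hu (K := K) (by linarith)
      have h2 : (1 : ℝ) ≤ 2 ^ u.length := one_le_pow₀ (by norm_num)
      obtain ⟨c, hc0, hc1, hc⟩ := hN.exists_bound_of_ends hT hk hS (K := K * 2 ^ u.length)
        (by nlinarith)
      refine ⟨1 - δ * (1 - c), by nlinarith, fun _ _ h hh hbal => ?_⟩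
      refine hN.bound_of_stopSet hT hc0 hc1.le hδ.le hτ hh (W := {u}) ?_ (H h hh hbal)
      intro u' hu' huT'
      obtain rfl : u' = u := hu'
      have hle := descend_pos (τ, h) u' hh
      refine hc _ huT' _ (fun j => (hh j).trans_le (hle j)) L hL (fun j hj l => ?_) hend
      obtain ⟨j₀, -, hj₀⟩ := Finset.exists_max_image Finset.univ h Finset.univ_nonempty
      calc (descend (τ, h) u').2 l ≤ 2 ^ u'.length * h j₀ :=
            descend_le (τ, h) u' hh (fun i => hj₀ i (Finset.mem_univ i)) l
        _ ≤ 2 ^ u'.length * (K * (descend (τ, h) u').2 j) := by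
            gcongr
            exact (hbal j hj j₀).trans (mul_le_mul_of_nonneg_left (hle j) (by linarith))
        _ = _ := by ring
    · exact ⟨0, one_pos, fun h1 h2 => absurd ⟨h1, h2⟩ hτL⟩
  obtain ⟨c, hc0, hc1, hc⟩ := exists_lt_one_forall
    (fun q c c' hc H h1 h2 h h3 h4 => (H h1 h2 h h3 h4).mono hc) hP
  refine ⟨c, hc0, hc1, fun τ hτ h hh ⟨L, hL, hbal⟩ => ?_⟩
  obtain ⟨L', hL', hcard⟩ := Finset.exists_subset_card_eq hL
  exact hc (τ, L') hτ hcard h hh fun i hi => hbal i (hL' hi)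

/-- If all heights are comparable, then every realizable word has probability bounded below. -/
theorem spread_card (hhit : ∀ τ ∈ T, ∃ w₀ ∈ τ.switchSpace, (∀ i, 0 < w₀ i) ∧
      ∃ u, Follows u (τ, w₀) ∧ ∀ w ∈ N τ, ¬ Follows u (τ, w)) : Spread T N n := by
  intro K hK
  refine exists_lt_one_forall (fun τ c c' hc H hτ h h1 h2 => (H hτ h h1 h2).mono hc) fun τ => ?_
  by_cases hτ : τ ∈ T
  swap
  · exact ⟨0, one_pos, fun h => absurd h hτ⟩
  obtain ⟨w₀, hw₀, hpos, u, hu, hNu⟩ := hhit τ hτ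
  obtain ⟨δ, hδ, H⟩ := exists_le_measure_stopSet hw₀ hpos hu.followsIn_univ (K := K) (by linarith)
  refine ⟨1 - δ, by linarith, fun _ h hh ⟨L, hL, hbal⟩ => ?_⟩
  have hLu : L = Finset.univ := by
    rw [← Finset.card_eq_iff_eq_univ, Fintype.card_fin]
    exact le_antisymm (by simpa using Finset.card_le_univ L) hL
  have h1 := H h hh (hLu ▸ hbal)
  have hsub : stopSet {u} τ h ⊆ τ.weightSet h := fun w hw => hw.1
  have hfin := τ.weightSet_lt_top hh
  calc τ.weightMeasure (N τ ∩ τ.weightSet h)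
      ≤ τ.weightMeasure (τ.weightSet h \ stopSet {u} τ h) := by
        refine measure_mono fun w hw => ⟨hw.2, ?_⟩
        rintro ⟨-, _, rfl, hf⟩
        exact hNu w hw.1 hf
    _ = τ.weightMeasure (τ.weightSet h) - τ.weightMeasure (stopSet {u} τ h) :=
        measure_sdiff hsub (measurableSet_stopSet _ _ _).nullMeasurableSet
          ((measure_mono hsub).trans_lt hfin).ne
    _ ≤ τ.weightMeasure (τ.weightSet h) - ENNReal.ofReal δ * τ.weightMeasure (τ.weightSet h) :=
        tsub_le_tsub_left h1 _
    _ = ENNReal.ofReal (1 - δ) * τ.weightMeasure (τ.weightSet h) := by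
        rw [ENNReal.ofReal_sub _ hδ.le, ENNReal.ofReal_one,
          ENNReal.sub_mul (fun _ _ => hfin.ne), one_mul]

/-- The proportion of a stable family that misses a realizable word of every exchange is bounded
away from `1`, whatever the heights are. -/
theorem IsStable.exists_bound (hT : IsSplittingFamily T) (hN : IsStable N)
    (hhit : ∀ τ ∈ T, ∃ w₀ ∈ τ.switchSpace, (∀ i, 0 < w₀ i) ∧
      ∃ u, Follows u (τ, w₀) ∧ ∀ w ∈ N τ, ¬ Follows u (τ, w)) :
    ∃ c : ℝ, 0 ≤ c ∧ c < 1 ∧ ∀ τ ∈ T, ∀ h : Fin n → ℝ, (∀ i, 0 < h i) → Bound N c τ h := by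
  have hS : ∀ j < n, Spread T N (n - j) := by
    intro j
    induction j with
    | zero => exact fun _ => spread_card hhit
    | succ j ih =>
      intro hj
      refine Spread.of_succ hT hN (by omega) (by omega) ?_
      have := ih (by omega)
      rwa [show n - j = n - (j + 1) + 1 by omega] at this
  have hn := Nat.pos_of_ne_zero (NeZero.ne n)
  obtain ⟨c, hc0, hc1, hc⟩ := hS (n - 1) (by omega) 1 le_rfl
  refine ⟨c, hc0, hc1, fun τ hτ h hh => hc τ hτ h hh ?_⟩
  obtain ⟨j₀, -, hj₀⟩ := Finset.exists_max_image Finset.univ h Finset.univ_nonempty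
  refine ⟨{j₀}, by simp; omega, fun i hi j => ?_⟩
  rw [Finset.mem_singleton.1 hi, one_mul]
  exact hj₀ j (Finset.mem_univ j)

/-- The generic weights whose splitting sequence does not contain any word of `U`. -/
def avoidSet (U : IntervalExchange n → Set (List Bool)) (τ : IntervalExchange n) :
    Set (Fin n → ℝ) :=
  {w | IsGeneric (τ, w) ∧ (∀ k, (splitStep^[k] (τ, w)).1.Splittable) ∧
    ∀ k, ∀ v ∈ U (splitStep^[k] (τ, w)).1, ¬ Follows v (splitStep^[k] (τ, w))}

theorem isStable_avoidSet (U : IntervalExchange n → Set (List Bool)) :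
    IsStable (avoidSet U) where
  isGeneric _ _ hw := hw.1
  splitStep _ _ hw := ⟨hw.1.splitStep (hw.2.1 0), fun k => hw.2.1 (k + 1), fun k => hw.2.2 (k + 1)⟩

/-- The words of length `m` that do not contain a word of `U`. -/
def avoidWords (U : IntervalExchange n → Set (List Bool)) (τ : IntervalExchange n) (m : ℕ) :
    Set (List Bool) :=
  {u | u.length = m ∧ ∀ a v b, u = a ++ v ++ b → v ∉ U (path τ a)}

theorem avoidSet_inter_subset {U : IntervalExchange n → Set (List Bool)}
    {τ : IntervalExchange n} (h : Fin n → ℝ) (m : ℕ) :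
    avoidSet U τ ∩ τ.weightSet h ⊆ stopSet (avoidWords U τ m) τ h := by
  rintro w ⟨hw, hw'⟩
  have hf : Follows (word (τ, w) m) (τ, w) := Follows.word fun j _ => by
    intro heq
    have hg : ∀ k, IsGeneric (splitStep^[k] (τ, w)) := by
      intro k
      induction k with
      | zero => exact hw.1
      | succ k ih =>
        rw [Function.iterate_succ_apply']
        exact ih.splitStep (hw.2.1 k)
    exact (hg j).ne (hw.2.1 j) heq
  refine ⟨hw', word (τ, w) m, ⟨length_word _ _, fun a v b hab hv => ?_⟩, hf⟩
  rw [hab, List.append_assoc, follows_append, follows_append] at hf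
  have h1 := path_word (τ, w) a.length
  rw [← hf.1.eq_word] at h1
  exact hw.2.2 a.length v (h1 ▸ hv) hf.2.1

/-- Almost no weights avoid a family of words that can be reached from every exchange. -/
theorem IsSplittingFamily.measure_avoidSet (hT : IsSplittingFamily T)
    {U : IntervalExchange n → Set (List Bool)}
    (hU : ∀ τ ∈ T, ∃ w₀ ∈ τ.switchSpace, (∀ i, 0 < w₀ i) ∧
      ∃ u, ∃ v ∈ U (path τ u), Follows (u ++ v) (τ, w₀))
    {τ : IntervalExchange n} (hτ : τ ∈ T) : τ.weightMeasure (avoidSet U τ) = 0 := by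
  have hN := isStable_avoidSet U
  obtain ⟨c, hc0, hc1, hc⟩ := hN.exists_bound hT fun τ hτ => by
    obtain ⟨w₀, hw₀, hpos, u, v, hv, huv⟩ := hU τ hτ
    refine ⟨w₀, hw₀, hpos, u ++ v, huv, fun w hw hf => ?_⟩
    rw [follows_append] at hf
    have h1 := path_word (τ, w) u.length
    rw [← hf.1.eq_word] at h1
    exact hw.2.2 u.length v (h1 ▸ hv) hf.2
  have key : ∀ h : Fin n → ℝ, (∀ i, 0 < h i) →
      τ.weightMeasure (avoidSet U τ ∩ τ.weightSet h) = 0 := by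
    intro h hh
    set S : ℕ → Set (Fin n → ℝ) := fun m => stopSet (avoidWords U τ m) τ h with hS
    have hfin := τ.weightSet_lt_top hh
    have hanti : Antitone S := by
      rintro a b hab w ⟨hw, u, ⟨hu, hu'⟩, hf⟩
      refine ⟨hw, u.take a, ⟨by simp; omega, fun x v y hxy => ?_⟩, ?_⟩
      · exact hu' x v (y ++ u.drop a) (by
          rw [← List.append_assoc, ← hxy, List.take_append_drop])
      · rw [← List.take_append_drop a u, follows_append] at hf
        exact hf.1
    have hle : ∀ m, τ.weightMeasure (avoidSet U τ ∩ τ.weightSet h) ≤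
        ENNReal.ofReal c * τ.weightMeasure (S m) := by
      intro m
      refine (measure_mono (t := avoidSet U τ ∩ S m) fun w hw =>
        ⟨hw.1, avoidSet_inter_subset h m hw⟩).trans ?_
      exact hN.measure_stopSet_le hT hτ fun u _ huT =>
        hc _ huT _ fun i => (hh i).trans_le (descend_pos (τ, h) u hh i)
    have hlim := tendsto_measure_iInter_atTop (μ := τ.weightMeasure)
      (fun m => (measurableSet_stopSet (avoidWords U τ m) τ h).nullMeasurableSet) hanti
      ⟨0, ((measure_mono fun w hw => hw.1).trans_lt hfin).ne⟩
    have h1 := ge_of_tendsto' (ENNReal.Tendsto.const_mul (a := ENNReal.ofReal c) hlim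
      (Or.inr ENNReal.ofReal_ne_top)) hle
    have hsub : ⋂ m, S m ⊆ (avoidSet U τ ∩ τ.weightSet h) ∪
        {w | w ∈ τ.switchSpace ∧ (∀ i, 0 < w i) ∧ ¬ IsGeneric (τ, w)} := by
      intro w hw
      rw [Set.mem_iInter] at hw
      have hw0 := (hw 0).1
      by_cases hg : IsGeneric (τ, w)
      · refine Or.inl ⟨⟨hg, fun k => hT.splittable _ (hT.iterate hg hτ k).2,
          fun k v hv hf => ?_⟩, hw0⟩
        obtain ⟨-, u, ⟨hu, hu'⟩, huf⟩ := hw (k + v.length)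
        have h2 := huf.eq_word
        rw [hu, word_add, ← hf.eq_word] at h2
        refine hu' (word (τ, w) k) v [] (by rw [h2, List.append_nil]) ?_
        have h3 := path_word (τ, w) k
        simp only at h3
        rwa [h3]
      · exact Or.inr ⟨hw0.1, hw0.2.1, hg⟩
    have h2 : τ.weightMeasure (avoidSet U τ ∩ τ.weightSet h) ≤
        ENNReal.ofReal c * τ.weightMeasure (avoidSet U τ ∩ τ.weightSet h) := by
      refine h1.trans (mul_le_mul_right ?_ _)
      refine (measure_mono (μ := τ.weightMeasure) hsub).trans ((measure_union_le _ _).trans ?_)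
      rw [hT.measure_not_isGeneric hτ, add_zero]
    by_contra h0
    have hlt : ENNReal.ofReal c < 1 := ENNReal.ofReal_lt_one.2 hc1
    have h3 : τ.weightMeasure (avoidSet U τ ∩ τ.weightSet h) ≠ ⊤ :=
      ((measure_mono Set.inter_subset_right).trans_lt hfin).ne
    refine absurd h2 (not_le.2 ?_)
    conv_rhs => rw [← one_mul (τ.weightMeasure _)]
    exact ENNReal.mul_lt_mul_left h0 h3 hlt
  have hcov : avoidSet U τ ⊆ ⋃ r : ℕ, avoidSet U τ ∩ τ.weightSet fun _ => 1 / ((r : ℝ) + 1) := by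
    intro w hw
    obtain ⟨r, hr⟩ := exists_nat_gt (∑ i, w i)
    refine Set.mem_iUnion.2 ⟨r, hw, hw.1.1, hw.1.2.1, ?_⟩
    have : (0 : ℝ) < r + 1 := by positivity
    simp only [dotProduct, ← Finset.mul_sum]
    rw [one_div, inv_mul_le_iff₀ this]
    linarith
  exact measure_mono_null hcov (measure_iUnion_null fun r => key _ fun i => by positivity)

/-- If from every exchange of the family it is possible to split along one of the words in `U`,
then almost all splitting sequences contain words in `U` infinitely often. -/
theorem IsSplittingFamily.measure_not_frequently (hT : IsSplittingFamily T)
    {U : IntervalExchange n → Set (List Bool)}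
    (hU : ∀ τ ∈ T, ∃ w₀ ∈ τ.switchSpace, (∀ i, 0 < w₀ i) ∧
      ∃ u, ∃ v ∈ U (path τ u), Follows (u ++ v) (τ, w₀))
    {τ : IntervalExchange n} (hτ : τ ∈ T) :
    τ.weightMeasure {w | w ∈ τ.switchSpace ∧ (∀ i, 0 < w i) ∧ ¬ (IsGeneric (τ, w) ∧
      ∃ᶠ k in atTop, ∃ v ∈ U (splitStep^[k] (τ, w)).1, Follows v (splitStep^[k] (τ, w)))} = 0 := by
  refine measure_mono_null ?_ (measure_union_null (hT.measure_not_isGeneric hτ)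
    (measure_iUnion_null fun k =>
      hT.measure_iterate_mem (fun σ hσ => hT.measure_avoidSet hU hσ) k τ hτ))
  rintro w ⟨h1, h2, h3⟩
  by_cases hg : IsGeneric (τ, w)
  · right
    have h4 : ∃ m, ∀ k ≥ m, ∀ v ∈ U (splitStep^[k] (τ, w)).1,
        ¬ Follows v (splitStep^[k] (τ, w)) := by
      by_contra hcon
      refine h3 ⟨hg, frequently_atTop.2 fun m => ?_⟩
      push Not at hcon
      exact hcon m
    obtain ⟨m, hm⟩ := h4
    refine Set.mem_iUnion.2 ⟨m, h1, h2, fun j _ => ?_, ?_⟩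
    · exact (hT.iterate hg hτ j).1.ne (hT.splittable _ (hT.iterate hg hτ j).2)
    · have key : ∀ k, splitStep^[k] (splitStep^[m] (τ, w)) = splitStep^[m + k] (τ, w) := fun k => by
        rw [← Function.iterate_add_apply, add_comm]
      refine ⟨(hT.iterate hg hτ m).1, fun k => ?_, fun k v hv => ?_⟩
      · change (splitStep^[k] (splitStep^[m] (τ, w))).1.Splittable
        rw [key]
        exact hT.splittable _ (hT.iterate hg hτ _).2
      · change ¬ Follows v (splitStep^[k] (splitStep^[m] (τ, w)))
        change v ∈ U (splitStep^[k] (splitStep^[m] (τ, w))).1 at hv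
        rw [key] at hv ⊢
        exact hm _ (by omega) v hv
  · exact Or.inl ⟨h1, h2, hg⟩

end IntervalExchange

namespace IntervalExchange

variable {n : ℕ} (τ : IntervalExchange n)

/-! ### Complementary regions -/

theorem length_boundary : τ.boundary.length = 2 * n := by
  rw [boundary, List.length_append, List.length_reverse, length_top_add_length_bottom]

instance : Finite τ.Region := inferInstanceAs (Finite (Quot τ.GapStep))

variable {τ}

theorem IsRecurrent.ne_nil (h : τ.IsRecurrent) (hn : 0 < n) : τ.top ≠ [] ∧ τ.bottom ≠ [] := by
  obtain ⟨w, hw, hpos⟩ := h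
  have hs : (τ.top.map w).sum = (τ.bottom.map w).sum := hw.1
  have key : ∀ l : List (Fin n), (l.map w).sum = 0 → l = [] := by
    intro l hl
    by_contra hne
    have : 0 < (l.map w).sum := List.sum_pos _ (by simp [hpos]) (by simpa using hne)
    exact this.ne' hl
  have hlen := τ.length_top_add_length_bottom
  constructor <;> intro h0
  · rw [h0, List.map_nil, List.sum_nil] at hs
    rw [h0, key _ hs.symm] at hlen
    simp at hlen
    omega
  · rw [h0, List.map_nil, List.sum_nil] at hs
    rw [h0, key _ hs] at hlen
    simp at hlen
    omega

theorem ncard_isCusp (ht : τ.top ≠ []) (hb : τ.bottom ≠ []) :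
    {p | τ.IsCusp p}.ncard + 2 = 2 * n := by
  have h1 : 0 < τ.top.length := List.length_pos_iff.2 ht
  have h2 : 0 < τ.bottom.length := List.length_pos_iff.2 hb
  have h3 := τ.length_top_add_length_bottom
  have h4 := τ.length_boundary
  let a : Fin τ.boundary.length := ⟨τ.top.length - 1, by omega⟩
  let b : Fin τ.boundary.length := ⟨τ.boundary.length - 1, by omega⟩
  have hab : a ≠ b := fun h => by
    have := congrArg Fin.val h
    simp only [a, b] at this
    omega
  have h5 : {p | τ.IsCusp p} = ({a, b} : Set (Fin τ.boundary.length))ᶜ := by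
    ext p
    simp only [IsCusp, Set.mem_ofPred_eq, Set.mem_compl_iff, Set.mem_insert_iff,
      Set.mem_singleton_iff, Fin.ext_iff, a, b]
    omega
  have h6 := Set.ncard_add_ncard_compl ({a, b} : Set (Fin τ.boundary.length))
  rw [Set.ncard_pair hab, Nat.card_fin, ← h5] at h6
  omega

theorem ncard_isCusp_eq (h : ∀ R : τ.Region, τ.IsIdealTriangle R) :
    {p | τ.IsCusp p}.ncard = 3 * Nat.card τ.Region := by
  have := Fintype.ofFinite τ.Region
  let e : {p // τ.IsCusp p} ≃
      Σ R : τ.Region, {p // (Quot.mk τ.GapStep p : τ.Region) = R ∧ τ.IsCusp p} :=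
    { toFun := fun p => ⟨Quot.mk _ p.1, p.1, rfl, p.2⟩
      invFun := fun x => ⟨x.2.1, x.2.2.2⟩
      left_inv := fun p => rfl
      right_inv := by rintro ⟨_, p, rfl, hp⟩; rfl }
  have h1 : Nat.card {p // τ.IsCusp p} = 3 * Nat.card τ.Region := by
    rw [Nat.card_congr e, Nat.card_sigma]
    refine (Finset.sum_congr rfl fun R _ => (h R : _ = 3)).trans ?_
    simp [mul_comm]
  exact h1

/-- Counting cusps determines the number of bands. -/
theorem IsCompleteGenusTwo.eq_seven (h : τ.IsCompleteGenusTwo) : n = 7 := by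
  obtain ⟨h1, h2, h3⟩ := h
  rcases Nat.eq_zero_or_pos n with rfl | hn
  · have := ncard_isCusp_eq h2
    have h4 : Nat.card τ.Region = 0 := by
      have h5 : {p | τ.IsCusp p}.ncard = 0 := by
        have : IsEmpty (Fin τ.boundary.length) := by
          rw [length_boundary]
          exact Fin.isEmpty
        simp [Set.eq_empty_of_isEmpty]
      omega
    omega
  · obtain ⟨ht, hb⟩ := h1.ne_nil hn
    have h4 := ncard_isCusp ht hb
    have h5 := ncard_isCusp_eq h2
    omega

theorem isCompleteGenusTwo_iff (τ : IntervalExchange 7) :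
    τ.IsCompleteGenusTwo ↔ τ.IsRecurrent ∧ ∀ R : τ.Region, τ.IsIdealTriangle R := by
  refine ⟨fun h => ⟨h.1, h.2.1⟩, fun ⟨h1, h2⟩ => ⟨h1, h2, ?_⟩⟩
  obtain ⟨ht, hb⟩ := h1.ne_nil (by norm_num)
  have h4 := ncard_isCusp ht hb
  have h5 := ncard_isCusp_eq h2
  omega

variable (τ)

/-- Every band has exactly two ends. -/
theorem existsUnique_partner (p : Fin τ.boundary.length) :
    ∃! q, q ≠ p ∧ τ.boundary.get q = τ.boundary.get p := by
  classical
  have h1 : ∀ a, τ.boundary.count a = 2 := fun a => by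
    have := τ.count_eq_two a
    rw [List.count_append] at this
    simp only [boundary, List.count_append, List.count_reverse]
    exact this
  have h2 : (Finset.univ.filter fun q => τ.boundary.get q = τ.boundary.get p).card = 2 := by
    rw [← h1 (τ.boundary.get p)]
    generalize τ.boundary.get p = a
    conv_rhs => rw [← List.map_get_finRange τ.boundary]
    rw [List.count, List.countP_map, List.countP_eq_length_filter,
      ← List.toFinset_card_of_nodup (List.Nodup.filter _ (List.nodup_finRange _))]
    congr 1
    ext q
    simp
  obtain ⟨q, r, hqr, h3⟩ := Finset.card_eq_two.1 h2
  have hmem : ∀ s, τ.boundary.get s = τ.boundary.get p ↔ s = q ∨ s = r := by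
    intro s
    have := Finset.ext_iff.1 h3 s
    simpa using this
  rcases (hmem p).1 rfl with rfl | rfl
  · exact ⟨r, ⟨hqr.symm, (hmem r).2 (Or.inr rfl)⟩, fun s hs =>
      ((hmem s).1 hs.2).resolve_left hs.1⟩
  · exact ⟨q, ⟨hqr, (hmem q).2 (Or.inl rfl)⟩, fun s hs =>
      ((hmem s).1 hs.2).resolve_right hs.1⟩

/-- The position of the other end of the same band. -/
noncomputable def partner (p : Fin τ.boundary.length) : Fin τ.boundary.length :=
  (τ.existsUnique_partner p).choose

theorem partner_spec (p : Fin τ.boundary.length) :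
    τ.partner p ≠ p ∧ τ.boundary.get (τ.partner p) = τ.boundary.get p :=
  (τ.existsUnique_partner p).choose_spec.1

variable {τ}

theorem eq_partner {p q : Fin τ.boundary.length} (h : q ≠ p)
    (h' : τ.boundary.get q = τ.boundary.get p) : q = τ.partner p :=
  (τ.existsUnique_partner p).choose_spec.2 q ⟨h, h'⟩

variable (τ)

theorem partner_partner (p : Fin τ.boundary.length) : τ.partner (τ.partner p) = p :=
  (eq_partner (τ.partner_spec p).1.symm (τ.partner_spec p).2.symm).symm

theorem next_injective : Function.Injective τ.next := by
  intro p q h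
  have h1 := congrArg Fin.val h
  simp only [next] at h1
  have hp := p.2
  have hq := q.2
  have key : ∀ p < τ.boundary.length, (p + 1) % τ.boundary.length =
      if p + 1 = τ.boundary.length then 0 else p + 1 := by
    intro p hp
    split_ifs with h
    · rw [h, Nat.mod_self]
    · exact Nat.mod_eq_of_lt (by omega)
  rw [key _ hp, key _ hq] at h1
  ext
  split_ifs at h1 <;> omega

/-- The gap that follows a given gap on the boundary of a complementary region. -/
noncomputable def nextGap (p : Fin τ.boundary.length) : Fin τ.boundary.length :=
  τ.partner (τ.next p)

theorem nextGap_injective : Function.Injective τ.nextGap := fun p q h =>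
  τ.next_injective (by
    rw [← τ.partner_partner (τ.next p), ← τ.partner_partner (τ.next q)]
    exact congrArg _ h)

theorem gapStep_iff (p q : Fin τ.boundary.length) : τ.GapStep p q ↔ q = τ.nextGap p :=
  ⟨fun h => eq_partner h.1 h.2, fun h => h ▸ τ.partner_spec _⟩

theorem mem_periodicPts_nextGap (p : Fin τ.boundary.length) :
    p ∈ Function.periodicPts τ.nextGap :=
  τ.nextGap_injective.mem_periodicPts p

theorem mk_iterate (p : Fin τ.boundary.length) (i : ℕ) :
    (Quot.mk τ.GapStep (τ.nextGap^[i] p) : τ.Region) = Quot.mk τ.GapStep p := by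
  induction i with
  | zero => rfl
  | succ i ih =>
    rw [Function.iterate_succ_apply', ← ih]
    exact (Quot.sound ((τ.gapStep_iff _ _).2 rfl)).symm

/-- The gaps on the boundary of a complementary region form an orbit. -/
theorem mk_eq_iff {p q : Fin τ.boundary.length} :
    (Quot.mk τ.GapStep q : τ.Region) = Quot.mk τ.GapStep p ↔
      ∃ i < Function.minimalPeriod τ.nextGap p, τ.nextGap^[i] p = q := by
  constructor
  · intro h
    have hk : ∀ p, 0 < Function.minimalPeriod τ.nextGap p := fun p =>
      Function.minimalPeriod_pos_of_mem_periodicPts (τ.mem_periodicPts_nextGap p)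
    let orbit : Fin τ.boundary.length → Set (Fin τ.boundary.length) :=
      fun p => {q | ∃ i, τ.nextGap^[i] p = q}
    have hstep : ∀ p q, τ.GapStep p q → orbit p = orbit q := by
      intro p q hpq
      rw [gapStep_iff] at hpq
      subst hpq
      ext r
      constructor
      · rintro ⟨i, rfl⟩
        refine ⟨i + (Function.minimalPeriod τ.nextGap p - 1), ?_⟩
        rw [← Function.iterate_succ_apply, Nat.succ_eq_add_one, add_assoc,
          Nat.sub_add_cancel (hk p), Function.iterate_add_apply,
          Function.iterate_minimalPeriod]
      · rintro ⟨i, rfl⟩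
        exact ⟨i + 1, Function.iterate_succ_apply _ _ _⟩
    have h1 : orbit q = orbit p := congrArg (Quot.lift orbit hstep) h
    obtain ⟨i, rfl⟩ : q ∈ orbit p := h1 ▸ ⟨0, rfl⟩
    exact ⟨i % _, Nat.mod_lt _ (hk p), Function.iterate_mod_minimalPeriod_eq⟩
  · rintro ⟨i, -, rfl⟩
    exact τ.mk_iterate p i

instance : DecidablePred τ.IsCusp := fun _ => inferInstanceAs (Decidable (_ ∧ _))

/-- All regions are triangles if and only if each closed walk along the boundary of a region
passes exactly three cusps. -/
theorem forall_isIdealTriangle_iff :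
    (∀ R : τ.Region, τ.IsIdealTriangle R) ↔
      ∀ p, ((Finset.range (Function.minimalPeriod τ.nextGap p)).filter
        fun i => τ.IsCusp (τ.nextGap^[i] p)).card = 3 := by
  have key : ∀ p, {q | (Quot.mk τ.GapStep q : τ.Region) = Quot.mk τ.GapStep p ∧
      τ.IsCusp q}.ncard = ((Finset.range (Function.minimalPeriod τ.nextGap p)).filter
        fun i => τ.IsCusp (τ.nextGap^[i] p)).card := by
    intro p
    rw [← Set.ncard_coe_finset]
    symm
    refine Set.ncard_congr (fun i _ => τ.nextGap^[i] p) ?_ ?_ ?_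
    · intro i hi
      rw [Finset.coe_filter] at hi
      exact ⟨τ.mk_iterate p i, hi.2⟩
    · intro i j hi hj hij
      simp only [Finset.coe_filter, Finset.mem_range, Set.mem_ofPred_eq] at hi hj
      exact Function.iterate_injOn_Iio_minimalPeriod hi.1 hj.1 hij
    · rintro q ⟨hq, hc⟩
      obtain ⟨i, hi, rfl⟩ := τ.mk_eq_iff.1 hq
      exact ⟨i, by simpa using ⟨hi, hc⟩, rfl⟩
  constructor
  · exact fun h p => (key p).symm.trans (h (Quot.mk _ p))
  · rintro h ⟨p⟩
    exact (key p).trans (h p)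

end IntervalExchange

/-! ### Codes of exchanges with seven bands -/

namespace ExchangeCode

/-- The hexadecimal digit of `x` of weight `16 ^ i`. -/
def digit (x i : ℕ) : ℕ := Nat.mod (Nat.div x (Nat.pow 16 i)) 16

/-- The number with the given hexadecimal digits, the lowest one first. -/
def encode (l : List ℕ) : ℕ := l.foldr (fun d x => d + 16 * x) 0

theorem digit_eq (x i : ℕ) : digit x i = x / 16 ^ i % 16 := rfl

theorem digit_lt (x i : ℕ) : digit x i < 16 := Nat.mod_lt _ (by norm_num)

theorem digit_zero (i : ℕ) : digit 0 i = 0 := by simp [digit_eq]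

theorem digit_encode {l : List ℕ} (hl : ∀ d ∈ l, d < 16) (i : ℕ) :
    digit (encode l) i = l.getD i 0 := by
  induction l generalizing i with
  | nil => simp [encode, digit_zero]
  | cons d l ih =>
    have hd : d < 16 := hl d (by simp)
    have e : encode (d :: l) = d + 16 * encode l := rfl
    cases i with
    | zero =>
      rw [e, digit_eq]
      simp only [pow_zero, Nat.div_one, List.getD_cons_zero]
      omega
    | succ i =>
      rw [List.getD_cons_succ, ← ih (fun d hd => hl d (by simp [hd])), e, digit_eq, digit_eq,
        pow_succ', ← Nat.div_div_eq_div_mul]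
      congr 2
      omega

theorem digit_add_mul_pow {x i d : ℕ} (hx : digit x i = 0) (hd : d < 16) (j : ℕ) :
    digit (x + d * 16 ^ i) j = if j = i then d else digit x j := by
  simp only [digit_eq] at hx ⊢
  rcases lt_trichotomy j i with h | rfl | h
  · obtain ⟨k, rfl⟩ := Nat.exists_eq_add_of_lt h
    rw [if_neg h.ne, show d * 16 ^ (j + k + 1) = 16 ^ j * (16 * (d * 16 ^ k)) by ring,
      Nat.add_mul_div_left _ _ (by positivity), Nat.add_mul_mod_self_left]
  · rw [if_pos rfl, Nat.add_mul_div_right _ _ (by positivity)]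
    omega
  · obtain ⟨k, rfl⟩ := Nat.exists_eq_add_of_lt h
    rw [if_neg h.ne', show i + k + 1 = i + (1 + k) by ring, pow_add, pow_add,
      ← Nat.div_div_eq_div_mul, ← Nat.div_div_eq_div_mul, ← Nat.div_div_eq_div_mul,
      ← Nat.div_div_eq_div_mul, Nat.add_mul_div_right _ _ (by positivity)]
    congr 2
    omega

section Lists

variable {α β : Type*} [DecidableEq α] [DecidableEq β]

/-- The other position of the label `a` found at the position `q` of `l`. -/
def otherIdx (l : List α) (q : ℕ) (a : α) : ℕ :=
  bif Nat.beq (l.idxOf a) q then q + 1 + (l.drop (q + 1)).idxOf a else l.idxOf a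

/-- The code of an exchange with seven bands: the hexadecimal digits of weights
`16 ^ 0, …, 16 ^ 13` are the positions of the other ends of the bands met along the boundary of
the base interval, increased by one, and the digit of weight `16 ^ 14` is the number of top ends. -/
def code (p : List α × List α) : ℕ :=
  encode (((p.1 ++ p.2.reverse).mapIdx fun q a => otherIdx (p.1 ++ p.2.reverse) q a + 1) ++
    [p.1.length])

theorem idxOf_map {f : α → β} (hf : Function.Injective f) (l : List α) (a : α) :
    (l.map f).idxOf (f a) = l.idxOf a := by
  induction l with
  | nil => rfl
  | cons b l ih =>
    have h : (f b == f a) = (b == a) := by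
      rw [Bool.eq_iff_iff, beq_iff_eq, beq_iff_eq, hf.eq_iff]
    rw [List.map_cons, List.idxOf_cons, List.idxOf_cons, ih, h]

theorem otherIdx_map {f : α → β} (hf : Function.Injective f) (l : List α) (q : ℕ) (a : α) :
    otherIdx (l.map f) q (f a) = otherIdx l q a := by
  simp only [otherIdx, idxOf_map hf, ← List.map_drop]

theorem code_map {f : α → β} (hf : Function.Injective f) (p : List α × List α) :
    code (p.map (List.map f) (List.map f)) = code p := by
  obtain ⟨A, B⟩ := p
  have h1 : A.map f ++ (B.map f).reverse = (A ++ B.reverse).map f := by simp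
  simp only [code, Prod.map_apply, h1, List.length_map]
  congr 2
  refine List.ext_getElem (by simp) fun i h2 h3 => ?_
  simp [otherIdx_map hf, -List.map_append]

theorem idxOf_getElem_le {l : List α} {r : ℕ} (hr : r < l.length) : l.idxOf l[r] ≤ r := by
  by_contra hcon
  have := List.not_of_lt_findIdx (not_le.1 hcon)
  simp at this

theorem otherIdx_spec {l : List α} {q r : ℕ} (hq : q < l.length) (hr : r < l.length)
    (hqr : r ≠ q) (h : l[r] = l[q]) :
    ∃ hs : otherIdx l q l[q] < l.length, otherIdx l q l[q] ≠ q ∧ l[otherIdx l q l[q]] = l[q] := by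
  have hle : l.idxOf l[q] ≤ r := h ▸ idxOf_getElem_le hr
  have hlt := List.idxOf_lt_length_of_mem (List.getElem_mem hq)
  by_cases hs : l.idxOf l[q] = q
  · have h1 : otherIdx l q l[q] = q + 1 + (l.drop (q + 1)).idxOf l[q] := by
      simp [otherIdx, hs]
    have h2 : l[q] ∈ l.drop (q + 1) := by
      rw [List.mem_drop_iff_getElem]
      refine ⟨r - (q + 1), by omega, ?_⟩
      rw [← h]
      congr 1
      omega
    have h3 := List.idxOf_lt_length_of_mem h2
    have h4 := List.getElem_idxOf h3
    rw [List.length_drop] at h3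
    rw [List.getElem_drop] at h4
    refine ⟨by omega, by omega, ?_⟩
    simp only [h1]
    exact h4
  · have h1 : otherIdx l q l[q] = l.idxOf l[q] := by
      rw [otherIdx, cond_eq_ite, if_neg (by simpa using hs)]
    refine ⟨by omega, by omega, ?_⟩
    simp only [h1]
    exact List.getElem_idxOf hlt

end Lists

end ExchangeCode

namespace IntervalExchange

open ExchangeCode

/-- The digits of `x` encode the pairs of ends of the bands of `τ`. -/
def IsCode (τ : IntervalExchange 7) (x : ℕ) : Prop :=
  ∀ q : Fin τ.boundary.length, digit x q = τ.partner q + 1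

variable (τ : IntervalExchange 7)

theorem length_boundary_seven : τ.boundary.length = 14 := τ.length_boundary

theorem otherIdx_boundary (q : Fin τ.boundary.length) :
    otherIdx τ.boundary q (τ.boundary.get q) = τ.partner q := by
  obtain ⟨h1, h2⟩ := τ.partner_spec q
  obtain ⟨h3, h4, h5⟩ := otherIdx_spec q.2 (τ.partner q).2 (fun h => h1 (Fin.ext h)) h2
  have := eq_partner (q := ⟨_, h3⟩) (fun h => h4 (congrArg Fin.val h)) h5
  exact congrArg Fin.val this

theorem digits_code_lt : ∀ d ∈ (τ.boundary.mapIdx fun q a => otherIdx τ.boundary q a + 1) ++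
    [τ.top.length], d < 16 := by
  intro d hd
  rw [List.mem_append] at hd
  rcases hd with hd | hd
  · obtain ⟨q, hq, rfl⟩ := List.mem_iff_getElem.1 hd
    rw [List.length_mapIdx] at hq
    rw [List.getElem_mapIdx]
    have := τ.otherIdx_boundary ⟨q, hq⟩
    have h2 := (τ.partner ⟨q, hq⟩).2
    have h3 := τ.length_boundary_seven
    simp only [List.get_eq_getElem] at this
    omega
  · rw [List.mem_singleton.1 hd]
    have := τ.length_top_add_length_bottom
    omega

theorem isCode_code : τ.IsCode (code τ.lists) := by
  intro q
  have h := digit_encode τ.digits_code_lt q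
  rw [List.getD_append _ _ _ _ (by simp), List.getD_eq_getElem _ _ (by simp),
    List.getElem_mapIdx] at h
  exact h.trans (congrArg (· + 1) (τ.otherIdx_boundary q))

theorem digit_code_top : digit (code τ.lists) 14 = τ.top.length := by
  have h := digit_encode τ.digits_code_lt 14
  rw [List.getD_append_right _ _ _ _ (by simp [length_boundary_seven])] at h
  rw [List.length_mapIdx, length_boundary_seven] at h
  exact h

/-- The code of `τ` only depends on the positions of the pairs of ends and the number of top
ends. -/
theorem code_eq_encode {x : ℕ} (hx : τ.IsCode x) :
    code τ.lists = encode ((List.range 14).map (digit x) ++ [τ.top.length]) := by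
  refine congrArg (fun l => encode (l ++ [τ.top.length])) ?_
  refine List.ext_getElem (by
    simpa [lists, boundary] using τ.length_boundary_seven) fun q h1 h2 => ?_
  rw [List.length_mapIdx] at h1
  rw [List.getElem_mapIdx, List.getElem_map, List.getElem_range]
  exact (congrArg (· + 1) (τ.otherIdx_boundary ⟨q, h1⟩)).trans (hx ⟨q, h1⟩).symm

end IntervalExchange

namespace ExchangeCode

/-- The exchange with a given code, with the bands labeled by the positions of their first ends. -/
def decode (k : ℕ) : List ℕ × List ℕ :=
  let l := (List.range 14).map fun q => min q (digit k q - 1)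
  (l.take (digit k 14), (l.drop (digit k 14)).reverse)

end ExchangeCode

namespace IntervalExchange

open ExchangeCode

variable (τ : IntervalExchange 7)

/-- The position of the first end of a band. -/
def firstEnd (i : Fin 7) : ℕ := τ.boundary.idxOf i

theorem mem_boundary (i : Fin 7) : i ∈ τ.boundary := by
  simpa [boundary] using τ.mem_top_or_mem_bottom i

theorem firstEnd_injective : Function.Injective τ.firstEnd := fun i _ h =>
  (List.idxOf_inj (τ.mem_boundary i)).1 h

theorem firstEnd_get (q : Fin τ.boundary.length) :
    τ.firstEnd (τ.boundary.get q) = min (q : ℕ) (τ.partner q) := by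
  have h1 : τ.firstEnd (τ.boundary.get q) ≤ q := idxOf_getElem_le q.2
  have h2 : τ.firstEnd (τ.boundary.get q) ≤ τ.partner q := by
    rw [← (τ.partner_spec q).2]
    exact idxOf_getElem_le (τ.partner q).2
  have h3 : τ.firstEnd (τ.boundary.get q) < τ.boundary.length :=
    List.idxOf_lt_length_of_mem (τ.mem_boundary _)
  have h4 : τ.boundary.get ⟨_, h3⟩ = τ.boundary.get q := List.getElem_idxOf h3
  by_cases h5 : (⟨_, h3⟩ : Fin τ.boundary.length) = q
  · have := congrArg Fin.val h5
    simp only at this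
    omega
  · have := congrArg Fin.val (eq_partner h5 h4)
    simp only at this
    omega

theorem decode_code :
    decode (code τ.lists) = τ.lists.map (List.map τ.firstEnd) (List.map τ.firstEnd) := by
  have h : (List.range 14).map (fun q => min q (digit (code τ.lists) q - 1)) =
      τ.boundary.map τ.firstEnd := by
    refine List.ext_getElem (by simp [length_boundary_seven]) fun q h1 h2 => ?_
    rw [List.length_map] at h2
    have h3 := τ.isCode_code ⟨q, h2⟩
    have h4 := τ.firstEnd_get ⟨q, h2⟩
    simp only [List.get_eq_getElem] at h3 h4
    rw [List.getElem_map, List.getElem_map, List.getElem_range, h4, h3, Nat.add_sub_cancel]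
  simp only [decode, h, digit_code_top]
  simp [boundary, lists]

/-- The code determines an exchange up to relabeling its bands. -/
theorem cls_eq_of_code_eq {τ σ : IntervalExchange 7} (h : code τ.lists = code σ.lists) :
    τ.cls = σ.cls := by
  have h1 : τ.lists.map (List.map τ.firstEnd) (List.map τ.firstEnd) =
      σ.lists.map (List.map σ.firstEnd) (List.map σ.firstEnd) := by
    rw [← decode_code, ← decode_code, h]
  have ht : τ.top.map τ.firstEnd = σ.top.map σ.firstEnd := congrArg Prod.fst h1
  have hb : τ.bottom.map τ.firstEnd = σ.bottom.map σ.firstEnd := congrArg Prod.snd h1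
  have hex : ∀ i, ∃ j, σ.firstEnd j = τ.firstEnd i := by
    intro i
    rcases τ.mem_top_or_mem_bottom i with hi | hi
    · have := List.mem_map_of_mem (f := τ.firstEnd) hi
      rw [ht] at this
      obtain ⟨j, -, hj⟩ := List.mem_map.1 this
      exact ⟨j, hj⟩
    · have := List.mem_map_of_mem (f := τ.firstEnd) hi
      rw [hb] at this
      obtain ⟨j, -, hj⟩ := List.mem_map.1 this
      exact ⟨j, hj⟩
  choose g hg using hex
  have hinj : Function.Injective g := fun i j hij =>
    τ.firstEnd_injective (by rw [← hg, ← hg, hij])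
  refine Quotient.sound
    ⟨Equiv.ofBijective g (Finite.injective_iff_bijective.1 hinj), Or.inl ⟨?_, ?_⟩⟩
  · apply List.map_injective_iff.2 σ.firstEnd_injective
    rw [← ht, List.map_map]
    exact List.map_congr_left fun i _ => (hg i).symm
  · apply List.map_injective_iff.2 σ.firstEnd_injective
    rw [← hb, List.map_map]
    exact List.map_congr_left fun i _ => (hg i).symm

end IntervalExchange

/-! ### Recognizing complete exchanges by their codes -/

namespace ExchangeCode

/-- `k n`, arranged so that the kernel evaluates `n` before it substitutes it. -/
noncomputable def force {β : Type} (n : ℕ) (k : ℕ → β) : β :=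
  Nat.rec (k 0) (fun m _ => k (Nat.succ m)) n

theorem force_eq {β : Type} (n : ℕ) (k : ℕ → β) : force n k = k n := by
  cases n <;> rfl

/-- All numbers less than `n` satisfy `p`. -/
noncomputable def allBelow (n : ℕ) (p : ℕ → Bool) : Bool :=
  Nat.rec true (fun i ih => bif p i then ih else false) n

/-- Some number less than `n` satisfies `p`. -/
noncomputable def anyBelow (n : ℕ) (p : ℕ → Bool) : Bool :=
  Nat.rec false (fun i ih => bif p i then true else ih) n

theorem allBelow_iff {n : ℕ} {p : ℕ → Bool} : allBelow n p = true ↔ ∀ i < n, p i = true := by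
  induction n with
  | zero => simp [allBelow]
  | succ n ih =>
    have : allBelow (n + 1) p = bif p n then allBelow n p else false := rfl
    rw [this, Nat.forall_lt_succ_right, ← ih]
    cases p n <;> simp

theorem anyBelow_iff {n : ℕ} {p : ℕ → Bool} : anyBelow n p = true ↔ ∃ i < n, p i = true := by
  induction n with
  | zero => simp [anyBelow]
  | succ n ih =>
    have : anyBelow (n + 1) p = bif p n then true else anyBelow n p := rfl
    rw [this, Nat.exists_lt_succ_right, ← ih]
    cases p n <;> simp

/-- The cyclic successor of a position on the boundary circle. -/
def nextPos (g : ℕ) : ℕ := Nat.mod (Nat.succ g) 14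

/-- The contribution of a gap to the number of cusps if there are `m` top ends. -/
def cuspCount (m g : ℕ) : ℕ :=
  bif Nat.beq (Nat.succ g) 14 then 0 else bif Nat.beq (Nat.succ g) m then 0 else 1

/-- Walk from the gap `g` along the boundary of its region until the gap `g₀` is reached, and
test whether three cusps are met. The number of cusps met before is `c`. -/
noncomputable def walk (x m g₀ fuel : ℕ) : ℕ → ℕ → Bool :=
  Nat.rec (fun _ _ => false) (fun _ ih g c =>
    force (Nat.pred (digit x (nextPos g))) fun q =>
      bif Nat.beq q g₀ then Nat.beq c 3 else force (Nat.add c (cuspCount m q)) fun c => ih q c) fuel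

/-- All complementary regions are triangles. -/
noncomputable def triangles (x m : ℕ) : Bool :=
  allBelow 14 fun g => walk x m g 14 g (cuspCount m g)

/-- There is a band with both ends on the top. -/
noncomputable def topReversing (x m : ℕ) : Bool :=
  anyBelow m fun p => Nat.ble (digit x p) m

/-- There is a band with both ends on the bottom. -/
noncomputable def bottomReversing (x m : ℕ) : Bool :=
  anyBelow 14 fun p => bif Nat.ble m p then Nat.blt m (digit x p) else false

/-- There are orientation reversing bands on both sides or on no side. This is necessary for
recurrence. -/
noncomputable def balanced (x m : ℕ) : Bool :=
  bif topReversing x m then bottomReversing x m else !bottomReversing x m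

end ExchangeCode

namespace IntervalExchange

open ExchangeCode

variable {τ : IntervalExchange 7} {x : ℕ}

theorem val_lt (p : Fin τ.boundary.length) : (p : ℕ) < 14 :=
  p.2.trans_eq τ.length_boundary_seven

theorem nextPos_val (p : Fin τ.boundary.length) : nextPos p = τ.next p := by
  have h : (τ.next p : ℕ) = ((p : ℕ) + 1) % τ.boundary.length := rfl
  rw [h]
  exact congrArg (((p : ℕ) + 1) % ·) τ.length_boundary_seven.symm

theorem IsCode.digit_nextPos (hx : τ.IsCode x) (p : Fin τ.boundary.length) :
    Nat.pred (digit x (nextPos p)) = τ.nextGap p := by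
  rw [nextPos_val, hx]
  rfl

theorem cuspCount_eq (p : Fin τ.boundary.length) :
    cuspCount τ.top.length p = if τ.IsCusp p then 1 else 0 := by
  simp only [cuspCount, IsCusp, length_boundary_seven, cond_eq_ite, Nat.succ_eq_add_one,
    Nat.beq_eq]
  grind

theorem card_filter_range_succ (P : ℕ → Prop) [DecidablePred P] (j : ℕ) :
    ((Finset.range (j + 1)).filter P).card =
      ((Finset.range j).filter P).card + if P j then 1 else 0 := by
  rw [Finset.range_add_one, Finset.filter_insert]
  split_ifs
  · rw [Finset.card_insert_of_notMem (by simp)]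
  · rfl

theorem minimalPeriod_nextGap_pos (p : Fin τ.boundary.length) :
    0 < Function.minimalPeriod τ.nextGap p :=
  Function.minimalPeriod_pos_of_mem_periodicPts (τ.mem_periodicPts_nextGap p)

theorem minimalPeriod_nextGap_le (p : Fin τ.boundary.length) :
    Function.minimalPeriod τ.nextGap p ≤ 14 := by
  have h : Set.InjOn (fun i => τ.nextGap^[i] p)
      (Finset.range (Function.minimalPeriod τ.nextGap p)) := fun i hi j hj hij =>
    Function.iterate_injOn_Iio_minimalPeriod (by simpa using hi) (by simpa using hj) hij
  have := Finset.card_le_card_of_injOn (t := Finset.univ) _ (fun _ _ => Finset.mem_univ _) h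
  simpa [length_boundary_seven] using this

theorem iterate_nextGap_ne {p : Fin τ.boundary.length} {j : ℕ} (h0 : 0 < j)
    (h : j < Function.minimalPeriod τ.nextGap p) : τ.nextGap^[j] p ≠ p :=
  Function.not_isPeriodicPt_of_pos_of_lt_minimalPeriod h0.ne' h

theorem IsCode.walk_eq (hx : τ.IsCode x) (p : Fin τ.boundary.length) (fuel : ℕ) :
    ∀ j c, j < Function.minimalPeriod τ.nextGap p →
      Function.minimalPeriod τ.nextGap p ≤ fuel + j →
      c = ((Finset.range (j + 1)).filter fun i => τ.IsCusp (τ.nextGap^[i] p)).card →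
      walk x τ.top.length p fuel (τ.nextGap^[j] p : Fin τ.boundary.length) c =
        decide (((Finset.range (Function.minimalPeriod τ.nextGap p)).filter
          fun i => τ.IsCusp (τ.nextGap^[i] p)).card = 3) := by
  induction fuel with
  | zero => intro j c h1 h2; omega
  | succ fuel ih =>
    intro j c h1 h2 hc
    have e : walk x τ.top.length p (fuel + 1) (τ.nextGap^[j] p : Fin τ.boundary.length) c =
        force (Nat.pred (digit x (nextPos (τ.nextGap^[j] p : Fin τ.boundary.length)))) fun q =>
          bif Nat.beq q p then Nat.beq c 3 else force (Nat.add c (cuspCount τ.top.length q))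
            fun c => walk x τ.top.length p fuel q c := rfl
    rw [e, hx.digit_nextPos, force_eq, ← Function.iterate_succ_apply' τ.nextGap, force_eq,
      cond_eq_ite]
    split_ifs with h <;> rw [Nat.beq_eq, ← Fin.ext_iff] at h
    · have h3 : Function.minimalPeriod τ.nextGap p = j + 1 := by
        by_contra h4
        exact iterate_nextGap_ne (Nat.succ_pos j) (by omega) h
      rw [h3, ← hc, Bool.eq_iff_iff, Nat.beq_eq, decide_eq_true_eq]
    · refine ih (j + 1) _ ?_ (by omega) ?_
      · by_contra h4
        have h3 : Function.minimalPeriod τ.nextGap p = j + 1 := by omega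
        have h5 := Function.iterate_minimalPeriod (f := τ.nextGap) (x := p)
        rw [h3] at h5
        exact h h5
      · rw [card_filter_range_succ _ (j + 1), ← hc, ← cuspCount_eq]
        rfl

theorem IsCode.triangles_iff (hx : τ.IsCode x) :
    triangles x τ.top.length = true ↔ ∀ R : τ.Region, τ.IsIdealTriangle R := by
  have h1 : ∀ p : Fin τ.boundary.length,
      walk x τ.top.length p 14 p (cuspCount τ.top.length p) = true ↔
        ((Finset.range (Function.minimalPeriod τ.nextGap p)).filter
          fun i => τ.IsCusp (τ.nextGap^[i] p)).card = 3 := by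
    intro p
    have := hx.walk_eq p 14 0 (cuspCount τ.top.length p) (minimalPeriod_nextGap_pos p)
      (by have := minimalPeriod_nextGap_le p; omega)
      (by rw [card_filter_range_succ, cuspCount_eq, Finset.range_zero, Finset.filter_empty,
        Finset.card_empty, zero_add]; rfl)
    rw [Function.iterate_zero, id_eq] at this
    rw [this, decide_eq_true_eq]
  rw [triangles, allBelow_iff, forall_isIdealTriangle_iff]
  refine ⟨fun h p => (h1 p).1 (h p (val_lt p)),
    fun h g hg => (h1 ⟨g, by rwa [length_boundary_seven]⟩).2 (h _)⟩

theorem mem_top_iff (i : Fin 7) :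
    i ∈ τ.top ↔ ∃ p : Fin τ.boundary.length, (p : ℕ) < τ.top.length ∧ τ.boundary.get p = i := by
  constructor
  · intro hi
    obtain ⟨p, hp, rfl⟩ := List.mem_iff_getElem.1 hi
    exact ⟨⟨p, by rw [boundary, List.length_append]; omega⟩, hp, List.getElem_append_left hp⟩
  · rintro ⟨p, hp, rfl⟩
    have : τ.boundary.get p = τ.top[(p : ℕ)] := List.getElem_append_left hp
    rw [this]
    exact List.getElem_mem _

theorem mem_bottom_iff (i : Fin 7) :
    i ∈ τ.bottom ↔ ∃ p : Fin τ.boundary.length, τ.top.length ≤ p ∧ τ.boundary.get p = i := by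
  rw [← List.mem_reverse]
  constructor
  · intro hi
    obtain ⟨p, hp, rfl⟩ := List.mem_iff_getElem.1 hi
    refine ⟨⟨τ.top.length + p, by rw [boundary, List.length_append]; omega⟩,
      Nat.le_add_right _ _, ?_⟩
    simp [boundary]
  · rintro ⟨p, hp, rfl⟩
    have : τ.boundary.get p = τ.bottom.reverse[(p : ℕ) - τ.top.length]'(by
        have := p.2
        simp only [boundary, List.length_append] at this
        omega) :=
      List.getElem_append_right hp
    rw [this]
    exact List.getElem_mem _

theorem eq_or_eq_partner {p q : Fin τ.boundary.length}
    (h : τ.boundary.get q = τ.boundary.get p) : q = p ∨ q = τ.partner p :=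
  or_iff_not_imp_left.2 fun h' => eq_partner h' h

theorem IsCode.topReversing_iff (hx : τ.IsCode x) :
    topReversing x τ.top.length = true ↔ ∃ i, i ∉ τ.bottom := by
  have hlen : τ.top.length ≤ τ.boundary.length := by simp [boundary]
  simp only [topReversing, anyBelow_iff, Nat.ble_eq, mem_bottom_iff, not_exists, not_and]
  constructor
  · rintro ⟨p, hp, hp'⟩
    have h1 := hx ⟨p, by omega⟩
    simp only at h1
    refine ⟨τ.boundary.get ⟨p, by omega⟩, fun q hq hq' => ?_⟩
    rcases eq_or_eq_partner hq' with rfl | rfl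
    · simp only at hq; omega
    · omega
  · rintro ⟨i, hi⟩
    obtain ⟨p, hp, rfl⟩ := List.mem_iff_getElem.1 (τ.mem_boundary i)
    have h1 := hi ⟨p, hp⟩
    have h2 := hi (τ.partner ⟨p, hp⟩)
    have h3 := hx ⟨p, hp⟩
    have h4 := (τ.partner_spec ⟨p, hp⟩).2
    simp only [List.get_eq_getElem] at h1 h2 h3 h4
    refine ⟨p, ?_, ?_⟩
    · by_contra h; exact h1 (by omega) trivial
    · by_contra h; exact h2 (by omega) h4

theorem IsCode.bottomReversing_iff (hx : τ.IsCode x) :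
    bottomReversing x τ.top.length = true ↔ ∃ i, i ∉ τ.top := by
  have hlen := τ.length_boundary_seven
  simp only [bottomReversing, anyBelow_iff, mem_top_iff, not_exists, not_and, cond_eq_ite,
    Nat.ble_eq]
  constructor
  · rintro ⟨p, hp, hp'⟩
    have h1 := hx ⟨p, by omega⟩
    simp only at h1
    split_ifs at hp' with h2
    rw [Nat.blt_eq] at hp'
    refine ⟨τ.boundary.get ⟨p, by omega⟩, fun q hq hq' => ?_⟩
    rcases eq_or_eq_partner hq' with rfl | rfl
    · simp only at hq; omega
    · omega
  · rintro ⟨i, hi⟩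
    obtain ⟨p, hp, rfl⟩ := List.mem_iff_getElem.1 (τ.mem_boundary i)
    have h1 := hi ⟨p, hp⟩
    have h2 := hi (τ.partner ⟨p, hp⟩)
    have h3 := hx ⟨p, hp⟩
    have h4 := (τ.partner_spec ⟨p, hp⟩).2
    simp only [List.get_eq_getElem] at h1 h2 h3 h4
    have h5 : τ.top.length ≤ p := by
      by_contra h; exact h1 (by omega) trivial
    refine ⟨p, by omega, ?_⟩
    rw [if_pos h5, Nat.blt_eq]
    by_contra h; exact h2 (by omega) h4

theorem forall_mem_of_forall_mem {n : ℕ} {l l' : List (Fin n)} (hc : ∀ i, (l ++ l').count i = 2)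
    {w : Fin n → ℝ} (hw : ∀ i, 0 < w i) (hs : (l.map w).sum = (l'.map w).sum)
    (h : ∀ i, i ∈ l) (i : Fin n) : i ∈ l' := by
  by_contra hi
  have e : ∀ l : List (Fin n), (l.map w).sum = ∑ j, l.count j * w j := by
    intro l
    rw [Finset.sum_list_map_count]
    simp only [nsmul_eq_mul]
    refine Finset.sum_subset (Finset.subset_univ _) fun j _ hj => ?_
    rw [List.count_eq_zero_of_not_mem (by simpa using hj), Nat.cast_zero, zero_mul]
  rw [e, e] at hs
  refine hs.not_gt (Finset.sum_lt_sum (fun j _ => ?_) ⟨i, Finset.mem_univ i, ?_⟩)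
  · have h1 := hc j
    have h2 := List.count_pos_iff.2 (h j)
    rw [List.count_append] at h1
    have h3 : (l'.count j : ℝ) ≤ l.count j := by exact_mod_cast (by omega)
    exact mul_le_mul_of_nonneg_right h3 (hw j).le
  · have h2 := List.count_pos_iff.2 (h i)
    rw [List.count_eq_zero_of_not_mem hi, Nat.cast_zero, zero_mul]
    exact mul_pos (by exact_mod_cast h2) (hw i)

theorem IsCode.balanced (hx : τ.IsCode x) (h : τ.IsRecurrent) :
    balanced x τ.top.length = true := by
  obtain ⟨w, hw, hpos⟩ := h
  have hs : (τ.top.map w).sum = (τ.bottom.map w).sum := hw.1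
  have h1 : (∃ i, i ∉ τ.bottom) ↔ ∃ i, i ∉ τ.top := by
    rw [← not_iff_not]
    push Not
    refine ⟨forall_mem_of_forall_mem (fun i => ?_) hpos hs.symm,
      forall_mem_of_forall_mem τ.count_eq_two hpos hs⟩
    rw [← τ.flip.count_eq_two i]
    rfl
  rw [← hx.topReversing_iff, ← hx.bottomReversing_iff] at h1
  rw [ExchangeCode.balanced]
  revert h1
  cases topReversing x τ.top.length <;> cases bottomReversing x τ.top.length <;> simp

end IntervalExchange

/-! ### Enumeration of the possible gluings -/

namespace ExchangeCode

/-- Record that the ends at `e` and `q` belong to the same band. -/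
def matchEnds (x e q : ℕ) : ℕ :=
  Nat.add (Nat.add x (Nat.mul (Nat.succ e) (Nat.pow 16 q))) (Nat.mul (Nat.succ q) (Nat.pow 16 e))

/-- The states of the search: the part `x` of the code known so far, the gap `g₀` at which the
current region is entered, the current gap `g`, the number `c` of gaps of this region met so far,
not counting the last gap `13`, and the list of the codes already found. -/
abbrev Search : Type := ℕ → ℕ → ℕ → ℕ → List ℕ → List ℕ

/-- Continue with the region of the gap preceding `g₀`. -/
noncomputable def nextRegion (ih : Search) (x g₀ : ℕ) (acc : List ℕ) : List ℕ :=
  Nat.rec (x :: acc) (fun g _ => ih x g g 1 acc) g₀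

/-- Go on to the gap `q`. Once the region is closed, its number of gaps is checked; a region that
contains a gap greater than `g₀` has been treated before. -/
noncomputable def advance (ih : Search) (x g₀ c q : ℕ) (acc : List ℕ) : List ℕ :=
  bif Nat.beq q g₀ then
    bif bif Nat.ble 3 c then Nat.ble c 4 else false then nextRegion ih x g₀ acc else acc
  else bif Nat.ble q g₀ then force (Nat.succ c) fun c => ih x g₀ q c acc
  else nextRegion ih x g₀ acc

/-- Try all positions for the other end of the band that ends at `e`. -/
noncomputable def tryAll (f : ℕ → List ℕ → List ℕ) (x e n : ℕ) (acc : List ℕ) : List ℕ :=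
  Nat.rec acc (fun q ih => Nat.rec (bif Nat.beq q e then ih else f q ih) (fun _ _ => ih)
    (digit x q)) n

/-- One step of the search. -/
noncomputable def searchStep (ih : Search) : Search := fun x g₀ g c acc =>
  force (nextPos g) fun e => force (digit x e) fun d =>
    Nat.rec
      (bif Nat.ble c 4 then
        tryAll (fun q acc => force (matchEnds x e q) fun x => advance ih x g₀ c q acc) x e 14 acc
      else acc)
      (fun q _ => advance ih x g₀ c q acc) d

/-- Search for the codes of all exchanges whose regions have three or four gaps besides the last
gap, tracing the regions in descending order of their greatest gaps and deciding on a band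
only when one of its ends is met. -/
noncomputable def search (fuel : ℕ) : Search :=
  Nat.rec (fun _ _ _ _ acc => acc) (fun _ ih => searchStep ih) fuel

/-- The codes (without the number of top ends) of all exchanges with seven bands whose regions
have three or four gaps besides the last gap. A region has at most 14 gaps, and there are at most 14
regions, which bounds the number of steps. -/
noncomputable def gluings : List ℕ := search 196 0 13 13 0 []

theorem advance_eq (ih : Search) (x g₀ c q : ℕ) (acc : List ℕ) :
    advance ih x g₀ c q acc =
      if q = g₀ then if 3 ≤ c ∧ c ≤ 4 then nextRegion ih x g₀ acc else acc
      else if q ≤ g₀ then ih x g₀ q (c + 1) acc else nextRegion ih x g₀ acc := by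
  simp only [advance, cond_eq_ite, Nat.beq_eq, force_eq, Nat.ble_eq, Nat.succ_eq_add_one]
  by_cases h : 3 ≤ c <;> simp [h]

theorem subset_nextRegion {ih : Search} (h : ∀ x g₀ g c acc, acc ⊆ ih x g₀ g c acc)
    (x g₀ : ℕ) (acc : List ℕ) : acc ⊆ nextRegion ih x g₀ acc := by
  cases g₀ with
  | zero => exact List.subset_cons_self x acc
  | succ g => exact h x g g 1 acc

theorem subset_advance {ih : Search} (h : ∀ x g₀ g c acc, acc ⊆ ih x g₀ g c acc)
    (x g₀ c q : ℕ) (acc : List ℕ) : acc ⊆ advance ih x g₀ c q acc := by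
  rw [advance_eq]
  split_ifs
  · exact subset_nextRegion h x g₀ acc
  · exact List.Subset.refl acc
  · exact h _ _ _ _ _
  · exact subset_nextRegion h x g₀ acc

theorem tryAll_succ (f : ℕ → List ℕ → List ℕ) (x e n : ℕ) (acc : List ℕ) :
    tryAll f x e (n + 1) acc = if digit x n = 0 ∧ n ≠ e then f n (tryAll f x e n acc)
      else tryAll f x e n acc := by
  have : tryAll f x e (n + 1) acc = Nat.rec (bif Nat.beq n e then tryAll f x e n acc
      else f n (tryAll f x e n acc)) (fun _ _ => tryAll f x e n acc) (digit x n) := rfl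
  rw [this]
  cases digit x n with
  | zero =>
    rw [cond_eq_ite]
    by_cases h : n = e
    · simp [h]
    · rw [if_neg (by simpa using h), if_pos ⟨rfl, h⟩]
      rfl
  | succ d => simp

theorem subset_tryAll {f : ℕ → List ℕ → List ℕ} (h : ∀ q acc, acc ⊆ f q acc) (x e n : ℕ)
    (acc : List ℕ) : acc ⊆ tryAll f x e n acc := by
  induction n with
  | zero => exact List.Subset.refl acc
  | succ n ih =>
    rw [tryAll_succ]
    split_ifs
    · exact List.Subset.trans ih (h _ _)
    · exact ih

theorem exists_mem_tryAll {f : ℕ → List ℕ → List ℕ} (h : ∀ q acc, acc ⊆ f q acc) {P : ℕ → Prop}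
    {x e n q : ℕ} (hq : q < n) (hx : digit x q = 0) (hqe : q ≠ e)
    (hP : ∀ acc, ∃ y ∈ f q acc, P y) (acc : List ℕ) : ∃ y ∈ tryAll f x e n acc, P y := by
  induction n with
  | zero => omega
  | succ n ih =>
    rw [tryAll_succ]
    rcases Nat.lt_succ_iff_lt_or_eq.1 hq with hq | rfl
    · obtain ⟨y, hy, hPy⟩ := ih hq
      refine ⟨y, ?_, hPy⟩
      split_ifs
      · exact h _ _ hy
      · exact hy
    · rw [if_pos ⟨hx, hqe⟩]
      exact hP _

theorem searchStep_eq (ih : Search) (x g₀ g c : ℕ) (acc : List ℕ) :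
    searchStep ih x g₀ g c acc =
      if digit x (nextPos g) = 0 then
        if c ≤ 4 then tryAll (fun q acc => advance ih (matchEnds x (nextPos g) q) g₀ c q acc) x
          (nextPos g) 14 acc else acc
      else advance ih x g₀ c (digit x (nextPos g) - 1) acc := by
  simp only [searchStep, force_eq]
  cases digit x (nextPos g) with
  | zero => simp [cond_eq_ite]
  | succ d => simp

theorem subset_search (fuel : ℕ) : ∀ x g₀ g c acc, acc ⊆ search fuel x g₀ g c acc := by
  induction fuel with
  | zero => exact fun _ _ _ _ acc => List.Subset.refl acc
  | succ fuel ih =>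
    intro x g₀ g c acc
    change acc ⊆ searchStep (search fuel) x g₀ g c acc
    rw [searchStep_eq]
    split_ifs
    · exact subset_tryAll (fun q acc => subset_advance ih _ _ _ _ _) _ _ _ _
    · exact List.Subset.refl acc
    · exact subset_advance ih _ _ _ _ _

end ExchangeCode

namespace IntervalExchange

open ExchangeCode

variable {τ : IntervalExchange 7} {x : ℕ}

/-- The nonzero digits of `x` are correct, and a digit is zero if and only if the digit of the
other end of the band is zero. -/
def IsPartialCode (τ : IntervalExchange 7) (x : ℕ) : Prop :=
  ∀ q : Fin τ.boundary.length, (digit x q = 0 ∨ digit x q = τ.partner q + 1) ∧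
    (digit x q = 0 → digit x (τ.partner q) = 0)

theorem isPartialCode_zero (τ : IntervalExchange 7) : τ.IsPartialCode 0 := fun _ =>
  ⟨Or.inl (digit_zero _), fun _ => digit_zero _⟩

theorem IsPartialCode.matchEnds (hx : τ.IsPartialCode x) {e : Fin τ.boundary.length}
    (he : digit x e = 0) : τ.IsPartialCode (matchEnds x e (τ.partner e)) := by
  have hq := (hx e).2 he
  have hne := (τ.partner_spec e).1
  have hne' : (e : ℕ) ≠ τ.partner e := fun h => hne (Fin.ext h.symm)
  have h1 : ∀ j, digit (ExchangeCode.matchEnds x e (τ.partner e)) j =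
      if j = e then (τ.partner e : ℕ) + 1 else if j = τ.partner e then (e : ℕ) + 1
        else digit x j := by
    intro j
    have h2 := digit_add_mul_pow hq (d := e + 1) (by have := val_lt e; omega)
    change digit (x + ((e : ℕ) + 1) * 16 ^ (τ.partner e : ℕ) + ((τ.partner e : ℕ) + 1) *
      16 ^ (e : ℕ)) j = _
    rw [digit_add_mul_pow (by rw [h2, if_neg hne', he])
      (by have := val_lt (τ.partner e); omega), h2]
  intro r
  rw [h1, h1]
  by_cases hre : r = e
  · subst hre
    simp
  by_cases hrq : r = τ.partner e
  · subst hrq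
    rw [if_neg hne'.symm, if_pos rfl, τ.partner_partner]
    simp
  · have h3 : τ.partner r ≠ e := fun h => hrq (by rw [← h, τ.partner_partner])
    have h4 : τ.partner r ≠ τ.partner e := fun h => hre (by
      rw [← τ.partner_partner r, h, τ.partner_partner])
    rw [if_neg (fun h => hre (Fin.ext h)), if_neg (fun h => hrq (Fin.ext h)),
      if_neg (fun h => h3 (Fin.ext h)), if_neg (fun h => h4 (Fin.ext h))]
    exact hx r

/-- The number of gaps other than the last one among the first `j` gaps on the walk from `p`. -/
noncomputable def gapCount (p : Fin τ.boundary.length) (j : ℕ) : ℕ :=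
  ((Finset.range j).filter fun i => ((τ.nextGap^[i] p : Fin τ.boundary.length) : ℕ) ≠ 13).card

theorem gapCount_mono (p : Fin τ.boundary.length) : Monotone (gapCount p) := fun _ _ h =>
  Finset.card_le_card (Finset.filter_subset_filter _ (Finset.range_subset_range.2 h))

/-- Every region has three or four gaps besides the last gap. -/
def SmallRegions (τ : IntervalExchange 7) : Prop :=
  ∀ p : Fin τ.boundary.length, 3 ≤ gapCount p (Function.minimalPeriod τ.nextGap p) ∧
    gapCount p (Function.minimalPeriod τ.nextGap p) ≤ 4

theorem exists_mem_nextRegion {fuel : ℕ}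
    (ih : ∀ x, τ.IsPartialCode x → ∀ (p : Fin τ.boundary.length) (j c : ℕ) (acc : List ℕ),
      j < Function.minimalPeriod τ.nextGap p → c = gapCount p (j + 1) → 14 * p + 14 ≤ fuel + j →
      ∃ y ∈ search fuel x p (τ.nextGap^[j] p : Fin τ.boundary.length) c acc, τ.IsPartialCode y)
    (hx : τ.IsPartialCode x) (p : Fin τ.boundary.length) (acc : List ℕ)
    (hf : 14 * p ≤ fuel) : ∃ y ∈ nextRegion (search fuel) x p acc, τ.IsPartialCode y := by
  obtain ⟨p, hp⟩ := p
  cases p with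
  | zero => exact ⟨x, List.mem_cons_self, hx⟩
  | succ g =>
    refine ih x hx ⟨g, by omega⟩ 0 1 acc (minimalPeriod_nextGap_pos _) ?_
      (by simp only at hf ⊢; omega)
    have := val_lt ⟨g + 1, hp⟩
    simp only at this
    rw [gapCount, card_filter_range_succ,
      if_pos (by simp only [Function.iterate_zero, id_eq]; omega)]
    simp

/-- The search finds every exchange with small regions. -/
theorem SmallRegions.exists_mem_search (hτ : τ.SmallRegions) (fuel : ℕ) :
    ∀ x, τ.IsPartialCode x → ∀ (p : Fin τ.boundary.length) (j c : ℕ) (acc : List ℕ),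
      j < Function.minimalPeriod τ.nextGap p → c = gapCount p (j + 1) → 14 * p + 14 ≤ fuel + j →
      ∃ y ∈ search fuel x p (τ.nextGap^[j] p : Fin τ.boundary.length) c acc,
        τ.IsPartialCode y := by
  induction fuel with
  | zero =>
    intro x _ p j c acc h1 _ h3
    have := minimalPeriod_nextGap_le p
    omega
  | succ fuel ih =>
    intro x hx p j c acc h1 h2 h3
    have hle := minimalPeriod_nextGap_le p
    have hc : c ≤ 4 := h2 ▸ (gapCount_mono p (Nat.succ_le_of_lt h1)).trans (hτ p).2
    have key : ∀ x, τ.IsPartialCode x → ∀ acc,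
        ∃ y ∈ advance (search fuel) x p c (τ.nextGap^[j + 1] p : Fin τ.boundary.length) acc,
          τ.IsPartialCode y := by
      intro x hx acc
      rw [advance_eq]
      split_ifs with h4 h5 h6
      · exact exists_mem_nextRegion ih hx p acc (by omega)
      · refine absurd ?_ h5
        have h7 : Function.minimalPeriod τ.nextGap p = j + 1 := by
          by_contra h8
          exact iterate_nextGap_ne (Nat.succ_pos j) (by omega) (Fin.ext h4)
        rw [h2, ← h7]
        exact hτ p
      · have h7 : j + 1 < Function.minimalPeriod τ.nextGap p := by
          by_contra h8
          have h9 : Function.minimalPeriod τ.nextGap p = j + 1 := by omega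
          have h10 := Function.iterate_minimalPeriod (f := τ.nextGap) (x := p)
          rw [h9] at h10
          exact h4 (congrArg Fin.val h10)
        refine ih x hx p (j + 1) (c + 1) acc h7 ?_ (by omega)
        have := val_lt p
        rw [gapCount, card_filter_range_succ _ (j + 1), if_pos (by omega), h2]
        rfl
      · exact exists_mem_nextRegion ih hx p acc (by omega)
    change ∃ y ∈ searchStep (search fuel) x p _ c acc, _
    rw [searchStep_eq, if_pos hc, nextPos_val]
    set e := τ.next (τ.nextGap^[j] p) with he
    have hq : τ.nextGap^[j + 1] p = τ.partner e := Function.iterate_succ_apply' _ _ _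
    rw [hq] at key
    split_ifs with h4
    · refine exists_mem_tryAll (f := fun q acc =>
          advance (search fuel) (ExchangeCode.matchEnds x e q) p c q acc)
        (fun q acc => subset_advance (subset_search fuel) _ _ _ _ _) (val_lt (τ.partner e))
        ((hx e).2 h4) (fun h => (τ.partner_spec e).1 (Fin.ext h))
        (key _ (hx.matchEnds h4)) acc
    · rw [(hx e).1.resolve_left h4, Nat.add_sub_cancel]
      exact key x hx acc

theorem SmallRegions.exists_mem_gluings (hτ : τ.SmallRegions) :
    ∃ y ∈ gluings, τ.IsPartialCode y := by
  have h14 := τ.length_boundary_seven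
  let p : Fin τ.boundary.length := ⟨13, by omega⟩
  refine hτ.exists_mem_search 196 0 τ.isPartialCode_zero p 0 0 [] (minimalPeriod_nextGap_pos p) ?_
    (by simp [p])
  rw [gapCount, card_filter_range_succ]
  simp [p]

/-- The boundary of a triangle contains three cusps, and besides them at most the gap behind the
rightmost top end and the last gap. The number of top ends does not enter this condition. -/
theorem smallRegions (hb : τ.bottom ≠ []) (h : ∀ R : τ.Region, τ.IsIdealTriangle R) :
    τ.SmallRegions := by
  rw [forall_isIdealTriangle_iff] at h
  intro p
  rw [← h p, gapCount]
  set k := Function.minimalPeriod τ.nextGap p with hk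
  have hlen := τ.length_boundary_seven
  have hlen' : τ.top.length < 14 := by
    have h1 := τ.length_top_add_length_bottom
    have h2 := List.length_pos_iff.2 hb
    omega
  set A := (Finset.range k).filter fun i => τ.IsCusp (τ.nextGap^[i] p) with hA
  set B := (Finset.range k).filter fun i =>
    ((τ.nextGap^[i] p : Fin τ.boundary.length) : ℕ) ≠ 13 with hB
  have h1 : A ⊆ B := by
    intro i hi
    rw [hA, Finset.mem_filter] at hi
    rw [hB, Finset.mem_filter]
    refine ⟨hi.1, fun h => hi.2.2 ?_⟩
    rw [h, hlen]
  have h2 : (B \ A).card ≤ 1 := by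
    rw [Finset.card_le_one]
    intro i hi j hj
    simp only [hA, hB, Finset.mem_sdiff, Finset.mem_filter, IsCusp] at hi hj
    refine Function.iterate_injOn_Iio_minimalPeriod (Finset.mem_range.1 hi.1.1)
      (Finset.mem_range.1 hj.1.1) (Fin.ext ?_)
    have h3 : ((τ.nextGap^[i] p : Fin τ.boundary.length) : ℕ) + 1 = τ.top.length := by
      by_contra h
      exact hi.2 (Finset.mem_filter.2 ⟨hi.1.1, h, by omega⟩)
    have h4 : ((τ.nextGap^[j] p : Fin τ.boundary.length) : ℕ) + 1 = τ.top.length := by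
      by_contra h
      exact hj.2 (Finset.mem_filter.2 ⟨hj.1.1, h, by omega⟩)
    simp only
    omega
  have h3 := Finset.card_sdiff_add_card_eq_card h1
  have h4 : A.card = 3 := h p
  omega

end IntervalExchange

/-! ### The census of complete exchanges -/

namespace ExchangeCode

/-- The codes of all complete exchanges with seven bands. -/
noncomputable def census : List ℕ :=
  gluings.flatMap fun x => ((List.range 14).filter fun m =>
    bif balanced x m then triangles x m else false).map fun m =>
      encode ((List.range 14).map (digit x) ++ [m])

/-- `k l`, arranged so that the kernel evaluates the members of `l` before it substitutes them. -/
noncomputable def forceList {β : Type} (l : List ℕ) (k : List ℕ → β) : β :=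
  List.rec (motive := fun _ => (List ℕ → β) → β) (fun k => k [])
    (fun a _ ih k => force a fun a => ih fun l => k (a :: l)) l k

/-- `k l`, arranged so that the kernel evaluates the members of `l` before it substitutes them. -/
noncomputable def forceTriples {β : Type} (l : List (ℕ × ℕ × ℕ)) (k : List (ℕ × ℕ × ℕ) → β) : β :=
  List.rec (motive := fun _ => (List (ℕ × ℕ × ℕ) → β) → β) (fun k => k [])
    (fun a _ ih k => force a.1 fun x => force a.2.1 fun y => force a.2.2 fun z =>
      ih fun l => k ((x, y, z) :: l)) l k

theorem forceList_eq {β : Type} (l : List ℕ) (k : List ℕ → β) : forceList l k = k l := by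
  induction l generalizing k with
  | nil => rfl
  | cons a l ih =>
    change force a (fun a => forceList l fun l => k (a :: l)) = _
    rw [force_eq, ih]

theorem forceTriples_eq {β : Type} (l : List (ℕ × ℕ × ℕ)) (k : List (ℕ × ℕ × ℕ) → β) :
    forceTriples l k = k l := by
  induction l generalizing k with
  | nil => rfl
  | cons a l ih =>
    change force a.1 (fun x => force a.2.1 fun y => force a.2.2 fun z =>
      forceTriples l fun l => k ((x, y, z) :: l)) = _
    rw [force_eq, force_eq, force_eq, ih]

/-- Membership in a list, in a form that the kernel evaluates quickly. -/
noncomputable def contains (l : List ℕ) (x : ℕ) : Bool :=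
  List.rec false (fun a _ ih => bif Nat.beq a x then true else ih) l

theorem contains_iff {l : List ℕ} {x : ℕ} : contains l x = true ↔ x ∈ l := by
  induction l with
  | nil => simp [contains]
  | cons a l ih =>
    have : contains (a :: l) x = bif Nat.beq a x then true else contains l x := rfl
    rw [this, List.mem_cons, ← ih, cond_eq_ite]
    by_cases h : x = a
    · simp [h]
    · rw [if_neg (by rw [Nat.beq_eq]; exact fun h' => h h'.symm)]
      simp [h]

/-- Integral weights on `decode k`: powers of three on the orientation preserving bands, which
are multiplied on the orientation reversing bands by factors that balance the two sides. Because of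
the powers of three, the positions of two gaps rarely coincide; that they never do is verified for
the members of the census. -/
noncomputable def weight (k : ℕ) : ℕ → ℕ :=
  force ((decode k).1.foldr
    (fun a s => (bif Nat.ble (digit k a) (digit k 14) then 3 ^ a else 0) + s) 0) fun s =>
  force ((decode k).2.foldr (fun a s => (bif Nat.ble (digit k 14) a then 3 ^ a else 0) + s) 0)
    fun s' a => bif Nat.ble (digit k 14) a then 3 ^ a * s else
      bif Nat.ble (digit k a) (digit k 14) then 3 ^ a * s' else 3 ^ a

/-- The sums of the weights of the proper nonempty initial segments of a list, increased
by `s`. -/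
def innerSums (v : ℕ → ℕ) : ℕ → List ℕ → List ℕ
  | s, a :: b :: l => (s + v a) :: innerSums v (s + v a) (b :: l)
  | _, _ => []

/-- The weights `v` are positive, satisfy the switch condition, and have no connections. -/
noncomputable def noConnection (p : List ℕ × List ℕ) (v : ℕ → ℕ) : Bool :=
  (p.1.map v).sum == (p.2.map v).sum && (p.1 ++ p.2).all (fun a => Nat.blt 0 (v a)) &&
    (innerSums v 0 p.1).all fun s => !contains (innerSums v 0 p.2) s

/-- Different bands end at the right end of the two lists. -/
def differentEnds (p : List ℕ × List ℕ) : Bool :=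
  !p.1.isEmpty && !p.2.isEmpty && p.1.getLast? != p.2.getLast?

/-- A code together with the codes after the two possible splittings. -/
def successors (k : ℕ) : ℕ × ℕ × ℕ :=
  (k, code (splitListsDir true (decode k)), code (splitListsDir false (decode k)))

/-- `k` belongs to the list, unless it is not the code of a recurrent exchange. -/
noncomputable def inCensus (l : List ℕ) (k : ℕ) : Bool :=
  bif balanced k (digit k 14) then contains l k else true

/-- Backward search: all first components of `r` are connected to members of `l` by sequences of
triples. -/
noncomputable def reaches (fuel : ℕ) : List ℕ → List (ℕ × ℕ × ℕ) → Bool :=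
  Nat.rec (fun _ r => r.isEmpty) (fun _ ih l r =>
    forceTriples (r.filter fun t => !(contains l t.2.1 || contains l t.2.2)) fun r' =>
      forceList ((r.filter fun t => contains l t.2.1 || contains l t.2.2).map Prod.fst) fun l' =>
        ih l' r') fuel

theorem reaches_spec {P : ℕ → Prop} (fuel : ℕ) : ∀ (l : List ℕ) (r : List (ℕ × ℕ × ℕ)),
    (∀ k ∈ l, P k) → (∀ t ∈ r, P t.2.1 ∨ P t.2.2 → P t.1) → reaches fuel l r = true →
      ∀ t ∈ r, P t.1 := by
  induction fuel with
  | zero =>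
    intro l r _ _ h t ht
    have : r = [] := List.isEmpty_iff.1 h
    simp [this] at ht
  | succ fuel ih =>
    intro l r hl hr h t ht
    have e : reaches (fuel + 1) l r =
        forceTriples (r.filter fun t => !(contains l t.2.1 || contains l t.2.2)) fun r' =>
          forceList ((r.filter fun t => contains l t.2.1 || contains l t.2.2).map Prod.fst)
            fun l' => reaches fuel l' r' := rfl
    rw [e, forceTriples_eq, forceList_eq] at h
    have hnew : ∀ t ∈ r, (contains l t.2.1 || contains l t.2.2) = true → P t.1 := by
      intro t ht h
      rw [Bool.or_eq_true, contains_iff, contains_iff] at h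
      exact hr t ht (h.imp (hl _) (hl _))
    by_cases h0 : (contains l t.2.1 || contains l t.2.2) = true
    · exact hnew t ht h0
    · refine ih _ _ ?_ (fun t ht => hr t (List.mem_of_mem_filter ht)) h t
        (List.mem_filter.2 ⟨ht, by simpa using h0⟩)
      intro k hk
      obtain ⟨t, ht, rfl⟩ := List.mem_map.1 hk
      exact hnew t (List.mem_of_mem_filter ht) (List.mem_filter.1 ht).2

/-- The standard exchange as a pair of lists. -/
def standardLists : List ℕ × List ℕ := ([0, 1, 2, 3, 1, 2, 3], [4, 5, 6, 4, 5, 6, 0])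

/-- The facts about the census that are verified by evaluation. -/
noncomputable def censusCheck : Bool :=
  (gluings.all fun x => allBelow 14 fun i => !Nat.beq (digit x i) 0) &&
  forceList census fun l =>
    contains l (code standardLists) && contains l (code standardLists.swap) &&
    (l.all fun k => contains l (code (decode k).swap) && differentEnds (decode k) &&
      noConnection (decode k) (weight k)) &&
    forceTriples (l.map successors) fun r =>
      (r.all fun t => inCensus l t.2.1 && inCensus l t.2.2) &&
      reaches 30 [code standardLists, code standardLists.swap] r

set_option maxRecDepth 10000 in
theorem censusCheck_eq_true : censusCheck = true := by decide +kernel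

end ExchangeCode

namespace ExchangeCode

theorem gluings_total : ∀ x ∈ gluings, ∀ i < 14, digit x i ≠ 0 := by
  have h := censusCheck_eq_true
  rw [censusCheck, Bool.and_eq_true] at h
  intro x hx i hi h0
  have h1 := allBelow_iff.1 (List.all_eq_true.1 h.1 x hx) i hi
  rw [h0] at h1
  exact absurd h1 (by decide)

theorem census_facts :
    (code standardLists ∈ census ∧ code standardLists.swap ∈ census) ∧
    (∀ k ∈ census, code (decode k).swap ∈ census ∧ differentEnds (decode k) = true ∧
      noConnection (decode k) (weight k) = true) ∧
    (∀ k ∈ census, inCensus census (successors k).2.1 = true ∧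
      inCensus census (successors k).2.2 = true) ∧
    reaches 30 [code standardLists, code standardLists.swap] (census.map successors) = true := by
  have h := censusCheck_eq_true
  rw [censusCheck, Bool.and_eq_true, forceList_eq, forceTriples_eq] at h
  have h := h.2
  rw [Bool.and_eq_true, Bool.and_eq_true, Bool.and_eq_true, Bool.and_eq_true, contains_iff,
    contains_iff] at h
  obtain ⟨⟨h1, h2⟩, h3, h4⟩ := h
  refine ⟨h1, fun k hk => ?_, fun k hk => ?_, h4⟩
  · have := List.all_eq_true.1 h2 k hk
    rw [Bool.and_eq_true, Bool.and_eq_true, contains_iff] at this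
    exact ⟨this.1.1, this.1.2, this.2⟩
  · have := List.all_eq_true.1 h3 _ (List.mem_map_of_mem hk)
    rwa [Bool.and_eq_true] at this

theorem mem_innerSums (v : ℕ → ℕ) (A A' : List ℕ) (hA : A ≠ []) (hA' : A' ≠ []) (s : ℕ) :
    s + (A.map v).sum ∈ innerSums v s (A ++ A') := by
  induction A generalizing s with
  | nil => exact absurd rfl hA
  | cons a A ih =>
    cases A with
    | nil =>
      obtain ⟨b, l, rfl⟩ := List.exists_cons_of_ne_nil hA'
      simp [innerSums]
    | cons b l =>
      have := ih (by simp) (s + v a)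
      rw [List.map_cons, List.sum_cons, ← add_assoc]
      exact List.mem_cons_of_mem _ this

theorem noConnection_spec {p : List ℕ × List ℕ} {v : ℕ → ℕ} (h : noConnection p v = true) :
    (p.1.map v).sum = (p.2.map v).sum ∧ (∀ a ∈ p.1 ++ p.2, 0 < v a) ∧
      ∀ A A' B B', p.1 = A ++ A' → p.2 = B ++ B' → (A ≠ [] ∨ B ≠ []) → (A' ≠ [] ∨ B' ≠ []) →
        (A.map v).sum ≠ (B.map v).sum := by
  rw [noConnection, Bool.and_eq_true, Bool.and_eq_true, beq_iff_eq] at h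
  obtain ⟨⟨h1, h2⟩, h3⟩ := h
  have hpos : ∀ a ∈ p.1 ++ p.2, 0 < v a := fun a ha => by
    simpa using List.all_eq_true.1 h2 a ha
  refine ⟨h1, hpos, fun A A' B B' hA hB hne hne' heq => ?_⟩
  have key : ∀ l : List ℕ, (∀ a ∈ l, a ∈ p.1 ++ p.2) → (l.map v).sum = 0 → l = [] := by
    intro l hl h0
    cases l with
    | nil => rfl
    | cons a l =>
      have := hpos a (hl a (by simp))
      simp at h0
      omega
  have s1 : (p.1.map v).sum = (A.map v).sum + (A'.map v).sum := by
    rw [hA, List.map_append, List.sum_append]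
  have s2 : (p.2.map v).sum = (B.map v).sum + (B'.map v).sum := by
    rw [hB, List.map_append, List.sum_append]
  have kA := key A (fun a ha => by simp [hA, ha])
  have kA' := key A' (fun a ha => by simp [hA, ha])
  have kB := key B (fun a ha => by simp [hB, ha])
  have kB' := key B' (fun a ha => by simp [hB, ha])
  have nA : A ≠ [] := fun h => by
    rw [h, List.map_nil, List.sum_nil] at heq
    exact hne.elim (fun h' => h' h) fun h' => h' (kB heq.symm)
  have nB : B ≠ [] := fun h => by
    rw [h, List.map_nil, List.sum_nil] at heq
    exact nA (kA heq)
  have nA' : A' ≠ [] := fun h => by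
    rw [h, List.map_nil, List.sum_nil] at s1
    exact hne'.elim (fun h' => h' h) fun h' => h' (kB' (by omega))
  have nB' : B' ≠ [] := fun h => by
    rw [h, List.map_nil, List.sum_nil] at s2
    exact nA' (kA' (by omega))
  have m1 := mem_innerSums v A A' nA nA' 0
  have m2 := mem_innerSums v B B' nB nB' 0
  rw [zero_add, ← hA] at m1
  rw [zero_add, ← hB, ← heq, ← contains_iff] at m2
  have := List.all_eq_true.1 h3 _ m1
  rw [m2] at this
  exact absurd this (by decide)

end ExchangeCode

/-! ### Complete exchanges of genus 2 -/

namespace IntervalExchange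

open ExchangeCode

variable {τ : IntervalExchange 7}

/-- The search finds the gluing of a complete exchange, and no end remains undecided in the gluings
found, so that the code is determined by the gluing and the number of top ends. -/
theorem code_mem_census (h : τ.IsCompleteGenusTwo) : code τ.lists ∈ census := by
  obtain ⟨h1, h2, -⟩ := h
  have hb := (h1.ne_nil (by norm_num)).2
  obtain ⟨x, hx, hpart⟩ := (smallRegions hb h2).exists_mem_gluings
  have hcode : τ.IsCode x := fun q =>
    ((hpart q).1).resolve_left (gluings_total x hx q (val_lt q))
  have hlen := τ.length_top_add_length_bottom
  have hb' := List.length_pos_iff.2 hb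
  refine List.mem_flatMap.2 ⟨x, hx, List.mem_map.2 ⟨τ.top.length, List.mem_filter.2
    ⟨List.mem_range.2 (by omega), ?_⟩, (τ.code_eq_encode hcode).symm⟩⟩
  rw [hcode.balanced h1, hcode.triangles_iff.2 h2]
  rfl

theorem isIdealTriangle_of_mem_census (h : code τ.lists ∈ census) :
    ∀ R : τ.Region, τ.IsIdealTriangle R := by
  obtain ⟨x, -, h⟩ := List.mem_flatMap.1 h
  obtain ⟨m, hm, he⟩ := List.mem_map.1 h
  obtain ⟨hm, hf⟩ := List.mem_filter.1 hm
  have hd : ∀ d ∈ (List.range 14).map (digit x) ++ [m], d < 16 := by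
    intro d hd
    rcases List.mem_append.1 hd with hd | hd
    · obtain ⟨i, -, rfl⟩ := List.mem_map.1 hd
      exact digit_lt x i
    · rw [List.mem_singleton.1 hd]
      have := List.mem_range.1 hm
      omega
  have htop : m = τ.top.length := by
    rw [← digit_code_top, ← he, digit_encode hd]
    rfl
  have hcode : τ.IsCode x := by
    intro q
    rw [← τ.isCode_code q, ← he, digit_encode hd,
      List.getD_append _ _ _ _ (by simpa using val_lt q),
      List.getD_eq_getElem _ _ (by simpa using val_lt q)]
    simp
  rw [← hcode.triangles_iff, ← htop]
  rw [cond_eq_ite] at hf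
  split_ifs at hf
  exact hf

/-- The census provides positive weights without connections, so that complete exchanges are
recurrent and satisfy no relation between the positions of two gaps identically. -/
theorem exists_noConnection (h : code τ.lists ∈ census) : ∃ w ∈ τ.switchSpace, (∀ i, 0 < w i) ∧
    ∀ A A' B B', τ.top = A ++ A' → τ.bottom = B ++ B' → (A ≠ [] ∨ B ≠ []) →
      (A' ≠ [] ∨ B' ≠ []) → (A.map w).sum ≠ (B.map w).sum := by
  have h1 := (census_facts.2.1 _ h).2.2
  rw [decode_code] at h1
  generalize weight (code τ.lists) = v at h1
  obtain ⟨h2, h3, h4⟩ := noConnection_spec h1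
  have key : ∀ l : List (Fin 7), (l.map fun i => ((v (τ.firstEnd i) : ℕ) : ℝ)).sum =
      (((l.map τ.firstEnd).map v).sum : ℕ) := by
    intro l
    rw [Nat.cast_list_sum, List.map_map, List.map_map]
    rfl
  refine ⟨fun i => (v (τ.firstEnd i) : ℝ), ?_, fun i => ?_, ?_⟩
  · rw [mem_switchSpace, key, key]
    exact_mod_cast h2
  · have : τ.firstEnd i ∈ τ.top.map τ.firstEnd ++ τ.bottom.map τ.firstEnd := by
      rw [← List.map_append]
      exact List.mem_map_of_mem (List.mem_append.2 (τ.mem_top_or_mem_bottom i))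
    exact Nat.cast_pos.2 (h3 _ this)
  · intro A A' B B' hA hB hne hne'
    rw [key, key]
    have := h4 (A.map τ.firstEnd) (A'.map τ.firstEnd) (B.map τ.firstEnd) (B'.map τ.firstEnd)
      (by rw [← List.map_append, ← hA]; rfl) (by rw [← List.map_append, ← hB]; rfl)
      (by simpa using hne) (by simpa using hne')
    exact_mod_cast this

theorem isCompleteGenusTwo_of_mem_census (h : code τ.lists ∈ census) : τ.IsCompleteGenusTwo := by
  obtain ⟨w, hw, hpos, -⟩ := exists_noConnection h
  exact (isCompleteGenusTwo_iff τ).2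
    ⟨⟨w, ⟨hw, fun i => (hpos i).le⟩, hpos⟩, isIdealTriangle_of_mem_census h⟩

theorem splittable_of_mem_census (h : code τ.lists ∈ census) : τ.Splittable := by
  have h1 := (census_facts.2.1 _ h).2.1
  rw [decode_code] at h1
  rcases List.eq_nil_or_concat τ.top with ht | ⟨A, t, ht⟩
  · simp [differentEnds, lists, ht] at h1
  rcases List.eq_nil_or_concat τ.bottom with hb | ⟨B, b, hb⟩
  · simp [differentEnds, lists, hb] at h1
  refine ⟨t, b, A, B, ?_, by simpa using ht, by simpa using hb⟩
  rintro rfl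
  simp [differentEnds, lists, ht, hb] at h1

theorem code_succ (h : τ.Splittable) (d : Bool) :
    code (τ.succ d).lists = code (splitListsDir d (decode (code τ.lists))) := by
  rw [decode_code, splitListsDir_map τ.firstEnd_injective, code_map τ.firstEnd_injective,
    lists_succ h]

theorem succ_mem_census (h : code τ.lists ∈ census) (d : Bool) (hr : (τ.succ d).IsRecurrent) :
    code (τ.succ d).lists ∈ census := by
  have h1 : inCensus census (code (τ.succ d).lists) = true := by
    rw [code_succ (splittable_of_mem_census h)]
    cases d
    · exact (census_facts.2.2.1 _ h).2
    · exact (census_facts.2.2.1 _ h).1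
  rw [inCensus, digit_code_top, (isCode_code _).balanced hr, cond_true, contains_iff] at h1
  exact h1

theorem cls_map {n : ℕ} {τ σ : IntervalExchange n} (e : Fin n ≃ Fin n)
    (h : σ.lists = τ.lists.map (List.map e) (List.map e)) : σ.cls = τ.cls :=
  (Quotient.sound ⟨e, Or.inl ⟨congrArg Prod.fst h, congrArg Prod.snd h⟩⟩ : τ.cls = σ.cls).symm

theorem cls_flip {n : ℕ} (τ : IntervalExchange n) : τ.flip.cls = τ.cls :=
  Quotient.sound ⟨Equiv.refl _, Or.inr ⟨by simp [flip], by simp [flip]⟩⟩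

/-- Exchanges of the same class differ by a relabeling and possibly the reflection. -/
theorem exists_of_cls_eq {n : ℕ} {τ σ : IntervalExchange n} (h : τ.cls = σ.cls) :
    ∃ e : Fin n ≃ Fin n, σ.lists = τ.lists.map (List.map e) (List.map e) ∨
      σ.lists = τ.flip.lists.map (List.map e) (List.map e) := by
  obtain ⟨e, ⟨h1, h2⟩ | ⟨h1, h2⟩⟩ := Quotient.exact h
  · exact ⟨e, Or.inl (Prod.ext h1 h2)⟩
  · exact ⟨e, Or.inr (Prod.ext h1 h2)⟩

theorem eq_of_cls_eq {n m : ℕ} {τ : IntervalExchange n} {σ : IntervalExchange m}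
    (h : τ.cls = σ.cls) : n = m := by
  obtain ⟨e, -⟩ := Quotient.exact h
  exact Fin.equiv_iff_eq.1 ⟨e⟩

theorem code_mem_census_of_cls (h : τ.cls ∈ ExchangeClass.completeGenusTwo) :
    code τ.lists ∈ census := by
  obtain ⟨n, σ, hσ, hcls⟩ := h
  obtain rfl := hσ.eq_seven
  have h1 := code_mem_census hσ
  obtain ⟨e, he | he⟩ := exists_of_cls_eq hcls
  · rwa [he, code_map e.injective]
  · rw [he, code_map e.injective, lists_flip]
    have h2 := (census_facts.2.1 _ h1).1
    rw [decode_code] at h2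
    have h3 := code_map σ.firstEnd_injective σ.lists.swap
    exact h3 ▸ h2

/-- The splittings of exchanges in the same class lead to the same classes. -/
theorem exists_succ_cls_eq {n : ℕ} {τ σ : IntervalExchange n} (h : τ.cls = σ.cls)
    (hτ : τ.Splittable) (hσ : σ.Splittable) (d : Bool) :
    ∃ d', (σ.succ d').cls = (τ.succ d).cls := by
  obtain ⟨e, he | he⟩ := exists_of_cls_eq h
  · refine ⟨d, cls_map e ?_⟩
    rw [lists_succ hσ, he, splitListsDir_map e.injective, lists_succ hτ]
  · refine ⟨!d, ?_⟩
    rw [← cls_flip (τ.succ d)]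
    refine cls_map e ?_
    rw [lists_succ hσ, he, splitListsDir_map e.injective, ← lists_succ hτ.flip, succ_flip hτ,
      Bool.not_not]

end IntervalExchange

namespace ExchangeClass

open IntervalExchange ExchangeCode

theorem Edge.exists_succ {x y : ExchangeClass} (h : Edge x y) {τ : IntervalExchange 7}
    (hτ : τ.cls = x) : ∃ d, (τ.succ d).cls = y := by
  obtain ⟨hx, -, n, σ, ρ, w, w', hσ, rfl, -, hs⟩ := h
  obtain rfl : n = 7 := eq_of_cls_eq (hσ.trans hτ.symm)
  have h1 := hs.splittable.1
  have h2 := congrArg Prod.fst hs.eq_splitStep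
  simp only at h2
  rw [h2]
  exact exists_succ_cls_eq (hσ.trans hτ.symm) h1
    (splittable_of_mem_census (code_mem_census_of_cls (hτ ▸ hx))) _

end ExchangeClass

namespace IntervalExchange

open ExchangeCode ExchangeClass

/-- Positive weights on the result of a splitting come from positive weights. -/
theorem Splittable.exists_cut_eq {n : ℕ} [NeZero n] {τ : IntervalExchange n} (h : τ.Splittable)
    (d : Bool) {w' : Fin n → ℝ} (hw' : w' ∈ (τ.succ d).switchSpace) (hpos : ∀ i, 0 < w' i) :
    ∃ w ∈ τ.switchSpace, (∀ i, 0 < w i) ∧ w (τ.loser d) < w (τ.winner d) ∧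
      cut (τ.winner d) (τ.loser d) w = w' := by
  set e := cutEquiv (h.winner_ne_loser d)
  have he : cut (τ.winner d) (τ.loser d) (e.symm w') = w' := e.apply_symm_apply w'
  have h1 := (cut_pos_iff (h.winner_ne_loser d)).1 (he.symm ▸ hpos)
  exact ⟨e.symm w', (cut_mem_switchSpace_iff h d).1 (he.symm ▸ hw'), h1.1, h1.2, he⟩

variable {τ : IntervalExchange 7}

theorem mem_completeGenusTwo_of_mem_census (h : code τ.lists ∈ census) :
    τ.cls ∈ completeGenusTwo :=
  ⟨7, τ, isCompleteGenusTwo_of_mem_census h, rfl⟩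

theorem edge_succ (h : code τ.lists ∈ census) {d : Bool} {w : Fin 7 → ℝ}
    (hw : w ∈ τ.switchSpace) (hpos : ∀ i, 0 < w i) (hlt : w (τ.loser d) < w (τ.winner d)) :
    Edge τ.cls (τ.succ d).cls := by
  have hs := splittable_of_mem_census h
  obtain ⟨hne, hd⟩ := ne_of_loser_lt_winner hlt
  have h1 := (cut_mem_switchSpace_iff hs d).2 hw
  have h2 := (cut_pos_iff (hs.winner_ne_loser d)).2 ⟨hpos, hlt⟩
  have h3 := succ_mem_census h d ⟨_, ⟨h1, fun i => (h2 i).le⟩, h2⟩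
  refine ⟨mem_completeGenusTwo_of_mem_census h, mem_completeGenusTwo_of_mem_census h3, 7, τ,
    τ.succ d, w, cut (τ.winner d) (τ.loser d) w, rfl, rfl, ⟨hw, fun i => (hpos i).le⟩, ?_⟩
  have h4 := splits_splitStep hs hne
  rw [splitStep] at h4
  simp only [hd] at h4
  exact h4

/-- Both splittings of a complete exchange are realized by weights as soon as the result is
recurrent. -/
theorem edge_succ_of_mem_census (h : code τ.lists ∈ census) (d : Bool)
    (h' : code (τ.succ d).lists ∈ census) : Edge τ.cls (τ.succ d).cls := by
  obtain ⟨w', hw', hpos', -⟩ := exists_noConnection h'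
  obtain ⟨w, hw, hpos, hlt, -⟩ := (splittable_of_mem_census h).exists_cut_eq d hw' hpos'
  exact edge_succ h hw hpos hlt

/-- Every complete exchange can be split until it becomes the standard exchange. -/
theorem reflTransGen_standardExchange (h : code τ.lists ∈ census) :
    Relation.ReflTransGen Edge τ.cls standardExchange.cls := by
  have h1 : code standardExchange.lists = code standardLists :=
    (code_map Fin.val_injective standardExchange.lists).symm
  have h2 : code standardExchange.flip.lists = code standardLists.swap :=
    (code_map Fin.val_injective standardExchange.flip.lists).symm
  let P : ℕ → Prop := fun k => k ∈ census ∧ ∀ τ : IntervalExchange 7, code τ.lists = k →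
    Relation.ReflTransGen Edge τ.cls standardExchange.cls
  have hP := reaches_spec (P := P) 30 [code standardLists, code standardLists.swap]
    (census.map successors) ?_ ?_ census_facts.2.2.2
  · exact (hP _ (List.mem_map_of_mem h)).2 τ rfl
  · intro k hk
    rcases List.mem_cons.1 hk with rfl | hk
    · refine ⟨census_facts.1.1, fun τ hτ => ?_⟩
      rw [cls_eq_of_code_eq (hτ.trans h1.symm)]
    · rw [List.mem_singleton] at hk
      subst hk
      refine ⟨census_facts.1.2, fun τ hτ => ?_⟩
      rw [cls_eq_of_code_eq (hτ.trans h2.symm), cls_flip]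
  · intro t ht h3
    obtain ⟨k, hk, rfl⟩ := List.mem_map.1 ht
    have key : ∀ d, P (code (splitListsDir d (decode k))) → P k := by
      intro d hd
      refine ⟨hk, ?_⟩
      rintro τ rfl
      rw [← code_succ (splittable_of_mem_census hk)] at hd
      exact (hd.2 _ rfl).head (edge_succ_of_mem_census hk d hd.1)
    exact h3.elim (key true) (key false)

end IntervalExchange

namespace ExchangeClass

open IntervalExchange ExchangeCode

theorem standardExchange_mem_sink : standardExchange.cls ∈ sink := by
  constructor
  · refine mem_completeGenusTwo_of_mem_census ?_
    have h1 : code standardExchange.lists = code standardLists :=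
      (code_map Fin.val_injective standardExchange.lists).symm
    rw [h1]
    exact census_facts.1.1
  · rintro y hy
    obtain ⟨n, τ, hτ, rfl⟩ := id hy
    obtain rfl := hτ.eq_seven
    exact reflTransGen_standardExchange (code_mem_census hτ)

theorem sink_of_edge {x y : ExchangeClass} (hx : x ∈ sink) (h : Edge x y) : y ∈ sink :=
  ⟨h.2.1, fun z hz => (hx.2 z hz).tail h⟩

/-- The exchanges over the sink. -/
def sinkExchanges : Set (IntervalExchange 7) := {τ | τ.cls ∈ sink}

theorem code_mem_census_of_mem {τ : IntervalExchange 7} (h : τ ∈ sinkExchanges) :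
    code τ.lists ∈ census :=
  code_mem_census_of_cls h.1

theorem isSplittingFamily_sinkExchanges : IsSplittingFamily sinkExchanges where
  splittable _ hτ := splittable_of_mem_census (code_mem_census_of_mem hτ)
  exists_pos _ hτ := by
    obtain ⟨w, hw, hpos, -⟩ := exists_noConnection (code_mem_census_of_mem hτ)
    exact ⟨w, hw, hpos⟩
  succ_mem _ hτ _ hw hpos hne :=
    sink_of_edge hτ (edge_succ (code_mem_census_of_mem hτ) hw hpos (loser_lt_winner hne))
  irreducible _ hτ A A' B B' hA hB hne hne' := by
    obtain ⟨w, hw, -, h⟩ := exists_noConnection (code_mem_census_of_mem hτ)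
    exact ⟨w, hw, h A A' B B' hA hB hne hne'⟩

/-- The words along which the classes `S` are visited. -/
def wordsThrough (S : List ExchangeClass) (τ : IntervalExchange 7) : Set (List Bool) :=
  {v | S.length ≤ v.length + 1 ∧ ∀ (j : ℕ) (hj : j < S.length), (path τ (v.take j)).cls = S[j]}

/-- The word is the beginning of the splitting sequence of some positive weights. -/
def IsRealizable (τ : IntervalExchange 7) (u : List Bool) : Prop :=
  ∃ w ∈ τ.switchSpace, (∀ i, 0 < w i) ∧ Follows u (τ, w)

theorem IsRealizable.cons {τ : IntervalExchange 7} (h : τ.Splittable) {d : Bool} {u : List Bool}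
    (hu : IsRealizable (τ.succ d) u) : IsRealizable τ (d :: u) := by
  obtain ⟨w', hw', hpos', hf⟩ := hu
  obtain ⟨w, hw, hpos, hlt, rfl⟩ := h.exists_cut_eq d hw' hpos'
  exact ⟨w, hw, hpos, hlt, hf⟩

theorem isRealizable_nil {τ : IntervalExchange 7} (h : τ.cls ∈ completeGenusTwo) :
    IsRealizable τ [] := by
  obtain ⟨w, hw, hpos, -⟩ := exists_noConnection (code_mem_census_of_cls h)
  exact ⟨w, hw, hpos, trivial⟩

/-- A path in the graph of classes is realized by a word of splittings of any representative. -/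
theorem exists_wordsThrough (S : List ExchangeClass) : ∀ x, (x :: S).IsChain Edge →
    x ∈ completeGenusTwo → ∀ τ : IntervalExchange 7, τ.cls = x →
      ∃ v ∈ wordsThrough (x :: S) τ, IsRealizable τ v := by
  induction S with
  | nil =>
    rintro x - hx τ rfl
    refine ⟨[], ⟨by simp, fun j hj => ?_⟩, isRealizable_nil hx⟩
    obtain rfl : j = 0 := by simpa using hj
    rfl
  | cons y S ih =>
    rintro x hS hx τ rfl
    rw [List.isChain_cons_cons] at hS
    obtain ⟨d, hd⟩ := hS.1.exists_succ rfl
    obtain ⟨v, ⟨hv, hv'⟩, hr⟩ := ih y hS.2 hS.1.2.1 _ hd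
    refine ⟨d :: v, ⟨by simpa using hv, fun j hj => ?_⟩,
      hr.cons (splittable_of_mem_census (code_mem_census_of_cls hx))⟩
    cases j with
    | zero => rfl
    | succ j => exact hv' j (by simpa using hj)

/-- From every representative of `y` it is possible to split until the path `x :: S` is followed. -/
theorem exists_isRealizable {S : List ExchangeClass} {x : ExchangeClass}
    (hS : (x :: S).IsChain Edge) {y : ExchangeClass} (hy : y ∈ completeGenusTwo)
    (h : Relation.ReflTransGen Edge y x) : ∀ τ : IntervalExchange 7, τ.cls = y →
      ∃ u, ∃ v ∈ wordsThrough (x :: S) (path τ u), IsRealizable τ (u ++ v) := by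
  induction h using Relation.ReflTransGen.head_induction_on with
  | refl =>
    intro τ hτ
    obtain ⟨v, hv, hr⟩ := exists_wordsThrough S x hS hy τ hτ
    exact ⟨[], v, hv, hr⟩
  | head hyz _ ih =>
    rintro τ rfl
    obtain ⟨d, hd⟩ := hyz.exists_succ rfl
    obtain ⟨u, v, hv, hr⟩ := ih hyz.2.1 _ hd
    exact ⟨d :: u, v, hv, hr.cons (splittable_of_mem_census (code_mem_census_of_cls hy))⟩

theorem occursAt_of_follows {S : List ExchangeClass} {p : IntervalExchange 7 × (Fin 7 → ℝ)}
    {k : ℕ} {v : List Bool} (hv : v ∈ wordsThrough S (splitStep^[k] p).1)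
    (hf : Follows v (splitStep^[k] p)) : OccursAt S (fun k => splitStep^[k] p) k := by
  intro j hj
  have h1 := hv.2 j hj
  have h2 : v.take j = word (splitStep^[k] p) j := by
    have h3 := hv.1
    rw [← List.take_append_drop j v, follows_append] at hf
    have h4 := hf.1.eq_word
    rwa [List.length_take, min_eq_left (by omega)] at h4
  rw [h2, path_word, ← Function.iterate_add_apply, add_comm j k] at h1
  exact h1

theorem measure_not_pos {τ : IntervalExchange 7} (hτ : τ ∈ sinkExchanges) :
    τ.weightMeasure {w | ∃ i, w i = 0} = 0 := by
  obtain ⟨v, hv, hpos⟩ := isSplittingFamily_sinkExchanges.exists_pos τ hτ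
  rw [Set.ofPred_exists]
  exact measure_iUnion_null fun i =>
    weightMeasure_ker τ (LinearMap.proj i) hv (hpos i).ne'

theorem splittingIsNormal : SplittingIsNormal := by
  refine ⟨⟨_, standardExchange_mem_sink⟩, fun S hS hsink n τ hτ => ?_⟩
  obtain ⟨m, σ, hσ, hcls⟩ := id hτ.1
  obtain rfl := hσ.eq_seven
  obtain rfl := eq_of_cls_eq hcls
  have hT := isSplittingFamily_sinkExchanges
  have hU : ∀ τ ∈ sinkExchanges, ∃ w₀ ∈ τ.switchSpace, (∀ i, 0 < w₀ i) ∧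
      ∃ u, ∃ v ∈ wordsThrough S (path τ u), Follows (u ++ v) (τ, w₀) := by
    intro τ hτ
    cases S with
    | nil =>
      obtain ⟨w, hw, hpos⟩ := hT.exists_pos τ hτ
      exact ⟨w, hw, hpos, [], [], ⟨by simp, by simp⟩, trivial⟩
    | cons x S =>
      obtain ⟨u, v, hv, w, hw, hpos, hf⟩ :=
        exists_isRealizable hS hτ.1 ((hsink x (by simp)).2 _ hτ.1) τ rfl
      exact ⟨w, hw, hpos, u, v, hv, hf⟩
  have hnull := measure_union_null (hT.measure_not_frequently hU hτ) (measure_not_pos hτ)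
  rw [weightMeasure_apply] at hnull
  refine measure_mono_null (fun w hw => ?_) hnull
  by_contra hgood
  refine hw fun hML => ?_
  have hpos : ∀ i, 0 < (w : Fin 7 → ℝ) i := fun i =>
    (hML.2 i).lt_of_ne' fun h => hgood (Or.inr ⟨i, h⟩)
  obtain ⟨hgen, hfreq⟩ := not_not.1 fun h => hgood (Or.inl ⟨hML.1, hpos, h⟩)
  refine ⟨fun k => splitStep^[k] (τ, (w : Fin 7 → ℝ)), rfl, fun k => ?_, hfreq.mono ?_⟩
  · obtain ⟨h1, h2⟩ := hT.iterate hgen hτ k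
    have hs := hT.splittable _ h2
    simp only [Function.iterate_succ_apply']
    exact splits_splitStep hs (h1.ne hs)
  · rintro k ⟨v, hv, hf⟩
    exact occursAt_of_follows hv hf

end ExchangeClass

theorem theorem10p3 :
    ExchangeClass.SplittingIsNormal ∧ standardExchange.cls ∈ ExchangeClass.sink :=
  ⟨ExchangeClass.splittingIsNormal, ExchangeClass.standardExchange_mem_sink⟩
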